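/- **Setting.** Let $(\boldsymbol a_n)_{n\ge0}$, $\boldsymbol a_n=[a_{x,n},a_{y,n}]^T\in\mathbb C^2$, be i.i.d. with zero mean and finite sixth moments, and write $a_x,a_y$ for the components of a generic symbol. Let $R_s>0$, and let $P$ be the spectrum of a real pulse $p$: $P$ is measurable, bounded, continuous almost everywhere, $P(-f)=P^*(f)$ for all $f$, $P(f)=0$ for $|f|>R_s/2$, and $p(t)=\int P(f)e^{j2\pi ft}df$ for a.e. $t$. For $W\ge1$ put $\Delta_f=R_s/W$. The transmitted periodic signal has, in polarisation $q\in\{x,y\}$, the spectral lines $C_{q,k}=\sqrt{\Delta_f}\,P(k\Delta_f)\,\nu_{q,k}$ at the frequencies $k\Delta_f$, $k\in\mathbb Z$, where $\nu_{q,k}=\sqrt{\Delta_f}\sum_{n=0}^{W-1}a_{q,n}e^{-j2\pi kn/W}$. It is sent over $N_s$ fibre spans of length $L_s>0$ governed by the Manakov equation $\partial_z\boldsymbol E=-\frac\alpha2\boldsymbol E-j\frac{\beta_2}2\partial_t^2\boldsymbol E+j\frac89\gamma|\boldsymbol E|^2\boldsymbol E$ ($\alpha>0$, $\beta_2,\gamma\in\mathbb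 R$), each span followed by an amplifier with field gain $e^{\alpha L_s/2}$. Let $c_{q,i}$ be the line at $i\Delta_f$, polarisation $q$, of the term of first order in $\gamma$ of the regular perturbation (RP) expansion of the field at the end of the link, after multiplication by $e^{-j2\pi^2\beta_2(i\Delta_f)^2N_sL_s}$ (dispersion compensation). The PSD of the first-order nonlinear interference (NLI) of the periodic signal is $\sum_i\mathbb E\{|c_{q,i}|^2\}\,\delta(f-i\Delta_f)$. Let $$\eta(f_1,f_2,f)=\frac{1-e^{-\alpha L_s}e^{j\varphi L_s}}{\alpha-j\varphi}\sum_{l=1}^{N_s}e^{j\varphi(l-1)L_s},\qquad \varphi=4\pi^2\beta_2(f-f_1)(f_2-f_1).$$ **Expansion.** Number the six factors of $\nu_{s,k}\nu_{s,m}^*\nu_{q,n}\nu_{t,k'}^*\nu_{t,m'}\nu_{q,n'}^*$ by $1,\dots,6$; let $u_1,\dots,u_6=a_s,a_s^*,a_q,a_t^*,a_t,a_q^*$ and $(\kappa_1,\dots,\kappa_6)=(k,-m,n,-k',m',-n')$. For set partitions $\pi,\sigma$ of $\{1,\dots,6\}$ put $M_\pi=\prod_{B\in\pi}\mathbb E\{\prod_{j\in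 B}u_j\}$ (the correlation when the time indices coincide exactly within the blocks of $\pi$); for $\pi$ refining $\sigma$ put $\mu(\pi,\sigma)=\prod_{B\in\sigma}(-1)^{n_B-1}(n_B-1)!$, $n_B$ being the number of blocks of $\pi$ inside $B$, and $w^{q}_{s,t}(\sigma)=\sum_{\pi\le\sigma}\mu(\pi,\sigma)M_\pi$. For a set $\mathcal T$ of partitions and a function $d$ on $\mathbb Z$ let $$r_{q,i}[\mathcal T,d]=\left(\tfrac89\right)^2\gamma^2\Delta_f^2\sum_{\substack{k-m+n=i\\k'-m'+n'=i}}\mathsf P\sum_{s,t\in\{x,y\}}\sum_{\sigma\in\mathcal T}\Delta_f^3W^{|\sigma|}\,w^q_{s,t}(\sigma)\prod_{B\in\sigma}d\Big(\sum_{j\in B}\kappa_j\Big),$$ $$\mathsf P=P(k\Delta_f)P^*(m\Delta_f)P(n\Delta_f)P^*(k'\Delta_f)P(m'\Delta_f)P^*(n'\Delta_f)\,\eta(k\Delta_f,m\Delta_f,i\Delta_f)\,\eta^*(k'\Delta_f,m'\Delta_f,i\Delta_f).$$ The full coefficient $r^{\rm full}_{q,i}$ takes all partitions and $d(r)=1$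 if $W\mid r$, $d(r)=0$ otherwise. The reduced coefficient $r_{q,i}$ drops the bias terms, i.e. the partitions having $\{1,2\}$, $\{2,3\}$, $\{4,5\}$ or $\{5,6\}$ as a block and the partition $\{\{1,2,3\},\{4,5,6\}\}$, and drops the terms $r=pW$, $p\ne0$, i.e. it takes $d(r)=1$ if $r=0$ and $d(r)=0$ otherwise. **Theorem.** (i) For every $W\ge1$ and every realisation of the symbols the lines $c_{q,i}$ exist and are unique; $\mathbb E\{|c_{q,i}|^2\}<\infty$ and $\mathbb E\{|c_{q,i}|^2\}=\Delta_f\,r^{\rm full}_{q,i}$ for all $q,i$. (ii) There are real functions $S_x,S_y$ on $\mathbb R$ such that, for every $f$, $$\begin{aligned}S_x(f)=\left(\tfrac89\right)^2\gamma^2\Big[&R_s^3[\Phi_1\chi_1+\Phi_2\chi_2+\Phi_3\chi_3]+R_s^2[\Psi_1\chi_4+2\Re\{\Psi_2\chi_5+\Psi_3\chi_5^*\}+\Psi_4\chi_6\\&+2\Re\{\Lambda_1\chi_7+\Lambda_2\chi_7^*\}+\Lambda_3\chi_8+2\Re\{\Lambda_4\chi_9+\Lambda_5\chi_9^*\}+\Lambda_6\chi_{10}]+R_s\Xi_1\chi_{11}\Big],\end{aligned}$$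 $S_y$ is given by the same formula with $x$ and $y$ exchanged, and, for $q\in\{x,y\}$, $S_q$ is the limit of the reduced PSD as $\Delta_f\to0$: (a) if $W_n\to\infty$, $i_nR_s/W_n\to f$ and $P(i_nR_s/W_n)\to P(f)$, then the reduced coefficient $r_{q,i_n}$ for $W=W_n$ tends to $S_q(f)$; (b) for every continuous $\psi:\mathbb R\to\mathbb C$, $\sum_i\Delta_f\,r_{q,i}\,\psi(i\Delta_f)\to\int S_q\psi\,df$ as $W\to\infty$. (iii) The NLI power vector is $\boldsymbol\Sigma_{\rm NLI}=\big[\int_{-\infty}^\infty S_x|P|^2df,\int_{-\infty}^\infty S_y|P|^2df\big]^T$; these integrals converge absolutely, equal the integrals over $[-R_s/2,R_s/2]$, and are the limits as $W\to\infty$ of $\sum_i\Delta_f\,r_{q,i}|P(i\Delta_f)|^2$, $q=x,y$. **Coefficients.** Here $A=\mathbb E\{|a_x|^2\}$, $B=\mathbb E\{|a_y|^2\}$, $G=\mathbb E\{a_x^2\}$, $H=\mathbb E\{a_y^2\}$, $K=\mathbb E\{a_xa_y\}$, $D=\mathbb E\{a_xa_y^*\}$. - $\Phi_1=2A^3+4A|D|^2+AB^2+|D|^2B$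 - $\Phi_2=4A|G|^2+A|H|^2+4A|K|^2+|K|^2B+2\Re\{KD^*H^*+2G^*KD\}$ - $\Phi_3=A|G|^2+|K|^2B+2\Re\{GK^*D^*\}$ - $\Psi_1=4|\mathbb E\{a_x|a_x|^2\}|^2+4|\mathbb E\{|a_x|^2a_y\}|^2+2\Re\{\mathbb E\{|a_x|^2a_y\}\mathbb E\{a_y^*|a_y|^2\}\}+|\mathbb E\{a_x|a_y|^2\}|^2+|\mathbb E\{a_x^*a_y^2\}|^2+4\Re\{\mathbb E\{a_x^*|a_x|^2\}\mathbb E\{a_x|a_y|^2\}\}$ - $\Psi_2=2|\mathbb E\{a_x|a_x|^2\}|^2+2|\mathbb E\{|a_x|^2a_y\}|^2+\mathbb E\{|a_x|^2a_y^*\}\mathbb E\{a_y|a_y|^2\}+|\mathbb E\{a_x|a_y|^2\}|^2$ - $\Psi_3=\mathbb E\{a_x|a_x|^2\}\mathbb E\{a_x^*|a_y|^2\}+|\mathbb E\{a_x^2a_y^*\}|^2$ - $\Psi_4=|\mathbb E\{a_x^3\}|^2+2|\mathbb E\{a_x^2a_y\}|^2+|\mathbb E\{a_xa_y^2\}|^2$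 - $\Lambda_1=-3A|G|^2+\mathbb E^*\{a_x^2|a_x|^2\}G-|G|^2B-2|K|^2B+G\,\mathbb E^*\{a_x^2|a_y|^2\}-2GK^*D^*+K\,\mathbb E^*\{a_xa_y|a_y|^2\}-KD^*H^*$ - $\Lambda_2=-2A|K|^2+K^*\mathbb E\{a_xa_y|a_x|^2\}-GK^*D^*$ - $\Lambda_3=4\mathbb E\{|a_x|^4\}A-4A|G|^2-8A^3+4A\,\mathbb E\{|a_x|^2|a_y|^2\}-12A|D|^2-4A|K|^2-4A^2B-3AB^2-A|H|^2+\mathbb E\{|a_x|^2|a_y|^2\}B+A\,\mathbb E\{|a_y|^4\}-5|D|^2B-|K|^2B+2\Re\{2D\,\mathbb E\{a_x^*a_y|a_x|^2\}-2G^*KD-KD^*H^*+D^*\mathbb E\{a_xa_y^*|a_y|^2\}\}$ - $\Lambda_4=-6A|G|^2+2\mathbb E^*\{a_x^2|a_x|^2\}G-4A|K|^2-A|H|^2+\mathbb E^*\{|a_x|^2a_y^2\}H+2K\,\mathbb E^*\{a_xa_y|a_x|^2\}-2|K|^2B-2G^*KD+K\,\mathbb E^*\{a_xa_y|a_y|^2\}-K^*DH-2\Re\{K^*DH\}$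 - $\Lambda_5=-2A|K|^2+K^*\mathbb E\{a_xa_y|a_x|^2\}+G^*\mathbb E\{a_x^2|a_y|^2\}-|G|^2B-G^*KD-2\Re\{GK^*D^*\}$ - $\Lambda_6=-2A^3+\mathbb E\{|a_x|^4\}A-A|G|^2-4A|D|^2-AB^2+\mathbb E\{|a_x|^2|a_y|^2\}B-|D|^2B-|K|^2B+2\Re\{D\,\mathbb E\{a_x^*a_y|a_x|^2\}-GK^*D^*\}$ - $\Xi_1=\mathbb E\{|a_x|^6\}-9\mathbb E\{|a_x|^4\}A+12A^3-2\mathbb E\{|a_x|^4\}B+\mathbb E\{|a_x|^2|a_y|^4\}-8A\,\mathbb E\{|a_x|^2|a_y|^2\}-4\mathbb E\{|a_x|^2|a_y|^2\}B+2\mathbb E\{|a_x|^4|a_y|^2\}-A\,\mathbb E\{|a_y|^4\}+4AB^2+8A^2B+18A|G|^2-|\mathbb E\{a_x^3\}|^2-9|\mathbb E\{a_x|a_x|^2\}|^2+2A|H|^2-4|\mathbb E\{a_x|a_y|^2\}|^2+8|D|^2B+8|K|^2B-|\mathbb E\{a_xa_y^2\}|^2-|\mathbb E\{a_x^*a_y^2\}|^2+16A|D|^2-2|\mathbb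 E\{a_x^2a_y^*\}|^2+16A|K|^2+4|G|^2B-2|\mathbb E\{a_x^2a_y\}|^2-8|\mathbb E\{|a_x|^2a_y\}|^2-2\Re\{3\mathbb E\{a_x^2|a_x|^2\}G^*+2\mathbb E\{|a_x|^2a_y\}\mathbb E\{a_y^*|a_y|^2\}+\mathbb E\{|a_x|^2a_y^2\}H^*-4KD^*H^*+2K\,\mathbb E^*\{a_xa_y|a_y|^2\}+2D\,\mathbb E\{a_x^*a_y|a_y|^2\}+4\mathbb E\{a_x^*|a_x|^2\}\mathbb E\{a_x|a_y|^2\}+2G\,\mathbb E^*\{a_x^2|a_y|^2\}+4D\,\mathbb E\{a_x^*a_y|a_x|^2\}-8GK^*D^*+4K\,\mathbb E^*\{a_xa_y|a_x|^2\}\}$ **Integrals.** All variables run over $[-R_s/2,R_s/2]$; $g=f-f_1+f_2$ and $\eta=\eta(f_1,f_2,f)$. - $\chi_1=\iint|P(f_1)|^2|P(f_2)|^2|P(g)|^2|\eta|^2\,df_1df_2$ - $\chi_2=\iint|P(f_1)|^2|P(f_2)|^2|P(g)|^2\,\eta\,\eta^*(f_1,-f+f_1-f_2,f)\,df_1df_2$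 - $\chi_3=|P(f)|^2\left|\int|P(f_1)|^2\eta(f_1,-f,f)\,df_1\right|^2$ - $\chi_4=\iiint P(f_1)P^*(f_2)P(g)P^*(f_1-f_2)P(f_3)P^*(g+f_3)\,\eta\,\eta^*(f_1-f_2,f_3,f)\,df_1df_2df_3$ - $\chi_5=\iiint P(f_1)P^*(f_2)P(g)P^*(f_3)P(f_2-f_1)P^*(g-f_3)\,\eta\,\eta^*(f_3,f_2-f_1,f)\,df_1df_2df_3$ - $\chi_6=\iiint P(f_1)P^*(f_2)P(g)P^*(f_3)P^*(f+f_2)P(f_2+f_3)\,\eta\,\eta^*(f_3,-f-f_2,f)\,df_1df_2df_3$ - $\chi_7=P(f)\iiint|P(f_1)|^2P^*(f_2)P(f_3)P^*(f-f_2+f_3)\,\eta(f_1,-f,f)\,\eta^*(f_2,f_3,f)\,df_1df_2df_3$ - $\chi_8=\iiint|P(f_1)|^2P^*(f_2)P(g)P(f_3)P^*(f-f_1+f_3)\,\eta\,\eta^*(f_1,f_3,f)\,df_1df_2df_3$ - $\chi_9=\iiint|P(f_1)|^2P^*(f_2)P(g)P^*(f_3)P^*(f-f_1-f_3)\,\eta\,\eta^*(f_3,-f_1,f)\,df_1df_2df_3$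 - $\chi_{10}=\iiint P(f_1)|P(f_2)|^2P(g)P^*(f_3)P^*(f+f_2-f_3)\,\eta\,\eta^*(f_3,f_2,f)\,df_1df_2df_3$ - $\chi_{11}=\iiiint P(f_1)P^*(f_2)P(g)P^*(f_3)P(f_4)P^*(f-f_3+f_4)\,\eta\,\eta^*(f_3,f_4,f)\,df_1df_2df_3df_4$ -/

import Mathlib

open MeasureTheory ProbabilityTheory Filter Topology
open scoped ComplexConjugate

namespace FibreNLI

/-! ### Pulse, fibre link and transmitted periodic signal

The two polarisations `x`, `y` are the indices `0`, `1` of `Fin 2`; `1 - q` is the polarisation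
orthogonal to `q`. -/

/-- `P` is the spectrum of the real pulse `p`, strictly band-limited to `[-R/2, R/2]`.  The
regularity asked of `P` (bounded, continuous almost everywhere) is Riemann integrability, so that
the ideal rectangular spectrum is covered. -/
structure IsPulseSpectrum (R : ℝ) (p : ℝ → ℝ) (P : ℝ → ℂ) : Prop where
  measurable : Measurable P
  bounded : ∃ B : ℝ, ∀ f, ‖P f‖ ≤ B
  ae_continuousAt : ∀ᵐ f : ℝ, ContinuousAt P f
  bandlimited : ∀ f : ℝ, R / 2 < |f| → P f = 0
  hermitian : ∀ f : ℝ, P (-f) = conj (P f)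
  spectrum : ∀ᵐ t : ℝ, (p t : ℂ) = ∫ f : ℝ, P f * Complex.exp (2 * Real.pi * f * t * Complex.I)

/-- `spans` identical fibre spans of length `L`, each followed by an amplifier that exactly
recovers the span loss; `α`, `β₂`, `γ` are attenuation, group velocity dispersion and
nonlinearity coefficients. -/
structure Link where
  α : ℝ
  β₂ : ℝ
  γ : ℝ
  L : ℝ
  spans : ℕ

/-- Discrete Fourier transform `ν_{q,k} = √Δ ∑_{n<W} a_{q,n} exp(-2πi kn/W)` of one block of `W`
symbols. -/
noncomputable def dft (Δ : ℝ) (W : ℕ) (u : ℕ → Fin 2 → ℂ) (q : Fin 2) (k : ℤ) : ℂ :=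
  (Real.sqrt Δ : ℂ) *
    ∑ n ∈ Finset.range W, u n q * Complex.exp (-(2 * Real.pi * Complex.I * k * n / W))

/-- Amplitude `√Δ P(kΔ) ν_{q,k}` of the spectral line at frequency `kΔ` of the transmitted periodic
signal. -/
noncomputable def launch (P : ℝ → ℂ) (Δ : ℝ) (W : ℕ) (u : ℕ → Fin 2 → ℂ) (q : Fin 2) (k : ℤ) : ℂ :=
  (Real.sqrt Δ : ℂ) * P (k * Δ) * dft Δ W u q k

/-! ### First-order regular perturbation of the Manakov equation -/

/-- Line `i` of polarisation `q` of the Kerr term `|E|² E` of a periodic field with lines `E`. -/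
noncomputable def kerr (E : Fin 2 → ℤ → ℂ) (q : Fin 2) (i : ℤ) : ℂ :=
  ∑' km : ℤ × ℤ, (∑ s : Fin 2, E s km.1 * conj (E s km.2)) * E q (i - km.1 + km.2)

/-- `-α/2 + 2π²β₂f² i`: the linear part `-α/2 - i(β₂/2)∂_t²` of the Manakov equation at frequency
`f`. -/
noncomputable def linRate (lk : Link) (f : ℝ) : ℂ :=
  -(lk.α : ℂ) / 2 + 2 * (Real.pi : ℂ) ^ 2 * lk.β₂ * (f : ℂ) ^ 2 * Complex.I

/-- `E0`, `E1` are the terms of order zero and one in `γ` of the regular perturbation expansion of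
the solution of
`∂_z E = -(α/2) E - i (β₂/2) ∂_t² E + i (8/9) γ |E|² E`
for a periodic launch signal with lines `C` at the multiples of `Δ`.  `E0 l z q k` is line `k` of
polarisation `q` at distance `z` into span number `l` (counted from `0`); the value at `(l + 1, 0)`
is taken after the amplifier that ends span `l`. -/
structure IsFirstOrderRP (lk : Link) (Δ : ℝ) (C : Fin 2 → ℤ → ℂ)
    (E0 E1 : ℕ → ℝ → Fin 2 → ℤ → ℂ) : Prop where
  init_zero : ∀ q k, E0 0 0 q k = C q k
  init_one : ∀ q k, E1 0 0 q k = 0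
  ode_zero : ∀ l < lk.spans, ∀ q k, ∀ z ∈ Set.Icc 0 lk.L,
    HasDerivWithinAt (fun z => E0 l z q k) (linRate lk (k * Δ) * E0 l z q k) (Set.Icc 0 lk.L) z
  ode_one : ∀ l < lk.spans, ∀ q k, ∀ z ∈ Set.Icc 0 lk.L,
    HasDerivWithinAt (fun z => E1 l z q k)
      (linRate lk (k * Δ) * E1 l z q k + Complex.I * (8 / 9) * lk.γ * kerr (E0 l z) q k)
      (Set.Icc 0 lk.L) z
  amp_zero : ∀ l < lk.spans, ∀ q k,
    E0 (l + 1) 0 q k = (Real.exp (lk.α * lk.L / 2) : ℂ) * E0 l lk.L q k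
  amp_one : ∀ l < lk.spans, ∀ q k,
    E1 (l + 1) 0 q k = (Real.exp (lk.α * lk.L / 2) : ℂ) * E1 l lk.L q k

/-- `c q i` are the spectral lines of the first-order term at the end of the link, after ideal
chromatic dispersion compensation. -/
def IsReceivedNLI (lk : Link) (Δ : ℝ) (C c : Fin 2 → ℤ → ℂ) : Prop :=
  ∃ E0 E1 : ℕ → ℝ → Fin 2 → ℤ → ℂ, IsFirstOrderRP lk Δ C E0 E1 ∧
    ∀ q i, c q i =
      Complex.exp (-(2 * (Real.pi : ℂ) ^ 2 * ((i * Δ : ℝ) : ℂ) ^ 2 * lk.β₂ * lk.spans * lk.L *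
        Complex.I)) * E1 lk.spans 0 q i

/-- The link function `η(f₁, f₂, f)`. -/
noncomputable def eta (lk : Link) (f₁ f₂ f : ℝ) : ℂ :=
  let φ : ℂ := 4 * (Real.pi : ℂ) ^ 2 * lk.β₂ * ((f : ℂ) - f₁) * ((f₂ : ℂ) - f₁)
  (1 - Complex.exp (-(lk.α * lk.L)) * Complex.exp (Complex.I * φ * lk.L)) /
      (lk.α - Complex.I * φ) *
    ∑ l ∈ Finset.range lk.spans, Complex.exp (Complex.I * φ * l * lk.L)

/-! ### Expansion of the sixth-order correlations into Kronecker delta products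

The six positions are those of `ν_{s,k} ν*_{s,m} ν_{q,n} ν*_{t,k'} ν_{t,m'} ν*_{q,n'}`, numbered
`0, …, 5`; odd positions are conjugated. -/

/-- The symbol component at position `j`. -/
noncomputable def letter (q s t : Fin 2) (v : Fin 2 → ℂ) (j : Fin 6) : ℂ :=
  if Even (j : ℕ) then v (![s, s, q, t, t, q] j) else conj (v (![s, s, q, t, t, q] j))

/-- Sixth-order correlation of the symbols when the time indices coincide exactly within the blocks
of `π` (independence over time). -/
noncomputable def patternMoment {Ω : Type*} [MeasurableSpace Ω] (μ : Measure Ω)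
    (X : Ω → Fin 2 → ℂ) (q s t : Fin 2) (π : Finpartition (Finset.univ : Finset (Fin 6))) : ℂ :=
  ∏ B ∈ π.parts, ∫ ω, ∏ j ∈ B, letter q s t (X ω) j ∂μ

open Classical in
/-- Inclusion-exclusion number: the sum over time indices that coincide exactly within the blocks of
`π` is the sum over `σ` of this number times the sum over indices that are constant on the blocks of
`σ` and otherwise free. -/
noncomputable def exclusion (π σ : Finpartition (Finset.univ : Finset (Fin 6))) : ℂ :=
  if π ≤ σ then
    ∏ B ∈ σ.parts, (-1 : ℂ) ^ ((π.parts.filter (fun A => A ⊆ B)).card - 1) *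
      (Nat.factorial ((π.parts.filter (fun A => A ⊆ B)).card - 1) : ℂ)
  else 0

/-- Total moment weight of the delta product with one Kronecker delta for each block of `σ`. -/
noncomputable def deltaWeight {Ω : Type*} [MeasurableSpace Ω] (μ : Measure Ω)
    (X : Ω → Fin 2 → ℂ) (q s t : Fin 2) (σ : Finpartition (Finset.univ : Finset (Fin 6))) : ℂ :=
  ∑ π : Finpartition (Finset.univ : Finset (Fin 6)), exclusion π σ * patternMoment μ X q s t π

/-- Signed sum over the block `B` of the line indices `κ = (k, m, n, k', m', n')`. -/
def blockFreq (κ : Fin 6 → ℤ) (B : Finset (Fin 6)) : ℤ :=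
  ∑ j ∈ B, if Even (j : ℕ) then κ j else -κ j

/-- `P(kΔ)P*(mΔ)P(nΔ)P*(k'Δ)P(m'Δ)P*(n'Δ) η_{k,m,n} η*_{k',m',n'}`. -/
noncomputable def gridKernel (P : ℝ → ℂ) (lk : Link) (Δ : ℝ) (κ : Fin 6 → ℤ) : ℂ :=
  P (κ 0 * Δ) * conj (P (κ 1 * Δ)) * P (κ 2 * Δ) *
    conj (P (κ 3 * Δ)) * P (κ 4 * Δ) * conj (P (κ 5 * Δ)) *
    eta lk (κ 0 * Δ) (κ 1 * Δ) ((κ 0 - κ 1 + κ 2) * Δ) *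
    conj (eta lk (κ 3 * Δ) (κ 4 * Δ) ((κ 3 - κ 4 + κ 5) * Δ))

/-- The part of the PSD coefficient of line `i` (per unit `Δ`) carried by the delta products in `T`,
each Kronecker delta being evaluated by `δ`.  The sum runs over `(k, m, k', m') ∈ ℤ⁴`, with
`n = i - k + m` and `n' = i - k' + m'`. -/
noncomputable def psdCoeff {Ω : Type*} [MeasurableSpace Ω] (μ : Measure Ω) (X : Ω → Fin 2 → ℂ)
    (P : ℝ → ℂ) (lk : Link) (Δ : ℝ) (W : ℕ)
    (T : Finset (Finpartition (Finset.univ : Finset (Fin 6)))) (δ : ℤ → ℂ)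
    (q : Fin 2) (i : ℤ) : ℂ :=
  (8 / 9) ^ 2 * (lk.γ : ℂ) ^ 2 * (Δ : ℂ) ^ 2 *
    ∑' v : ℤ × ℤ × ℤ × ℤ,
      (let κ : Fin 6 → ℤ :=
        ![v.1, v.2.1, i - v.1 + v.2.1, v.2.2.1, v.2.2.2, i - v.2.2.1 + v.2.2.2]
      gridKernel P lk Δ κ *
        ∑ s : Fin 2, ∑ t : Fin 2, ∑ σ ∈ T,
          (Δ : ℂ) ^ 3 * (W : ℂ) ^ σ.parts.card * deltaWeight μ X q s t σ *
            ∏ B ∈ σ.parts, δ (blockFreq κ B))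

/-- All delta products, with all Kronecker deltas modulo `W`. -/
noncomputable def psdCoeffFull {Ω : Type*} [MeasurableSpace Ω] (μ : Measure Ω) (X : Ω → Fin 2 → ℂ)
    (P : ℝ → ℂ) (lk : Link) (Δ : ℝ) (W : ℕ) (q : Fin 2) (i : ℤ) : ℂ :=
  psdCoeff μ X P lk Δ W Finset.univ (fun r => if (W : ℤ) ∣ r then 1 else 0) q i

/-- Bias terms: delta products with one of the factors `δ_{k-m}`, `δ_{n-m}`, `δ_{k'-m'}`,
`δ_{n'-m'}`; and the product `δ_{k-m+n} δ_{k'-m'+n'}`, which only lives at frequency zero. -/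
def IsBias (σ : Finpartition (Finset.univ : Finset (Fin 6))) : Prop :=
  {0, 1} ∈ σ.parts ∨ {1, 2} ∈ σ.parts ∨ {3, 4} ∈ σ.parts ∨ {4, 5} ∈ σ.parts ∨
    σ.parts = {{0, 1, 2}, {3, 4, 5}}

open Classical in
/-- The PSD coefficient of line `i` without the bias terms and without the aliases `p ≠ 0`: only
`r = 0` is kept among the solutions `r = pW` of each Kronecker delta. -/
noncomputable def psdCoeffKept {Ω : Type*} [MeasurableSpace Ω] (μ : Measure Ω) (X : Ω → Fin 2 → ℂ)
    (P : ℝ → ℂ) (lk : Link) (Δ : ℝ) (W : ℕ) (q : Fin 2) (i : ℤ) : ℂ :=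
  psdCoeff μ X P lk Δ W (Finset.univ.filter fun σ => ¬ IsBias σ) (fun r => if r = 0 then 1 else 0)
    q i

/-! ### Coefficients of the final formula -/

/-- `E{X^a (X*)^b Y^c (Y*)^d}`. -/
noncomputable def moment {Ω : Type*} [MeasurableSpace Ω] (μ : Measure Ω) (X Y : Ω → ℂ)
    (a b c d : ℕ) : ℂ :=
  ∫ ω, X ω ^ a * conj (X ω) ^ b * Y ω ^ c * conj (Y ω) ^ d ∂μ

/-- `|z|²`. -/
noncomputable def absSq (z : ℂ) : ℂ := ((‖z‖ ^ 2 : ℝ) : ℂ)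

/-- `2 Re z`. -/
noncomputable def twoRe (z : ℂ) : ℂ := ((2 * z.re : ℝ) : ℂ)

noncomputable def coefPhi1 (E : ℕ → ℕ → ℕ → ℕ → ℂ) : ℂ :=
  2 * (E 1 1 0 0) ^ 3 + 4 * E 1 1 0 0 * absSq (E 1 0 0 1) + E 1 1 0 0 * (E 0 0 1 1) ^ 2 +
  absSq (E 1 0 0 1) * E 0 0 1 1

noncomputable def coefPhi2 (E : ℕ → ℕ → ℕ → ℕ → ℂ) : ℂ :=
  4 * E 1 1 0 0 * absSq (E 2 0 0 0) + E 1 1 0 0 * absSq (E 0 0 2 0) + 4 * E 1 1 0 0 *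
  absSq (E 1 0 1 0) + absSq (E 1 0 1 0) * E 0 0 1 1 + twoRe (E 1 0 1 0 * E 0 1 1 0 *
  conj (E 0 0 2 0) + 2 * conj (E 2 0 0 0) * E 1 0 1 0 * E 1 0 0 1)

noncomputable def coefPhi3 (E : ℕ → ℕ → ℕ → ℕ → ℂ) : ℂ :=
  E 1 1 0 0 * absSq (E 2 0 0 0) + absSq (E 1 0 1 0) * E 0 0 1 1 + twoRe (E 2 0 0 0 *
  conj (E 1 0 1 0) * E 0 1 1 0)

noncomputable def coefPsi1 (E : ℕ → ℕ → ℕ → ℕ → ℂ) : ℂ :=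
  4 * absSq (E 2 1 0 0) + 4 * absSq (E 1 1 1 0) + twoRe (E 1 1 1 0 * E 0 0 1 2) +
  absSq (E 1 0 1 1) + absSq (E 0 1 2 0) + 2 * twoRe (E 1 2 0 0 * E 1 0 1 1)

noncomputable def coefPsi2 (E : ℕ → ℕ → ℕ → ℕ → ℂ) : ℂ :=
  2 * absSq (E 2 1 0 0) + 2 * absSq (E 1 1 1 0) + E 1 1 0 1 * E 0 0 2 1 + absSq (E 1 0 1 1)

noncomputable def coefPsi3 (E : ℕ → ℕ → ℕ → ℕ → ℂ) : ℂ :=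
  E 2 1 0 0 * E 0 1 1 1 + absSq (E 2 0 0 1)

noncomputable def coefPsi4 (E : ℕ → ℕ → ℕ → ℕ → ℂ) : ℂ :=
  absSq (E 3 0 0 0) + 2 * absSq (E 2 0 1 0) + absSq (E 1 0 2 0)

noncomputable def coefLam1 (E : ℕ → ℕ → ℕ → ℕ → ℂ) : ℂ :=
  -3 * E 1 1 0 0 * absSq (E 2 0 0 0) + conj (E 3 1 0 0) * E 2 0 0 0 - absSq (E 2 0 0 0) *
  E 0 0 1 1 - 2 * absSq (E 1 0 1 0) * E 0 0 1 1 + E 2 0 0 0 * conj (E 2 0 1 1) - 2 * E 2 0 0 0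
  * conj (E 1 0 1 0) * E 0 1 1 0 + E 1 0 1 0 * conj (E 1 0 2 1) - E 1 0 1 0 * E 0 1 1 0 *
  conj (E 0 0 2 0)

noncomputable def coefLam2 (E : ℕ → ℕ → ℕ → ℕ → ℂ) : ℂ :=
  -2 * E 1 1 0 0 * absSq (E 1 0 1 0) + conj (E 1 0 1 0) * E 2 1 1 0 - E 2 0 0 0 *
  conj (E 1 0 1 0) * E 0 1 1 0

noncomputable def coefLam3 (E : ℕ → ℕ → ℕ → ℕ → ℂ) : ℂ :=
  4 * E 2 2 0 0 * E 1 1 0 0 - 4 * E 1 1 0 0 * absSq (E 2 0 0 0) - 8 * (E 1 1 0 0) ^ 3 + 4 *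
  E 1 1 0 0 * E 1 1 1 1 - 12 * E 1 1 0 0 * absSq (E 1 0 0 1) - 4 * E 1 1 0 0 *
  absSq (E 1 0 1 0) - 4 * (E 1 1 0 0) ^ 2 * E 0 0 1 1 - 3 * E 1 1 0 0 * (E 0 0 1 1) ^ 2 -
  E 1 1 0 0 * absSq (E 0 0 2 0) + E 1 1 1 1 * E 0 0 1 1 + E 1 1 0 0 * E 0 0 2 2 - 5 *
  absSq (E 1 0 0 1) * E 0 0 1 1 - absSq (E 1 0 1 0) * E 0 0 1 1 + twoRe (2 * E 1 0 0 1 *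
  E 1 2 1 0 - 2 * conj (E 2 0 0 0) * E 1 0 1 0 * E 1 0 0 1 - E 1 0 1 0 * E 0 1 1 0 *
  conj (E 0 0 2 0) + E 0 1 1 0 * E 1 0 1 2)

noncomputable def coefLam4 (E : ℕ → ℕ → ℕ → ℕ → ℂ) : ℂ :=
  -6 * E 1 1 0 0 * absSq (E 2 0 0 0) + 2 * conj (E 3 1 0 0) * E 2 0 0 0 - 4 * E 1 1 0 0 *
  absSq (E 1 0 1 0) - E 1 1 0 0 * absSq (E 0 0 2 0) + conj (E 1 1 2 0) * E 0 0 2 0 + 2 *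
  E 1 0 1 0 * conj (E 2 1 1 0) - 2 * absSq (E 1 0 1 0) * E 0 0 1 1 - 2 * conj (E 2 0 0 0) *
  E 1 0 1 0 * E 1 0 0 1 + E 1 0 1 0 * conj (E 1 0 2 1) - conj (E 1 0 1 0) * E 1 0 0 1 *
  E 0 0 2 0 - twoRe (conj (E 1 0 1 0) * E 1 0 0 1 * E 0 0 2 0)

noncomputable def coefLam5 (E : ℕ → ℕ → ℕ → ℕ → ℂ) : ℂ :=
  -2 * E 1 1 0 0 * absSq (E 1 0 1 0) + conj (E 1 0 1 0) * E 2 1 1 0 + conj (E 2 0 0 0) *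
  E 2 0 1 1 - absSq (E 2 0 0 0) * E 0 0 1 1 - conj (E 2 0 0 0) * E 1 0 1 0 * E 1 0 0 1 -
  twoRe (E 2 0 0 0 * conj (E 1 0 1 0) * E 0 1 1 0)

noncomputable def coefLam6 (E : ℕ → ℕ → ℕ → ℕ → ℂ) : ℂ :=
  -2 * (E 1 1 0 0) ^ 3 + E 2 2 0 0 * E 1 1 0 0 - E 1 1 0 0 * absSq (E 2 0 0 0) - 4 * E 1 1 0 0
  * absSq (E 1 0 0 1) - E 1 1 0 0 * (E 0 0 1 1) ^ 2 + E 1 1 1 1 * E 0 0 1 1 -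
  absSq (E 1 0 0 1) * E 0 0 1 1 - absSq (E 1 0 1 0) * E 0 0 1 1 + twoRe (E 1 0 0 1 * E 1 2 1 0
  - E 2 0 0 0 * conj (E 1 0 1 0) * E 0 1 1 0)

noncomputable def coefXi1 (E : ℕ → ℕ → ℕ → ℕ → ℂ) : ℂ :=
  (E 3 3 0 0 - 9 * E 2 2 0 0 * E 1 1 0 0 + 12 * (E 1 1 0 0) ^ 3 - 2 * E 2 2 0 0 * E 0 0 1 1 +
  E 1 1 2 2 - 8 * E 1 1 0 0 * E 1 1 1 1 - 4 * E 1 1 1 1 * E 0 0 1 1 + 2 * E 2 2 1 1 -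
  E 1 1 0 0 * E 0 0 2 2 + 4 * E 1 1 0 0 * (E 0 0 1 1) ^ 2 + 8 * (E 1 1 0 0) ^ 2 * E 0 0 1 1 +
  18 * E 1 1 0 0 * absSq (E 2 0 0 0) - absSq (E 3 0 0 0) - 9 * absSq (E 2 1 0 0) + 2 *
  E 1 1 0 0 * absSq (E 0 0 2 0) - 4 * absSq (E 1 0 1 1) + 8 * absSq (E 1 0 0 1) * E 0 0 1 1 +
  8 * absSq (E 1 0 1 0) * E 0 0 1 1 - absSq (E 1 0 2 0) - absSq (E 0 1 2 0) + 16 * E 1 1 0 0 *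
  absSq (E 1 0 0 1) - 2 * absSq (E 2 0 0 1) + 16 * E 1 1 0 0 * absSq (E 1 0 1 0) + 4 *
  absSq (E 2 0 0 0) * E 0 0 1 1 - 2 * absSq (E 2 0 1 0) - 8 * absSq (E 1 1 1 0) - twoRe (3 *
  E 3 1 0 0 * conj (E 2 0 0 0) + 2 * E 1 1 1 0 * E 0 0 1 2 + E 1 1 2 0 * conj (E 0 0 2 0) - 4
  * E 1 0 1 0 * E 0 1 1 0 * conj (E 0 0 2 0) + 2 * E 1 0 1 0 * conj (E 1 0 2 1) + 2 *
  E 1 0 0 1 * E 0 1 2 1 + 4 * E 1 2 0 0 * E 1 0 1 1 + 2 * E 2 0 0 0 * conj (E 2 0 1 1) + 4 *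
  E 1 0 0 1 * E 1 2 1 0 - 8 * E 2 0 0 0 * conj (E 1 0 1 0) * E 0 1 1 0 + 4 * E 1 0 1 0 *
  conj (E 2 1 1 0)))
/-! ### Frequency integrals of the final formula -/

noncomputable def chi1 (P : ℝ → ℂ) (lk : Link) (R f : ℝ) : ℂ :=
  ∫ f₁ in (-(R / 2))..(R / 2), ∫ f₂ in (-(R / 2))..(R / 2),
    absSq (P f₁) * absSq (P f₂) * absSq (P (f - f₁ + f₂)) * absSq (eta lk f₁ f₂ f)

noncomputable def chi2 (P : ℝ → ℂ) (lk : Link) (R f : ℝ) : ℂ :=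
  ∫ f₁ in (-(R / 2))..(R / 2), ∫ f₂ in (-(R / 2))..(R / 2),
    absSq (P f₁) * absSq (P f₂) * absSq (P (f - f₁ + f₂)) *
      eta lk f₁ f₂ f * conj (eta lk f₁ (-f + f₁ - f₂) f)

noncomputable def chi3 (P : ℝ → ℂ) (lk : Link) (R f : ℝ) : ℂ :=
  absSq (P f) * absSq (∫ f₁ in (-(R / 2))..(R / 2), absSq (P f₁) * eta lk f₁ (-f) f)

noncomputable def chi4 (P : ℝ → ℂ) (lk : Link) (R f : ℝ) : ℂ :=
  ∫ f₁ in (-(R / 2))..(R / 2), ∫ f₂ in (-(R / 2))..(R / 2), ∫ f₃ in (-(R / 2))..(R / 2),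
    P f₁ * conj (P f₂) * P (f - f₁ + f₂) *
      conj (P (f₁ - f₂)) * P f₃ * conj (P (f - f₁ + f₂ + f₃)) *
      eta lk f₁ f₂ f * conj (eta lk (f₁ - f₂) f₃ f)

noncomputable def chi5 (P : ℝ → ℂ) (lk : Link) (R f : ℝ) : ℂ :=
  ∫ f₁ in (-(R / 2))..(R / 2), ∫ f₂ in (-(R / 2))..(R / 2), ∫ f₃ in (-(R / 2))..(R / 2),
    P f₁ * conj (P f₂) * P (f - f₁ + f₂) *
      conj (P f₃) * P (f₂ - f₁) * conj (P (f - f₁ + f₂ - f₃)) *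
      eta lk f₁ f₂ f * conj (eta lk f₃ (f₂ - f₁) f)

noncomputable def chi6 (P : ℝ → ℂ) (lk : Link) (R f : ℝ) : ℂ :=
  ∫ f₁ in (-(R / 2))..(R / 2), ∫ f₂ in (-(R / 2))..(R / 2), ∫ f₃ in (-(R / 2))..(R / 2),
    P f₁ * conj (P f₂) * P (f - f₁ + f₂) *
      conj (P f₃) * conj (P (f + f₂)) * P (f₂ + f₃) *
      eta lk f₁ f₂ f * conj (eta lk f₃ (-f - f₂) f)

noncomputable def chi7 (P : ℝ → ℂ) (lk : Link) (R f : ℝ) : ℂ :=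
  P f * ∫ f₁ in (-(R / 2))..(R / 2), ∫ f₂ in (-(R / 2))..(R / 2), ∫ f₃ in (-(R / 2))..(R / 2),
    absSq (P f₁) * conj (P f₂) * P f₃ * conj (P (f - f₂ + f₃)) *
      eta lk f₁ (-f) f * conj (eta lk f₂ f₃ f)

noncomputable def chi8 (P : ℝ → ℂ) (lk : Link) (R f : ℝ) : ℂ :=
  ∫ f₁ in (-(R / 2))..(R / 2), ∫ f₂ in (-(R / 2))..(R / 2), ∫ f₃ in (-(R / 2))..(R / 2),
    absSq (P f₁) * conj (P f₂) * P (f - f₁ + f₂) * P f₃ * conj (P (f - f₁ + f₃)) *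
      eta lk f₁ f₂ f * conj (eta lk f₁ f₃ f)

noncomputable def chi9 (P : ℝ → ℂ) (lk : Link) (R f : ℝ) : ℂ :=
  ∫ f₁ in (-(R / 2))..(R / 2), ∫ f₂ in (-(R / 2))..(R / 2), ∫ f₃ in (-(R / 2))..(R / 2),
    absSq (P f₁) * conj (P f₂) * P (f - f₁ + f₂) * conj (P f₃) * conj (P (f - f₁ - f₃)) *
      eta lk f₁ f₂ f * conj (eta lk f₃ (-f₁) f)

noncomputable def chi10 (P : ℝ → ℂ) (lk : Link) (R f : ℝ) : ℂ :=
  ∫ f₁ in (-(R / 2))..(R / 2), ∫ f₂ in (-(R / 2))..(R / 2), ∫ f₃ in (-(R / 2))..(R / 2),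
    P f₁ * absSq (P f₂) * P (f - f₁ + f₂) * conj (P f₃) * conj (P (f + f₂ - f₃)) *
      eta lk f₁ f₂ f * conj (eta lk f₃ f₂ f)

noncomputable def chi11 (P : ℝ → ℂ) (lk : Link) (R f : ℝ) : ℂ :=
  ∫ f₁ in (-(R / 2))..(R / 2), ∫ f₂ in (-(R / 2))..(R / 2), ∫ f₃ in (-(R / 2))..(R / 2),
    ∫ f₄ in (-(R / 2))..(R / 2),
    P f₁ * conj (P f₂) * P (f - f₁ + f₂) * conj (P f₃) * P f₄ * conj (P (f - f₃ + f₄)) *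
      eta lk f₁ f₂ f * conj (eta lk f₃ f₄ f)

/-- Right-hand side of the final formula, for the polarisation carrying the symbol component `X`,
the orthogonal one carrying `Y`. -/
noncomputable def nliPSD {Ω : Type*} [MeasurableSpace Ω] (μ : Measure Ω) (X Y : Ω → ℂ)
    (P : ℝ → ℂ) (lk : Link) (R f : ℝ) : ℂ :=
  let E := moment μ X Y
  (8 / 9) ^ 2 * (lk.γ : ℂ) ^ 2 *
    ((R : ℂ) ^ 3 * (coefPhi1 E * chi1 P lk R f + coefPhi2 E * chi2 P lk R f +
        coefPhi3 E * chi3 P lk R f) +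
      (R : ℂ) ^ 2 * (coefPsi1 E * chi4 P lk R f +
        twoRe (coefPsi2 E * chi5 P lk R f + coefPsi3 E * conj (chi5 P lk R f)) +
        coefPsi4 E * chi6 P lk R f +
        twoRe (coefLam1 E * chi7 P lk R f + coefLam2 E * conj (chi7 P lk R f)) +
        coefLam3 E * chi8 P lk R f +
        twoRe (coefLam4 E * chi9 P lk R f + coefLam5 E * conj (chi9 P lk R f)) +
        coefLam6 E * chi10 P lk R f) +
      (R : ℂ) * coefXi1 E * chi11 P lk R f)

end FibreNLI

/-! Perturbation. At order zero every line propagates linearly. At order one, line `i` is driven by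
the mixing products of the lines `k`, `m`, `n = i - k + m`. Measured against the propagator of line
`i`, such a product only decays and rotates at the phase mismatch, so integrating it span by span
gives a geometric sum, which is `eta`. Band limitation makes every sum over lines finite, and linear
equations have unique solutions, so the received lines are exactly `nliLine` (`isReceivedNLI_iff`).
This settles existence and uniqueness.

Moments. The squared modulus of a line is a sum of products of six Fourier coefficients, hence of
sums over six time indices. By independence, the expectation for given times depends only on which
times coincide (`integral_prod_letter`). Möbius inversion on the partition lattice replaces
"coincide exactly within the blocks" by "constant on the blocks, otherwise free"
(`sum_exclusion_le`). The free sums then factorise over the blocks into geometric sums, which are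
Kronecker deltas modulo `W`. This is the identity with the full coefficient
(`integral_normSq_nliLine`). Zero mean removes every partition with a singleton; 41 of the 203
partitions of six positions remain, few enough for kernel evaluation.

Reduction. A partition with `n` blocks imposes `n - 1` independent conditions on the four summation
indices, because the signed frequencies sum to zero. It thus leaves a lattice sum in `5 - n`
variables with prefactor `Δ ^ 5 W ^ n = R ^ n Δ ^ (5 - n)`, which is a Riemann sum. The symmetry `k
↔ n` of the kernel and complex conjugation group the 28 partitions that are not bias terms into
eleven such sums. Their total weights are the stated coefficients. Hence the reduced coefficient
equals the final formula with Riemann sums in place of the integrals, exactly and for every `W`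
(`psdCoeffKept_eq`).

Limit. A Riemann sum is the integral of a step function. The kernels are uniformly bounded, have
uniformly bounded support and converge almost everywhere, so dominated convergence, applied one
variable at a time, gives the integrals (`tendsto_gridChi`). Only `χ₃` and `χ₇` involve `P` at the
fixed frequency `f`, which is why the pointwise limit assumes convergence of `P` at the line. The
weighted sums over the lines are lattice sums in one more variable, for which almost every `f`
suffices (`tendsto_sum_psdCoeffKept`). The limit is real because the lattice sums entering outside a
real part are real. -/

namespace FibreNLI

/-! ### The first-order perturbation solution -/

/-- Solutions of a scalar linear equation on an interval are determined by their initial value. -/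
theorem eqOn_of_linear_ode {L : ℝ} {r : ℂ} {b f g : ℝ → ℂ}
    (hf : ∀ z ∈ Set.Icc 0 L, HasDerivWithinAt f (r * f z + b z) (Set.Icc 0 L) z)
    (hg : ∀ z ∈ Set.Icc 0 L, HasDerivWithinAt g (r * g z + b z) (Set.Icc 0 L) z)
    (h0 : f 0 = g 0) : ∀ z ∈ Set.Icc 0 L, f z = g z := by
  -- The source `b` cancels in the difference, and the integrating factor `exp (-r z)` makes its
  -- derivative vanish.
  have hd : ∀ z ∈ Set.Icc 0 L, HasDerivWithinAt
      (fun z : ℝ => Complex.exp (-(r * z)) * (f z - g z)) 0 (Set.Icc 0 L) z := by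
    intro z hz
    have h1 : HasDerivAt (fun z : ℝ => Complex.exp (-(r * z))) (Complex.exp (-(r * z)) * -(r * 1)) z :=
      (((hasDerivAt_id z).ofReal_comp.const_mul r).neg).cexp
    refine (h1.hasDerivWithinAt.mul ((hf z hz).sub (hg z hz))).congr_deriv ?_
    simp only [Pi.sub_apply]
    ring
  intro z hz
  have := constant_of_has_deriv_right_zero (fun z hz => (hd z hz).continuousWithinAt)
    (fun x hx => (hd x ⟨hx.1, hx.2.le⟩).mono_of_mem_nhdsWithin
      (Icc_mem_nhdsGE_of_mem hx)) z hz
  simp only [h0, sub_self, mul_zero, mul_eq_zero, Complex.exp_ne_zero, false_or] at this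
  exact sub_eq_zero.1 this

/-- The dispersive part of `linRate`. -/
noncomputable def dispRate (lk : Link) (f : ℝ) : ℂ :=
  2 * (Real.pi : ℂ) ^ 2 * lk.β₂ * (f : ℂ) ^ 2 * Complex.I

/-- The phase mismatch in `eta`. -/
noncomputable def mismatch (lk : Link) (f₁ f₂ f : ℝ) : ℝ :=
  4 * Real.pi ^ 2 * lk.β₂ * (f - f₁) * (f₂ - f₁)

theorem eta_eq (lk : Link) (f₁ f₂ f : ℝ) :
    eta lk f₁ f₂ f =
      (1 - Complex.exp ((-lk.α + Complex.I * mismatch lk f₁ f₂ f) * lk.L)) /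
        (lk.α - Complex.I * mismatch lk f₁ f₂ f) *
      ∑ l ∈ Finset.range lk.spans, Complex.exp (Complex.I * mismatch lk f₁ f₂ f * l * lk.L) := by
  simp only [eta, mismatch, ← Complex.exp_add]
  push_cast
  ring_nf

theorem linRate_eq (lk : Link) (f : ℝ) : linRate lk f = -(lk.α : ℂ) / 2 + dispRate lk f := rfl

theorem conj_dispRate (lk : Link) (f : ℝ) : conj (dispRate lk f) = -dispRate lk f := by
  simp [dispRate, Complex.conj_ofNat]

/-- The identity `k² - m² + n² - i² = 2 (i - k) (m - k)` for `n = i - k + m`: the quadratic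
dispersion phases of a mixing product differ from that of line `i` by the product appearing in
`mismatch`. -/
theorem dispRate_mix (lk : Link) (Δ : ℝ) (k m i : ℤ) :
    dispRate lk (k * Δ) - dispRate lk (m * Δ) + dispRate lk ((i - k + m : ℤ) * Δ) =
      dispRate lk (i * Δ) + Complex.I * mismatch lk (k * Δ) (m * Δ) (i * Δ) := by
  simp only [dispRate, mismatch]
  push_cast
  ring

theorem alpha_sub_ne_zero {lk : Link} (hα : 0 < lk.α) (x : ℝ) :
    (lk.α : ℂ) - Complex.I * x ≠ 0 := by
  intro h
  have := congrArg Complex.re h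
  simp at this
  exact hα.ne' this

/-- Order zero in `γ`: linear propagation. -/
noncomputable def linField (lk : Link) (Δ : ℝ) (C : Fin 2 → ℤ → ℂ) (l : ℕ) (z : ℝ) (q : Fin 2)
    (k : ℤ) : ℂ :=
  C q k * Complex.exp (linRate lk (k * Δ) * z + dispRate lk (k * Δ) * l * lk.L)

/-- The effective length of one mixing product at distance `z` into span `l`. -/
noncomputable def mixLength (lk : Link) (φ : ℝ) (l : ℕ) (z : ℝ) : ℂ :=
  (1 - Complex.exp ((-lk.α + Complex.I * φ) * lk.L)) / (lk.α - Complex.I * φ) *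
      ∑ j ∈ Finset.range l, Complex.exp (Complex.I * φ * j * lk.L) +
    Complex.exp (Complex.I * φ * l * lk.L) *
      ((1 - Complex.exp ((-lk.α + Complex.I * φ) * z)) / (lk.α - Complex.I * φ))

/-- The mixing product of the lines `k`, `m`, `i - k + m`. -/
noncomputable def mixProd (C : Fin 2 → ℤ → ℂ) (q : Fin 2) (i : ℤ) (km : ℤ × ℤ) : ℂ :=
  (∑ s : Fin 2, C s km.1 * conj (C s km.2)) * C q (i - km.1 + km.2)

/-- Order one in `γ`, for a launch signal with lines in `[-N, N]`. -/
noncomputable def kerrField (lk : Link) (Δ : ℝ) (C : Fin 2 → ℤ → ℂ) (B : Finset (ℤ × ℤ)) (l : ℕ)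
    (z : ℝ) (q : Fin 2) (i : ℤ) : ℂ :=
  Complex.exp (linRate lk (i * Δ) * z + dispRate lk (i * Δ) * l * lk.L) *
    (Complex.I * (8 / 9) * lk.γ * ∑ km ∈ B, mixProd C q i km *
      mixLength lk (mismatch lk (km.1 * Δ) (km.2 * Δ) (i * Δ)) l z)

theorem mixLength_zero (lk : Link) (φ : ℝ) (l : ℕ) : mixLength lk φ l 0 =
    (1 - Complex.exp ((-lk.α + Complex.I * φ) * lk.L)) / (lk.α - Complex.I * φ) *
      ∑ j ∈ Finset.range l, Complex.exp (Complex.I * φ * j * lk.L) := by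
  simp [mixLength]

/-- The contribution of a completed span is the next term of the geometric sum over spans, so
nothing but the amplifier gain has to be matched at a span boundary. -/
theorem mixLength_succ (lk : Link) (φ : ℝ) (l : ℕ) :
    mixLength lk φ (l + 1) 0 = mixLength lk φ l lk.L := by
  rw [mixLength_zero, mixLength, Finset.sum_range_succ]
  ring

/-- The derivative is the factor by which a mixing product of linear fields differs from the
propagator of its line (`mixProd_linField`); `mixLength` is its integral along the link. Positivity
of `α` keeps the denominator away from zero. -/
theorem hasDerivAt_mixLength {lk : Link} (hα : 0 < lk.α) (φ : ℝ) (l : ℕ) (z : ℝ) :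
    HasDerivAt (mixLength lk φ l)
      (Complex.exp (Complex.I * φ * l * lk.L) *
        Complex.exp ((-lk.α + Complex.I * φ) * z)) z := by
  have h1 : HasDerivAt (fun z : ℝ => Complex.exp ((-lk.α + Complex.I * φ) * z))
      (Complex.exp ((-lk.α + Complex.I * φ) * z) * ((-lk.α + Complex.I * φ) * 1)) z :=
    ((hasDerivAt_id z).ofReal_comp.const_mul _).cexp
  have h2 := (((h1.const_sub 1).div_const (lk.α - Complex.I * φ)).const_mul
    (Complex.exp (Complex.I * φ * l * lk.L))).const_add
      ((1 - Complex.exp ((-lk.α + Complex.I * φ) * lk.L)) / (lk.α - Complex.I * φ) *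
      ∑ j ∈ Finset.range l, Complex.exp (Complex.I * φ * j * lk.L))
  refine h2.congr_deriv ?_
  have := alpha_sub_ne_zero hα φ
  field_simp
  ring

/-- Three fields each carry the loss `exp (-α z / 2)`. One of these belongs to the propagator of
line `i`, and the other two leave `exp (-α z)`. The phases combine by `dispRate_mix`. -/
theorem mixProd_linField (lk : Link) (Δ : ℝ) (C : Fin 2 → ℤ → ℂ) (l : ℕ) (z : ℝ) (q : Fin 2)
    (i : ℤ) (km : ℤ × ℤ) :
    mixProd (linField lk Δ C l z) q i km =
      Complex.exp (linRate lk (i * Δ) * z + dispRate lk (i * Δ) * l * lk.L) *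
      (mixProd C q i km *
        (Complex.exp (Complex.I * mismatch lk (km.1 * Δ) (km.2 * Δ) (i * Δ) * l * lk.L) *
        Complex.exp ((-lk.α + Complex.I * mismatch lk (km.1 * Δ) (km.2 * Δ) (i * Δ)) * z))) := by
  obtain ⟨k, m⟩ := km
  have hφ := dispRate_mix lk Δ k m i
  set φ := mismatch lk (k * Δ) (m * Δ) (i * Δ)
  simp only [mixProd, linField, map_mul, ← Complex.exp_conj, map_add, linRate_eq, conj_dispRate,
    map_div₀, map_neg, Complex.conj_ofReal, map_natCast, Finset.sum_mul, Finset.mul_sum]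
  refine Finset.sum_congr rfl fun s _ => ?_
  rw [show conj (2 : ℂ) = 2 from Complex.conj_ofNat 2]
  have e : Complex.exp (((-(lk.α : ℂ)) / 2 + dispRate lk (k * Δ)) * z + dispRate lk (k * Δ) * l * lk.L)
      * Complex.exp (((-(lk.α : ℂ)) / 2 + -dispRate lk (m * Δ)) * z + -dispRate lk (m * Δ) * l * lk.L)
      * Complex.exp (((-(lk.α : ℂ)) / 2 + dispRate lk ((i - k + m : ℤ) * Δ)) * z +
          dispRate lk ((i - k + m : ℤ) * Δ) * l * lk.L) =
      Complex.exp (((-(lk.α : ℂ)) / 2 + dispRate lk (i * Δ)) * z + dispRate lk (i * Δ) * l * lk.L) *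
      (Complex.exp (Complex.I * φ * l * lk.L) * Complex.exp ((-lk.α + Complex.I * φ) * z)) := by
    simp only [← Complex.exp_add]
    congr 1
    linear_combination ((z : ℂ) + l * lk.L) * hφ
  linear_combination (C s k * conj (C s m) * C q (i - k + m)) * e

/-- The lines of the received first-order field. -/
noncomputable def nliLine (lk : Link) (Δ : ℝ) (C : Fin 2 → ℤ → ℂ) (q : Fin 2) (i : ℤ) : ℂ :=
  Complex.I * (8 / 9) * lk.γ * ∑' km : ℤ × ℤ, mixProd C q i km *
    eta lk (km.1 * Δ) (km.2 * Δ) (i * Δ)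

theorem tsum_mixProd_mul {C : Fin 2 → ℤ → ℂ} {N : ℤ} (hC : ∀ q k, N < |k| → C q k = 0)
    (q : Fin 2) (i : ℤ) (h : ℤ × ℤ → ℂ) :
    ∑' km, mixProd C q i km * h km =
      ∑ km ∈ Finset.Icc (-N) N ×ˢ Finset.Icc (-N) N, mixProd C q i km * h km := by
  refine tsum_eq_sum fun km hkm => ?_
  have : N < |km.1| ∨ N < |km.2| := by
    by_contra! hc
    exact hkm (by simpa [abs_le, Prod.forall] using hc)
  rcases this with h1 | h1
  · simp [mixProd, hC _ _ h1]
  · simp [mixProd, hC _ _ h1]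

theorem tsum_mixProd {C : Fin 2 → ℤ → ℂ} {N : ℤ} (hC : ∀ q k, N < |k| → C q k = 0)
    (q : Fin 2) (i : ℤ) :
    ∑' km, mixProd C q i km =
      ∑ km ∈ Finset.Icc (-N) N ×ˢ Finset.Icc (-N) N, mixProd C q i km := by
  simpa using tsum_mixProd_mul hC q i (fun _ => 1)

/-- The gain cancels the loss of the span, so only the dispersive phase is carried into the next
one. -/
theorem exp_amp (lk : Link) (Δ : ℝ) (k : ℤ) (l : ℕ) :
    Complex.exp (linRate lk (k * Δ) * (0 : ℝ) + dispRate lk (k * Δ) * (l + 1 : ℕ) * lk.L) =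
      (Real.exp (lk.α * lk.L / 2) : ℂ) *
        Complex.exp (linRate lk (k * Δ) * lk.L + dispRate lk (k * Δ) * l * lk.L) := by
  push_cast
  rw [← Complex.exp_add, linRate_eq]
  congr 1
  ring

theorem hasDerivAt_exp_lin (r s : ℂ) (z : ℝ) :
    HasDerivAt (fun z : ℝ => Complex.exp (r * z + s)) (r * Complex.exp (r * z + s)) z := by
  have := (((hasDerivAt_id z).ofReal_comp.const_mul r).add_const s).cexp
  exact this.congr_deriv (by simp [mul_comm])

/-- Variation of constants: the first-order field is the linear propagator times the accumulated
mixing products. Finiteness of the set of launched lines allows termwise differentiation. -/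
theorem isFirstOrderRP_explicit {lk : Link} (hα : 0 < lk.α) (Δ : ℝ) {C : Fin 2 → ℤ → ℂ} {N : ℤ}
    (hC : ∀ q k, N < |k| → C q k = 0) :
    IsFirstOrderRP lk Δ C (linField lk Δ C)
      (kerrField lk Δ C (Finset.Icc (-N) N ×ˢ Finset.Icc (-N) N)) where
  init_zero q k := by simp [linField]
  init_one q k := by simp [kerrField, mixLength_zero]
  ode_zero l _ q k z _ := by
    have := ((hasDerivAt_exp_lin (linRate lk (k * Δ)) (dispRate lk (k * Δ) * l * lk.L) z).const_mul
      (C q k)).hasDerivWithinAt (s := Set.Icc 0 lk.L)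
    refine this.congr_deriv ?_
    simp only [linField]
    ring
  ode_one l _ q i z _ := by
    have h1 := hasDerivAt_exp_lin (linRate lk (i * Δ)) (dispRate lk (i * Δ) * l * lk.L) z
    have h2 := HasDerivAt.fun_sum (u := Finset.Icc (-N) N ×ˢ Finset.Icc (-N) N) fun km _ =>
      (hasDerivAt_mixLength hα (mismatch lk (km.1 * Δ) (km.2 * Δ) (i * Δ)) l z).const_mul
        (mixProd C q i km)
    have h3 := (h1.mul (h2.const_mul (Complex.I * (8 / 9) * lk.γ))).hasDerivWithinAt
      (s := Set.Icc 0 lk.L)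
    refine h3.congr_deriv ?_
    have hk : kerr (linField lk Δ C l z) q i = ∑' km, mixProd (linField lk Δ C l z) q i km := rfl
    rw [hk, tsum_mixProd (N := N) (fun q k h => by simp [linField, hC q k h])]
    simp only [mixProd_linField, kerrField, Finset.mul_sum]
    congr 1
    all_goals exact Finset.sum_congr rfl fun km _ => by ring
  amp_zero l _ q k := by
    simp only [linField, exp_amp]
    ring
  amp_one l _ q k := by
    simp only [kerrField, exp_amp, mixLength_succ]
    ring

/-- The system is triangular. The equation of order zero is closed; once its solutions agree on a
span, both first-order fields solve the same linear equation with the same Kerr source. Induction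
over the spans does the rest. -/
theorem IsFirstOrderRP.unique {lk : Link} (hL : 0 < lk.L) {Δ : ℝ} {C : Fin 2 → ℤ → ℂ}
    {E0 E1 F0 F1 : ℕ → ℝ → Fin 2 → ℤ → ℂ} (hE : IsFirstOrderRP lk Δ C E0 E1)
    (hF : IsFirstOrderRP lk Δ C F0 F1) : E1 lk.spans 0 = F1 lk.spans 0 := by
  have zero : ∀ l ≤ lk.spans, E0 l 0 = F0 l 0 ∧ E1 l 0 = F1 l 0 := by
    intro l
    induction l with
    | zero =>
      intro _
      constructor <;> ext q k
      · rw [hE.init_zero, hF.init_zero]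
      · rw [hE.init_one, hF.init_one]
    | succ l ih =>
      intro hl
      obtain ⟨h0, h1⟩ := ih (by omega)
      have hl' : l < lk.spans := hl
      have e0 : ∀ z ∈ Set.Icc 0 lk.L, E0 l z = F0 l z := by
        intro z hz
        ext q k
        refine eqOn_of_linear_ode (r := linRate lk (k * Δ)) (b := fun _ => 0) (L := lk.L)
          (f := fun z => E0 l z q k) (g := fun z => F0 l z q k) ?_ ?_ (by simp [h0]) z hz
        · intro z hz; simpa using hE.ode_zero l hl' q k z hz
        · intro z hz; simpa using hF.ode_zero l hl' q k z hz
      have e1 : ∀ z ∈ Set.Icc 0 lk.L, E1 l z = F1 l z := by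
        intro z hz
        ext q k
        refine eqOn_of_linear_ode (r := linRate lk (k * Δ)) (L := lk.L)
          (b := fun z => Complex.I * (8 / 9) * lk.γ * kerr (E0 l z) q k)
          (f := fun z => E1 l z q k) (g := fun z => F1 l z q k) ?_ ?_ (by simp [h1]) z hz
        · intro z hz; exact hE.ode_one l hl' q k z hz
        · intro z hz; simpa only [e0 z hz] using hF.ode_one l hl' q k z hz
      have hLm : lk.L ∈ Set.Icc 0 lk.L := ⟨hL.le, le_rfl⟩
      constructor <;> ext q k
      · rw [hE.amp_zero l hl', hF.amp_zero l hl', e0 _ hLm]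
      · rw [hE.amp_one l hl', hF.amp_one l hl', e1 _ hLm]
  exact (zero _ le_rfl).2

theorem isReceivedNLI_iff {lk : Link} (hα : 0 < lk.α) (hL : 0 < lk.L) (Δ : ℝ)
    {C : Fin 2 → ℤ → ℂ} {N : ℤ} (hC : ∀ q k, N < |k| → C q k = 0) (c : Fin 2 → ℤ → ℂ) :
    IsReceivedNLI lk Δ C c ↔ c = nliLine lk Δ C := by
  have hex := isFirstOrderRP_explicit hα Δ hC
  have key : ∀ (q : Fin 2) (i : ℤ), Complex.exp (-(2 * (Real.pi : ℂ) ^ 2 * ((i * Δ : ℝ) : ℂ) ^ 2 * lk.β₂ *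
      lk.spans * lk.L * Complex.I)) *
      kerrField lk Δ C (Finset.Icc (-N) N ×ˢ Finset.Icc (-N) N) lk.spans 0 q i =
      nliLine lk Δ C q i := by
    intro q i
    rw [nliLine, tsum_mixProd_mul hC, kerrField, ← mul_assoc, ← Complex.exp_add]
    simp only [mixLength_zero, ← eta_eq]
    -- Dispersion compensation removes exactly the phase accumulated over all spans.
    have : -(2 * (Real.pi : ℂ) ^ 2 * ((i * Δ : ℝ) : ℂ) ^ 2 * lk.β₂ * lk.spans * lk.L *
        Complex.I) + (linRate lk (i * Δ) * (0 : ℝ) + dispRate lk (i * Δ) * lk.spans * lk.L) = 0 := by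
      simp only [dispRate]
      push_cast
      ring
    rw [this, Complex.exp_zero, one_mul]
  constructor
  · rintro ⟨E0, E1, hE, hc⟩
    ext q i
    rw [hc, hE.unique hL hex, key]
  · rintro rfl
    exact ⟨_, _, hex, fun q i => (key q i).symm⟩

/-! ### Partitions of the six positions without singletons -/

/-- A set partition of the six positions as a list of blocks. -/
abbrev Pattern := List (List (Fin 6))

/-- The blocks of a pattern. -/
def Pattern.parts (c : Pattern) : Finset (Finset (Fin 6)) := (c.map List.toFinset).toFinset

/-- Refinement of patterns. -/
def Pattern.refines (c d : Pattern) : Bool := c.all fun A => d.any fun B => A.all fun x => B.contains x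

/-- The inclusion-exclusion number of two patterns. -/
def Pattern.excl (c d : Pattern) : ℤ :=
  if c.refines d then
    (d.map fun B => (-1) ^ ((c.filter fun A => A.all fun x => B.contains x).length - 1) *
      (Nat.factorial ((c.filter fun A => A.all fun x => B.contains x).length - 1) : ℤ)).prod
  else 0

def chi1Patterns : List Pattern :=
  [[[0, 3], [1, 4], [2, 5]], [[0, 5], [1, 4], [2, 3]]]

def chi2Patterns : List Pattern :=
  [[[0, 3], [1, 5], [2, 4]], [[0, 5], [1, 3], [2, 4]], [[0, 4], [1, 5], [2, 3]],
    [[0, 4], [1, 3], [2, 5]]]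

def chi3Patterns : List Pattern := [[[0, 2], [1, 4], [3, 5]]]

def chi4Patterns : List Pattern :=
  [[[0, 1, 3], [2, 4, 5]], [[0, 1, 5], [2, 3, 4]], [[0, 4, 5], [1, 2, 3]], [[0, 3, 4], [1, 2, 5]]]

def chi5Patterns : List Pattern := [[[0, 1, 4], [2, 3, 5]], [[0, 3, 5], [1, 2, 4]]]

def chi5ConjPatterns : List Pattern := [[[0, 2, 5], [1, 3, 4]], [[0, 2, 3], [1, 4, 5]]]

def chi6Patterns : List Pattern := [[[0, 2, 4], [1, 3, 5]]]

def chi7Patterns : List Pattern := [[[0, 2], [1, 3, 4, 5]]]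

def chi7ConjPatterns : List Pattern := [[[0, 1, 2, 4], [3, 5]]]

def chi8Patterns : List Pattern :=
  [[[0, 3], [1, 2, 4, 5]], [[0, 5], [1, 2, 3, 4]], [[0, 1, 4, 5], [2, 3]], [[0, 1, 3, 4], [2, 5]]]

def chi9Patterns : List Pattern := [[[0, 4], [1, 2, 3, 5]], [[0, 1, 3, 5], [2, 4]]]

def chi9ConjPatterns : List Pattern := [[[0, 2, 4, 5], [1, 3]], [[0, 2, 3, 4], [1, 5]]]

def chi10Patterns : List Pattern := [[[0, 2, 3, 5], [1, 4]]]

def chi11Patterns : List Pattern := [[[0, 1, 2, 3, 4, 5]]]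

/-- The partitions without singletons that are not bias terms. -/
def keptPatterns : List Pattern :=
  chi1Patterns ++ (chi2Patterns ++ (chi3Patterns ++ (chi4Patterns ++ (chi5Patterns ++
  (chi5ConjPatterns ++ (chi6Patterns ++ (chi7Patterns ++ (chi7ConjPatterns ++ (chi8Patterns ++
  (chi9Patterns ++ (chi9ConjPatterns ++ (chi10Patterns ++ chi11Patterns))))))))))))

def biasPatterns : List Pattern :=
  [[[0, 5], [1, 2], [3, 4]], [[0, 2], [1, 5], [3, 4]], [[0, 1], [2, 5], [3, 4]],
    [[0, 1, 2, 5], [3, 4]], [[0, 4], [1, 2], [3, 5]], [[0, 1], [2, 4], [3, 5]],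
    [[0, 3], [1, 2], [4, 5]], [[0, 2], [1, 3], [4, 5]], [[0, 1], [2, 3], [4, 5]],
    [[0, 1, 2, 3], [4, 5]], [[0, 1, 2], [3, 4, 5]], [[0, 3, 4, 5], [1, 2]], [[0, 1], [2, 3, 4, 5]]]

/-- All partitions without singletons. -/
def patterns : List Pattern := keptPatterns ++ biasPatterns

theorem patterns_nodup : (patterns.map Pattern.parts).Nodup := by decide +kernel

theorem patterns_blocks : ∀ c ∈ patterns, (c.map List.toFinset).Nodup ∧ ∀ b ∈ c, b.Nodup := by
  decide +kernel

theorem patterns_cover : ∀ c ∈ patterns, (∅ ∉ c.parts) ∧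
    ∀ i : Fin 6, (c.parts.filter fun B => i ∈ B).card = 1 := by decide +kernel

/-- The inclusion-exclusion number in terms of blocks. -/
def exclParts (S T : Finset (Finset (Fin 6))) : ℤ :=
  if ∀ A ∈ S, ∃ B ∈ T, A ⊆ B then
    ∏ B ∈ T, (-1) ^ ((S.filter (· ⊆ B)).card - 1) * (Nat.factorial ((S.filter (· ⊆ B)).card - 1) : ℤ)
  else 0

theorem Pattern.mem_parts {c : Pattern} {S : Finset (Fin 6)} :
    S ∈ c.parts ↔ ∃ b ∈ c, b.toFinset = S := by
  simp [Pattern.parts]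

theorem toFinset_subset_iff (A B : List (Fin 6)) :
    A.toFinset ⊆ B.toFinset ↔ (A.all fun x => B.contains x) = true := by
  simp [Finset.subset_iff]

theorem refines_parts (c d : Pattern) :
    (∀ A ∈ c.parts, ∃ B ∈ d.parts, A ⊆ B) ↔ c.refines d := by
  simp only [Pattern.mem_parts, Pattern.refines, List.all_eq_true (l := c), List.any_eq_true]
  constructor
  · intro h A hA
    obtain ⟨_, ⟨B, hB, rfl⟩, h2⟩ := h _ ⟨A, hA, rfl⟩
    exact ⟨B, hB, (toFinset_subset_iff A B).1 h2⟩
  · rintro h _ ⟨A, hA, rfl⟩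
    obtain ⟨B, hB, h2⟩ := h A hA
    exact ⟨_, ⟨B, hB, rfl⟩, (toFinset_subset_iff A B).2 h2⟩

/-- Passage from sets of blocks to lists, on which the kernel can compute. Distinctness of the
blocks ensures that list lengths and products agree with cardinalities and products over sets. -/
theorem excl_parts {c d : Pattern} (hc : (c.map List.toFinset).Nodup)
    (hd : (d.map List.toFinset).Nodup) : exclParts c.parts d.parts = c.excl d := by
  have hcard : ∀ B : List (Fin 6), (c.parts.filter (· ⊆ B.toFinset)).card =
      (c.filter fun A => A.all fun x => B.contains x).length := by
    intro B
    have : c.parts.filter (· ⊆ B.toFinset) =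
        ((c.filter fun A => A.all fun x => B.contains x).map List.toFinset).toFinset := by
      ext S
      simp only [Finset.mem_filter, Pattern.mem_parts, List.mem_toFinset, List.mem_map,
        List.mem_filter, ← toFinset_subset_iff]
      constructor
      · rintro ⟨⟨A, hA, rfl⟩, h⟩
        exact ⟨A, ⟨hA, h⟩, rfl⟩
      · rintro ⟨A, ⟨hA, h⟩, rfl⟩
        exact ⟨⟨A, hA, rfl⟩, h⟩
    rw [this, List.toFinset_card_of_nodup, List.length_map]
    exact hc.sublist (List.filter_sublist.map _)
  unfold exclParts Pattern.excl
  simp only [refines_parts]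
  split_ifs
  · rw [Pattern.parts, List.prod_toFinset _ hd, List.map_map]
    simp only [Function.comp_def, ← hcard]
  · rfl

/-- The defining property of the Möbius function on the interval from `c` to `d`, by exhaustive
evaluation. The list contains the whole interval, since coarsening a partition without singletons
creates none. -/
theorem patterns_moebius : ∀ c ∈ patterns, ∀ d ∈ patterns, c.refines d →
    ((patterns.filter fun e => c.refines e).map fun e => if e.refines d then c.excl e else 0).sum =
      if c = d then 1 else 0 := by decide +kernel

def IsBiasParts (S : Finset (Finset (Fin 6))) : Prop :=
  {0, 1} ∈ S ∨ {1, 2} ∈ S ∨ {3, 4} ∈ S ∨ {4, 5} ∈ S ∨ S = {{0, 1, 2}, {3, 4, 5}}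

instance : DecidablePred IsBiasParts := fun S => by unfold IsBiasParts; infer_instance

theorem kept_not_bias : ∀ c ∈ keptPatterns, ¬ IsBiasParts c.parts := by decide +kernel

theorem bias_bias : ∀ c ∈ biasPatterns, IsBiasParts c.parts := by decide +kernel

/-- Every labelling of the positions without isolated label has its fibres in the list. -/
theorem fibres_mem_patterns : ∀ (b : Fin 2) (c : Fin 3) (d : Fin 4) (e : Fin 5) (g : Fin 6),
    (∀ i : Fin 6, ∃ j : Fin 6, j ≠ i ∧ ![0, b.val, c.val, d.val, e.val, g.val] i =
      ![0, b.val, c.val, d.val, e.val, g.val] j) →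
    (Finset.univ.image fun i => Finset.univ.filter fun j : Fin 6 =>
      ![0, b.val, c.val, d.val, e.val, g.val] i = ![0, b.val, c.val, d.val, e.val, g.val] j) ∈
      patterns.map Pattern.parts := by decide +kernel

theorem exclusion_eq (π σ : Finpartition (Finset.univ : Finset (Fin 6))) :
    exclusion π σ = (exclParts π.parts σ.parts : ℂ) := by
  unfold exclusion exclParts
  have hle : π ≤ σ ↔ ∀ A ∈ π.parts, ∃ B ∈ σ.parts, A ⊆ B :=
    ⟨fun h A hA => by obtain ⟨B, hB, hAB⟩ := h hA; exact ⟨B, hB, hAB⟩,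
      fun h A hA => by obtain ⟨B, hB, hAB⟩ := h A hA; exact ⟨B, hB, hAB⟩⟩
  by_cases h : π ≤ σ
  · rw [if_pos h, if_pos (hle.1 h)]
    push_cast
    refine Finset.prod_congr rfl fun B _ => ?_
    congr!
  · rw [if_neg h, if_neg (fun h' => h (hle.2 h'))]
    simp

/-- Each position is labelled by the least element of its block. The label of position `j` is at
most `j`, so only `6! = 720` labellings occur, and these are what `fibres_mem_patterns` examines. -/
theorem exists_pattern (σ : Finpartition (Finset.univ : Finset (Fin 6)))
    (hσ : ∀ B ∈ σ.parts, 1 < B.card) : ∃ c ∈ patterns, σ.parts = c.parts := by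
  have hne : ∀ i, (σ.part i).Nonempty := fun i => σ.part_nonempty.2 (Finset.mem_univ i)
  have hself : ∀ i, i ∈ σ.part i := fun i => σ.mem_part_self.2 (Finset.mem_univ i)
  have hmem : ∀ i, σ.part i ∈ σ.parts := fun i => σ.part_mem.2 (Finset.mem_univ i)
  let f : Fin 6 → Fin 6 := fun i => (σ.part i).min' (hne i)
  have hf : ∀ i, f i ≤ i := fun i => Finset.min'_le _ _ (hself i)
  have hfmem : ∀ i, f i ∈ σ.part i := fun i => Finset.min'_mem _ _
  have hff : ∀ i j, f i = f j ↔ j ∈ σ.part i := by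
    intro i j
    constructor
    · intro h
      have h1 : σ.part i = σ.part (f i) := (σ.part_eq_of_mem (hmem i) (hfmem i)).symm
      have h2 : σ.part j = σ.part (f j) := (σ.part_eq_of_mem (hmem j) (hfmem j)).symm
      rw [h1, h, ← h2]
      exact hself j
    · intro h
      have h1 : σ.part j = σ.part i := σ.part_eq_of_mem (hmem i) h
      simp only [f, h1]
  have hv : ∀ i, ![0, (f 1).val, (f 2).val, (f 3).val, (f 4).val, (f 5).val] i = (f i).val := by
    intro i
    have h0 : (f 0).val = 0 := by simpa using hf 0
    fin_cases i <;> simp [h0]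
  have key := fibres_mem_patterns ⟨(f 1).val, Nat.lt_succ_of_le (hf 1)⟩
    ⟨(f 2).val, Nat.lt_succ_of_le (hf 2)⟩ ⟨(f 3).val, Nat.lt_succ_of_le (hf 3)⟩
    ⟨(f 4).val, Nat.lt_succ_of_le (hf 4)⟩ ⟨(f 5).val, Nat.lt_succ_of_le (hf 5)⟩
  simp only [hv, Fin.val_inj, hff] at key
  have := key fun i => by
    obtain ⟨j, hj, hji⟩ := Finset.exists_mem_ne (hσ _ (hmem i)) i
    exact ⟨j, hji, hj⟩
  obtain ⟨c, hc, hcp⟩ := List.mem_map.1 this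
  refine ⟨c, hc, ?_⟩
  rw [hcp]
  ext S
  simp only [Finset.mem_image, Finset.mem_univ, true_and]
  constructor
  · intro hS
    obtain ⟨i, hi⟩ := σ.nonempty_of_mem_parts hS
    refine ⟨i, ?_⟩
    rw [← σ.part_eq_of_mem hS hi]
    ext; simp
  · rintro ⟨i, rfl⟩
    convert hmem i
    ext; simp

theorem exists_finpartition {c : Pattern} (hc : c ∈ patterns) :
    ∃ σ : Finpartition (Finset.univ : Finset (Fin 6)), σ.parts = c.parts := by
  obtain ⟨h0, h1⟩ := patterns_cover c hc
  refine ⟨Finpartition.ofExistsUnique c.parts (fun _ _ => Finset.subset_univ _) ?_ h0, rfl⟩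
  intro i _
  obtain ⟨B, hB⟩ := Finset.card_eq_one.1 (h1 i)
  have hmem : ∀ D, (D ∈ c.parts ∧ i ∈ D) ↔ D = B := fun D => by
    have := Finset.ext_iff.1 hB D
    simpa using this
  exact ⟨B, (hmem B).2 rfl, fun D hD => (hmem D).1 hD⟩

/-- The list and the partitions on which `F` can be non-zero correspond bijectively through their
sets of blocks. In the applications the vanishing on singletons expresses the zero mean. -/
theorem sum_finpartition_of_list {l : List Pattern} (hl : (l.map Pattern.parts).Nodup)
    (h₁ : ∀ σ : Finpartition (Finset.univ : Finset (Fin 6)), (∀ B ∈ σ.parts, 1 < B.card) →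
      ∃ c ∈ l, σ.parts = c.parts)
    (h₂ : ∀ c ∈ l, ∃ σ : Finpartition (Finset.univ : Finset (Fin 6)), σ.parts = c.parts) (F : Finset (Finset (Fin 6)) → ℂ)
    (hF : ∀ σ : Finpartition (Finset.univ : Finset (Fin 6)),
      (∃ B ∈ σ.parts, B.card ≤ 1) → F σ.parts = 0) :
    ∑ σ : Finpartition (Finset.univ : Finset (Fin 6)), F σ.parts =
      (l.map fun c => F c.parts).sum := by
  have h1 : (l.map fun c => F c.parts).sum =
      ∑ S ∈ (l.map Pattern.parts).toFinset, F S := by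
    rw [List.sum_toFinset _ hl, List.map_map]
    rfl
  rw [h1]
  -- A total choice of partitions; its value `⊥` on families outside the list is never used.
  have hg : ∀ S, ∃ σ : Finpartition (Finset.univ : Finset (Fin 6)),
      S ∈ l.map Pattern.parts → σ.parts = S := by
    intro S
    by_cases h : S ∈ l.map Pattern.parts
    · obtain ⟨c, hc, rfl⟩ := List.mem_map.1 h
      obtain ⟨σ, hσ⟩ := h₂ c hc
      exact ⟨σ, fun _ => hσ⟩
    · exact ⟨⊥, fun h' => absurd h' h⟩
  choose g hg using hg
  symm
  refine Finset.sum_of_injOn g ?_ (fun _ _ => Finset.mem_univ _) ?_ ?_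
  · intro S hS S' hS' h
    rw [Finset.mem_coe, List.mem_toFinset] at hS hS'
    rw [← hg S hS, ← hg S' hS', h]
  · intro σ _ hσ
    by_contra hne
    have hs : ∀ B ∈ σ.parts, 1 < B.card := by
      by_contra! hc
      exact hne (hF σ hc)
    obtain ⟨c, hc, hcp⟩ := h₁ σ hs
    have hm := List.mem_map_of_mem (f := Pattern.parts) hc
    refine hσ ⟨c.parts, List.mem_toFinset.2 hm, ?_⟩
    exact Finpartition.ext ((hg _ hm).trans hcp.symm)
  · intro S hS
    rw [hg S (List.mem_toFinset.1 hS)]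

theorem sum_finpartition (F : Finset (Finset (Fin 6)) → ℂ)
    (hF : ∀ σ : Finpartition (Finset.univ : Finset (Fin 6)),
      (∃ B ∈ σ.parts, B.card ≤ 1) → F σ.parts = 0) :
    ∑ σ : Finpartition (Finset.univ : Finset (Fin 6)), F σ.parts =
      (patterns.map fun c => F c.parts).sum :=
  sum_finpartition_of_list patterns_nodup exists_pattern (fun _ => exists_finpartition) F hF

open Classical in
theorem sum_kept (F : Finset (Finset (Fin 6)) → ℂ)
    (hF : ∀ σ : Finpartition (Finset.univ : Finset (Fin 6)),
      (∃ B ∈ σ.parts, B.card ≤ 1) → F σ.parts = 0) :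
    ∑ σ ∈ (Finset.univ : Finset (Finpartition (Finset.univ : Finset (Fin 6)))).filter
        (fun σ => ¬ IsBias σ), F σ.parts = (keptPatterns.map fun c => F c.parts).sum := by
  rw [Finset.sum_filter]
  have := sum_finpartition (fun S => if ¬ IsBiasParts S then F S else 0) (fun σ h => by
    simp [hF σ h])
  have hb : ∀ σ : Finpartition (Finset.univ : Finset (Fin 6)), IsBias σ ↔ IsBiasParts σ.parts :=
    fun σ => Iff.rfl
  simp only [hb, this]
  rw [patterns, List.map_append, List.sum_append]
  have e1 : (keptPatterns.map fun c => if ¬ IsBiasParts c.parts then F c.parts else 0) =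
      keptPatterns.map fun c => F c.parts :=
    List.map_congr_left fun c hc => if_pos (kept_not_bias c hc)
  have e2 : (biasPatterns.map fun c => if ¬ IsBiasParts c.parts then F c.parts else 0) =
      biasPatterns.map fun c => 0 :=
    List.map_congr_left fun c hc => if_neg (not_not.2 (bias_bias c hc))
  rw [e1, e2]
  simp

/-- Möbius inversion above a partition without singletons. -/
theorem sum_exclusion_le (π ρ : Finpartition (Finset.univ : Finset (Fin 6)))
    (hπ : ∀ B ∈ π.parts, 1 < B.card) :
    ∑ σ : Finpartition (Finset.univ : Finset (Fin 6)),
      exclusion π σ * (if ∀ A ∈ σ.parts, ∃ B ∈ ρ.parts, A ⊆ B then 1 else 0) =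
        if π = ρ then 1 else 0 := by
  obtain ⟨c, hc, hcp⟩ := exists_pattern π hπ
  -- Every block of a coarser partition contains a block of `π`, hence at least two positions.
  have up : ∀ τ : Finpartition (Finset.univ : Finset (Fin 6)),
      (∀ A ∈ π.parts, ∃ B ∈ τ.parts, A ⊆ B) → ∀ B ∈ τ.parts, 1 < B.card := by
    intro τ h B hB
    obtain ⟨i, hi⟩ := τ.nonempty_of_mem_parts hB
    obtain ⟨A, hA, hiA⟩ := π.exists_mem (Finset.mem_univ i)
    obtain ⟨B', hB', hAB⟩ := h A hA
    rw [τ.eq_of_mem_parts hB hB' hi (hAB hiA)]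
    exact (hπ A hA).trans_le (Finset.card_le_card hAB)
  by_cases hle : ∀ A ∈ π.parts, ∃ B ∈ ρ.parts, A ⊆ B
  · obtain ⟨d, hd, hdp⟩ := exists_pattern ρ (up ρ hle)
    simp only [exclusion_eq]
    rw [sum_finpartition (fun S => (exclParts π.parts S : ℂ) *
      (if ∀ A ∈ S, ∃ B ∈ ρ.parts, A ⊆ B then 1 else 0))]
    · have hcd : c.refines d := (refines_parts c d).1 (by rwa [← hcp, ← hdp])
      have hmo := patterns_moebius c hc d hd hcd
      have heq : π = ρ ↔ c = d := by
        rw [Finpartition.ext_iff, hcp, hdp]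
        exact ⟨fun h => List.inj_on_of_nodup_map patterns_nodup hc hd h, fun h => by rw [h]⟩
      have hcast := congrArg (Int.cast : ℤ → ℂ) hmo
      simp only [heq]
      rw [show (if c = d then (1 : ℂ) else 0) = (((if c = d then 1 else 0 : ℤ)) : ℂ) by
        split_ifs <;> simp, ← hcast]
      rw [hcp, hdp]
      have e : ∀ l : List Pattern, l ⊆ patterns → (l.map fun e =>
          (exclParts c.parts e.parts : ℂ) * (if ∀ A ∈ e.parts, ∃ B ∈ d.parts, A ⊆ B then 1 else 0)).sum
          = ((((l.filter fun e => c.refines e).map fun e => if e.refines d then c.excl e else 0).sum : ℤ)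
            : ℂ) := by
        intro l
        induction l with
        | nil => simp
        | cons e l ih =>
          intro hl
          have hep : e ∈ patterns := hl (by simp)
          rw [List.map_cons, List.sum_cons, ih (fun x hx => hl (by simp [hx])),
            excl_parts (patterns_blocks c hc).1 (patterns_blocks e hep).1]
          simp only [refines_parts]
          by_cases h1 : c.refines e
          · rw [List.filter_cons_of_pos h1, List.map_cons, List.sum_cons]
            split_ifs <;> simp
          · rw [List.filter_cons_of_neg h1]
            simp [Pattern.excl, h1]
      exact e patterns (List.Subset.refl _)
    · rintro τ ⟨B, hB, hBc⟩
      have : ¬ ∀ A ∈ π.parts, ∃ B ∈ τ.parts, A ⊆ B := fun h => absurd (up τ h B hB) (by omega)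
      simp [exclParts, this]
  · have hne : π ≠ ρ := by
      rintro rfl
      exact hle fun A hA => ⟨A, hA, Finset.Subset.refl _⟩
    rw [if_neg hne]
    -- When `π` does not refine `ρ`, no `σ` lies between them, and each summand has a vanishing
    -- factor.
    refine Finset.sum_eq_zero fun σ _ => ?_
    rw [exclusion_eq, exclParts]
    split_ifs with h1 h2
    · exact absurd (fun A hA => by
        obtain ⟨B, hB, hAB⟩ := h1 A hA
        obtain ⟨D, hD, hBD⟩ := h2 B hB
        exact ⟨D, hD, hAB.trans hBD⟩) hle
    all_goals simp

/-! ### Sixth-order moments of the transmitted lines -/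

/-- The partition of the positions into the level sets of `n`. -/
def kerPartition (n : Fin 6 → ℕ) : Finpartition (Finset.univ : Finset (Fin 6)) :=
  @Finpartition.ofSetoid _ _ _ (Setoid.ker n) fun i j => inferInstanceAs (Decidable (n i = n j))

theorem mem_part_kerPartition {n : Fin 6 → ℕ} {i j : Fin 6} :
    j ∈ (kerPartition n).part i ↔ n i = n j :=
  @Finpartition.mem_part_ofSetoid_iff_rel _ _ _ _ (Setoid.ker n)
    (fun i j => inferInstanceAs (Decidable (n i = n j))) _

theorem kerPartition_parts (n : Fin 6 → ℕ) : (kerPartition n).parts =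
    (Finset.univ.image n).image fun τ => Finset.univ.filter fun j => n j = τ := by
  rw [kerPartition, Finpartition.ofSetoid, Finpartition.ofSetSetoid_parts, Finset.image_image]
  refine Finset.image_congr fun i _ => ?_
  ext j
  simp [Setoid.ker_def, eq_comm]

section Correlation

variable {Ω : Type*} [MeasurableSpace Ω] {μ : Measure Ω} {a : ℕ → Ω → Fin 2 → ℂ}

theorem measurable_letter (q s t : Fin 2) (j : Fin 6) :
    Measurable fun v : Fin 2 → ℂ => letter q s t v j := by
  unfold letter
  split_ifs
  · exact measurable_pi_apply _
  · exact Complex.continuous_conj.measurable.comp (measurable_pi_apply _)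

theorem memLp_letter (ha_ident : ∀ n, IdentDistrib (a n) (a 0) μ μ)
    (ha_six : ∀ q, MemLp (fun ω => a 0 ω q) 6 μ) (q s t : Fin 2) (n : ℕ) (j : Fin 6) :
    MemLp (fun ω => letter q s t (a n ω) j) 6 μ := by
  have h : ∀ r, MemLp (fun ω => a n ω r) 6 μ := fun r =>
    (((ha_ident n).comp (measurable_pi_apply r)).memLp_iff).2 (ha_six r)
  unfold letter
  split_ifs
  · exact h _
  · exact (h _).star

/-- Hölder's inequality with six exponents equal to six. -/
theorem integrable_prod_letter (ha_ident : ∀ n, IdentDistrib (a n) (a 0) μ μ)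
    (ha_six : ∀ q, MemLp (fun ω => a 0 ω q) 6 μ) (q s t : Fin 2) (n : Fin 6 → ℕ) :
    Integrable (fun ω => ∏ j, letter q s t (a (n j) ω) j) μ := by
  have := MemLp.prod' (s := Finset.univ) (p := fun _ : Fin 6 => 6) (μ := μ)
    (f := fun j ω => letter q s t (a (n j) ω) j)
    fun j _ => memLp_letter ha_ident ha_six q s t (n j) j
  rw [← memLp_one_iff_integrable]
  convert this
  simp only [Finset.sum_const, Finset.card_univ, Fintype.card_fin, nsmul_eq_mul, Nat.cast_ofNat]
  rw [ENNReal.mul_inv_cancel (by norm_num) (by norm_num), inv_one]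

/-- Grouping the factors by time, independence splits the expectation over the distinct times and
identical distribution moves each group to time `0`. The groups are the level sets of `n`. -/
theorem integral_prod_letter (ha_meas : ∀ n, Measurable (a n)) (ha_indep : iIndepFun a μ)
    (ha_ident : ∀ n, IdentDistrib (a n) (a 0) μ μ) (q s t : Fin 2) (n : Fin 6 → ℕ) :
    ∫ ω, ∏ j, letter q s t (a (n j) ω) j ∂μ =
      patternMoment μ (a 0) q s t (kerPartition n) := by
  have hY : ∀ B : Finset (Fin 6), Measurable fun v : Fin 2 → ℂ => ∏ j ∈ B, letter q s t v j :=
    fun B => Finset.measurable_fun_prod _ fun j _ => measurable_letter q s t j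
  have h1 : ∀ ω, ∏ j, letter q s t (a (n j) ω) j =
      ∏ τ : (Finset.univ.image n : Finset ℕ),
        ∏ j ∈ Finset.univ.filter (fun j => n j = τ), letter q s t (a τ ω) j := by
    intro ω
    rw [Finset.prod_coe_sort (Finset.univ.image n) (fun τ =>
      ∏ j ∈ Finset.univ.filter (fun j => n j = τ), letter q s t (a τ ω) j),
      ← Finset.prod_fiberwise_of_maps_to (t := Finset.univ.image n) (g := n)
      (fun j _ => Finset.mem_image_of_mem n (Finset.mem_univ j))]
    refine Finset.prod_congr rfl fun τ _ => Finset.prod_congr rfl fun j hj => ?_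
    rw [(Finset.mem_filter.1 hj).2]
  simp only [h1]
  have hind : iIndepFun (fun τ : (Finset.univ.image n : Finset ℕ) => a τ) μ :=
    ha_indep.precomp Subtype.val_injective
  rw [hind.integral_fun_prod_comp
    (f := fun (τ : (Finset.univ.image n : Finset ℕ)) v => ∏ j ∈ Finset.univ.filter (fun j => n j = τ), letter q s t v j)
    (fun τ => (ha_meas τ).aemeasurable) (fun τ => (hY _).aestronglyMeasurable)]
  have h2 : ∀ τ : ℕ, ∫ ω, ∏ j ∈ Finset.univ.filter (fun j => n j = τ), letter q s t (a τ ω) j ∂μ =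
      ∫ ω, ∏ j ∈ Finset.univ.filter (fun j => n j = τ), letter q s t (a 0 ω) j ∂μ :=
    fun τ => ((ha_ident τ).comp (hY _)).integral_eq
  simp only [h2]
  rw [Finset.prod_coe_sort (Finset.univ.image n) (fun τ =>
      ∫ ω, ∏ j ∈ Finset.univ.filter (fun j => n j = τ), letter q s t (a 0 ω) j ∂μ)]
  rw [patternMoment, kerPartition_parts]
  have hinj : Set.InjOn (fun τ => Finset.univ.filter fun j => n j = τ)
      (Finset.univ.image n : Finset ℕ) := by
    intro x hx y _ hxy
    rw [Finset.mem_coe, Finset.mem_image] at hx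
    obtain ⟨i, _, hi⟩ := hx
    have h6 := Finset.ext_iff.1 hxy i
    simp only [Finset.mem_filter, Finset.mem_univ, true_and] at h6
    rw [← hi]
    exact h6.1 hi
  rw [Finset.prod_image (f := fun B => ∫ ω, ∏ j ∈ B, letter q s t (a 0 ω) j ∂μ) hinj]

theorem patternMoment_singleton (ha_mean : ∀ q, ∫ ω, a 0 ω q ∂μ = 0) (q s t : Fin 2)
    {π : Finpartition (Finset.univ : Finset (Fin 6))} (h : ∃ B ∈ π.parts, B.card ≤ 1) :
    patternMoment μ (a 0) q s t π = 0 := by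
  obtain ⟨B, hB, hc⟩ := h
  have : B.card = 1 := le_antisymm hc (Finset.card_pos.2 (π.nonempty_of_mem_parts hB))
  obtain ⟨j, rfl⟩ := Finset.card_eq_one.1 this
  refine Finset.prod_eq_zero hB ?_
  simp only [Finset.prod_singleton, letter]
  split_ifs
  · exact ha_mean _
  · rw [integral_conj, ha_mean, map_zero]

/-- Time assignments constant on the blocks of `σ` are the functions on the set of blocks, composed
with the map from a position to its block. The sum over them factorises, with one free time per
block. -/
theorem sum_constant_on_blocks (e : Fin 6 → ℕ → ℂ) (W : ℕ)
    (σ : Finpartition (Finset.univ : Finset (Fin 6))) :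
    ∑ n ∈ Fintype.piFinset (fun _ : Fin 6 => Finset.range W), (∏ j, e j (n j)) *
        (if ∀ A ∈ σ.parts, ∃ B ∈ (kerPartition n).parts, A ⊆ B then 1 else 0) =
      ∏ B ∈ σ.parts, ∑ τ ∈ Finset.range W, ∏ j ∈ B, e j τ := by
  have hcond : ∀ n : Fin 6 → ℕ,
      (∀ A ∈ σ.parts, ∃ B ∈ (kerPartition n).parts, A ⊆ B) ↔
      ∀ A ∈ σ.parts, ∀ i ∈ A, ∀ j ∈ A, n i = n j := by
    intro n
    refine forall₂_congr fun A hA => ?_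
    constructor
    · rintro ⟨B, hB, hAB⟩ i hi j hj
      have h1 := (kerPartition n).part_eq_of_mem hB (hAB hi)
      have h2 := mem_part_kerPartition.1 (h1 ▸ hAB hj)
      exact h2
    · intro h
      obtain ⟨i, hi⟩ := σ.nonempty_of_mem_parts hA
      refine ⟨(kerPartition n).part i,
        (Finpartition.part_mem _).2 (Finset.mem_univ _), fun j hj => ?_⟩
      exact mem_part_kerPartition.2 (h i hi j hj)
  have hpm : ∀ j, σ.part j ∈ σ.parts := fun j => σ.part_mem.2 (Finset.mem_univ j)
  have hself : ∀ i, i ∈ σ.part i := fun i => σ.mem_part_self.2 (Finset.mem_univ i)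
  have h1 : ∀ y : σ.parts → ℕ, ∏ B : σ.parts, ∏ j ∈ (B : Finset (Fin 6)), e j (y B) =
      ∏ j, e j (y ⟨σ.part j, hpm j⟩) := by
    intro y
    have h2 : ∀ B : σ.parts, ∏ j ∈ (B : Finset (Fin 6)), e j (y B) =
        ∏ j ∈ (B : Finset (Fin 6)), e j (y ⟨σ.part j, hpm j⟩) := fun B =>
      Finset.prod_congr rfl fun j hj => by
        congr 2
        exact Subtype.ext (σ.part_eq_of_mem B.2 hj).symm
    simp only [h2]
    rw [Finset.prod_coe_sort σ.parts fun B => ∏ j ∈ B, e j (y ⟨σ.part j, hpm j⟩)]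
    have := Finset.prod_biUnion (f := fun j => e j (y ⟨σ.part j, hpm j⟩)) σ.disjoint
    rw [σ.biUnion_parts] at this
    exact this.symm
  rw [← Finset.prod_coe_sort σ.parts fun B => ∑ τ ∈ Finset.range W, ∏ j ∈ B, e j τ,
    Finset.prod_univ_sum]
  simp only [h1, hcond]
  symm
  refine Finset.sum_of_injOn (fun y j => y ⟨σ.part j, hpm j⟩) ?_ ?_ ?_ ?_
  · intro y _ y' _ h
    ext B
    obtain ⟨i, hi⟩ := σ.nonempty_of_mem_parts B.2
    have := congrFun h i
    have hB : (⟨σ.part i, hpm i⟩ : σ.parts) = B := Subtype.ext (σ.part_eq_of_mem B.2 hi)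
    simpa only [hB] using this
  · intro y hy
    simp only [Finset.mem_coe, Fintype.mem_piFinset] at hy ⊢
    exact fun j => by simpa using hy ⟨σ.part j, hpm j⟩
  -- An assignment constant on the blocks is recovered from its values at chosen block
  -- representatives, so one outside the image fails the condition.
  · intro n hn hni
    rw [if_neg, mul_zero]
    intro hc
    refine hni ⟨fun B => n (σ.nonempty_of_mem_parts B.2).choose, ?_, ?_⟩
    · rw [Finset.mem_coe, Fintype.mem_piFinset]
      exact fun B => Fintype.mem_piFinset.1 hn _
    · ext j
      exact hc _ (hpm j) _ (σ.nonempty_of_mem_parts (hpm j)).choose_spec _ (hself j)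
  · intro y _
    rw [if_pos, mul_one]
    intro A hA i hi j hj
    simp only [σ.part_eq_of_mem hA hi, σ.part_eq_of_mem hA hj]

/-- After expansion, the moment of the exact coincidence pattern of `n` is written as the sum of
`deltaWeight` over all `σ` refining that pattern. Exchanging the sums leaves, for each `σ`,
assignments merely constant on its blocks. -/
theorem integral_prod_sum_letter (ha_meas : ∀ n, Measurable (a n)) (ha_indep : iIndepFun a μ)
    (ha_ident : ∀ n, IdentDistrib (a n) (a 0) μ μ)
    (ha_six : ∀ q, MemLp (fun ω => a 0 ω q) 6 μ) (ha_mean : ∀ q, ∫ ω, a 0 ω q ∂μ = 0)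
    (q s t : Fin 2) (W : ℕ) (e : Fin 6 → ℕ → ℂ) :
    Integrable (fun ω => ∏ j, ∑ n ∈ Finset.range W, letter q s t (a n ω) j * e j n) μ ∧
    ∫ ω, ∏ j, ∑ n ∈ Finset.range W, letter q s t (a n ω) j * e j n ∂μ =
      ∑ σ : Finpartition (Finset.univ : Finset (Fin 6)), deltaWeight μ (a 0) q s t σ *
        ∏ B ∈ σ.parts, ∑ τ ∈ Finset.range W, ∏ j ∈ B, e j τ := by
  have h1 : ∀ ω, ∏ j, ∑ n ∈ Finset.range W, letter q s t (a n ω) j * e j n =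
      ∑ n ∈ Fintype.piFinset (fun _ : Fin 6 => Finset.range W),
        (∏ j, letter q s t (a (n j) ω) j) * ∏ j, e j (n j) := by
    intro ω
    rw [Finset.prod_univ_sum]
    simp only [Finset.prod_mul_distrib]
  have hint : ∀ n : Fin 6 → ℕ,
      Integrable (fun ω => (∏ j, letter q s t (a (n j) ω) j) * ∏ j, e j (n j)) μ :=
    fun n => (integrable_prod_letter ha_ident ha_six q s t n).mul_const _
  simp only [h1]
  refine ⟨integrable_finsetSum _ fun n _ => hint n, ?_⟩
  rw [integral_finsetSum _ fun n _ => hint n]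
  simp only [integral_mul_const, integral_prod_letter ha_meas ha_indep ha_ident]
  have h2 : ∀ n : Fin 6 → ℕ,
      patternMoment μ (a 0) q s t (kerPartition n) =
      ∑ σ : Finpartition (Finset.univ : Finset (Fin 6)), deltaWeight μ (a 0) q s t σ *
        (if ∀ A ∈ σ.parts, ∃ B ∈ (kerPartition n).parts, A ⊆ B
          then 1 else 0) := by
    intro n
    simp only [deltaWeight, Finset.sum_mul]
    rw [Finset.sum_comm]
    symm
    have h3 : ∀ π : Finpartition (Finset.univ : Finset (Fin 6)),
        ∑ σ : Finpartition (Finset.univ : Finset (Fin 6)),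
          exclusion π σ * patternMoment μ (a 0) q s t π *
          (if ∀ A ∈ σ.parts, ∃ B ∈ (kerPartition n).parts, A ⊆ B
          then 1 else 0) = if π = kerPartition n then
            patternMoment μ (a 0) q s t π else 0 := by
      intro π
      -- Inversion is available only without singletons; otherwise the moment of `π` is zero and
      -- nothing is needed.
      by_cases hπ : ∀ B ∈ π.parts, 1 < B.card
      · have := congrArg (patternMoment μ (a 0) q s t π * ·)
          (sum_exclusion_le π (kerPartition n) hπ)
        simp only [Finset.mul_sum, mul_ite, mul_one, mul_zero] at this ⊢
        rw [← this]
        refine Finset.sum_congr rfl fun σ _ => ?_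
        split_ifs
        · ring
        · rfl
      · rw [patternMoment_singleton ha_mean q s t (by simpa using hπ)]
        simp
    simp only [h3]
    rw [Finset.sum_ite_eq' Finset.univ, if_pos (Finset.mem_univ _)]
  simp only [h2, Finset.sum_mul]
  rw [Finset.sum_comm]
  refine Finset.sum_congr rfl fun σ _ => ?_
  rw [← sum_constant_on_blocks, Finset.mul_sum]
  refine Finset.sum_congr rfl fun n _ => ?_
  ring

end Correlation

/-- Geometric sum of a `W`-th root of unity, which equals `1` precisely when `W` divides `r`. -/
theorem sum_exp_range {W : ℕ} (hW : 0 < W) (r : ℤ) :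
    ∑ n ∈ Finset.range W, Complex.exp (-(2 * Real.pi * Complex.I * r * n / W)) =
      W * if (W : ℤ) ∣ r then 1 else 0 := by
  have hW' : (W : ℂ) ≠ 0 := Nat.cast_ne_zero.2 hW.ne'
  have hpow : ∀ n : ℕ, Complex.exp (-(2 * Real.pi * Complex.I * r * n / W)) =
      Complex.exp (-(2 * Real.pi * Complex.I * r / W)) ^ n := by
    intro n
    rw [← Complex.exp_nat_mul]
    congr 1
    ring
  have hiff : Complex.exp (-(2 * Real.pi * Complex.I * r / W)) = 1 ↔ (W : ℤ) ∣ r := by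
    rw [Complex.exp_eq_one_iff]
    have h2 : (2 * Real.pi * Complex.I : ℂ) ≠ 0 := Complex.two_pi_I_ne_zero
    constructor
    · rintro ⟨n, hn⟩
      refine ⟨-n, ?_⟩
      field_simp at hn
      have : (r : ℂ) = W * (-n : ℤ) := by
        push_cast
        linear_combination (-1 : ℂ) * hn
      exact_mod_cast this
    · rintro ⟨n, rfl⟩
      refine ⟨-n, ?_⟩
      push_cast
      field_simp
  simp only [hpow]
  split_ifs with h
  · simp [hiff.2 h]
  · have h1 : Complex.exp (-(2 * Real.pi * Complex.I * r / W)) ≠ 1 := fun h' => h (hiff.1 h')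
    rw [geom_sum_eq h1, ← hpow]
    have : Complex.exp (-(2 * Real.pi * Complex.I * r * W / W)) = 1 := by
      rw [mul_div_assoc, div_self hW', mul_one, Complex.exp_eq_one_iff]
      exact ⟨-r, by push_cast; ring⟩
    rw [this]
    simp

/-! ### The mean line powers of the first-order interference -/

/-- `P(kΔ) P*(mΔ) P((i - k + m)Δ) η(kΔ, mΔ, iΔ)`. -/
noncomputable def gridAmp (P : ℝ → ℂ) (lk : Link) (Δ : ℝ) (i k m : ℤ) : ℂ :=
  P (k * Δ) * conj (P (m * Δ)) * P ((i - k + m : ℤ) * Δ) * eta lk (k * Δ) (m * Δ) (i * Δ)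

/-- The six line indices of a summation index. -/
def lineIndices (i : ℤ) (v : ℤ × ℤ × ℤ × ℤ) : Fin 6 → ℤ :=
  ![v.1, v.2.1, i - v.1 + v.2.1, v.2.2.1, v.2.2.2, i - v.2.2.1 + v.2.2.2]

theorem gridKernel_lineIndices (P : ℝ → ℂ) (lk : Link) (Δ : ℝ) (i : ℤ) (v : ℤ × ℤ × ℤ × ℤ) :
    gridKernel P lk Δ (lineIndices i v) =
      gridAmp P lk Δ i v.1 v.2.1 * conj (gridAmp P lk Δ i v.2.2.1 v.2.2.2) := by
  obtain ⟨k, m, k', m'⟩ := v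
  have h0 : lineIndices i (k, m, k', m') 0 = k := rfl
  have h1 : lineIndices i (k, m, k', m') 1 = m := rfl
  have h2 : lineIndices i (k, m, k', m') 2 = i - k + m := rfl
  have h3 : lineIndices i (k, m, k', m') 3 = k' := rfl
  have h4 : lineIndices i (k, m, k', m') 4 = m' := rfl
  have h5 : lineIndices i (k, m, k', m') 5 = i - k' + m' := rfl
  have e1 : ((k : ℝ) - m + ((i - k + m : ℤ) : ℝ)) = i := by push_cast; ring
  have e2 : ((k' : ℝ) - m' + ((i - k' + m' : ℤ) : ℝ)) = i := by push_cast; ring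
  simp only [gridKernel, gridAmp, h0, h1, h2, h3, h4, h5, e1, e2, map_mul, Complex.conj_conj]
  ring

/-- The lines of the spectrum `P` vanish beyond index `W`. -/
theorem IsPulseSpectrum.eq_zero_of_index {R : ℝ} (hR : 0 < R) {p : ℝ → ℝ} {P : ℝ → ℂ}
    (hP : IsPulseSpectrum R p P) {W : ℕ} (hW : 0 < W) {k : ℤ} (hk : (W : ℤ) < |k|) :
    P (k * (R / W)) = 0 := by
  apply hP.bandlimited
  have hW' : (0 : ℝ) < W := Nat.cast_pos.2 hW
  have hk' : (W : ℝ) < |(k : ℝ)| := by exact_mod_cast hk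
  rw [abs_mul, abs_of_pos (div_pos hR hW')]
  -- The cut-off index `W` is twice the band edge `W / 2`, which avoids halving an integer.
  calc R / 2 < R := half_lt_self hR
    _ = W * (R / W) := by field_simp
    _ ≤ |(k : ℝ)| * (R / W) := by gcongr

theorem gridAmp_eq_zero {R : ℝ} (hR : 0 < R) {p : ℝ → ℝ} {P : ℝ → ℂ}
    (hP : IsPulseSpectrum R p P) (lk : Link) {W : ℕ} (hW : 0 < W) (i : ℤ) {k m : ℤ}
    (h : ¬ (|k| ≤ W ∧ |m| ≤ W)) : gridAmp P lk (R / W) i k m = 0 := by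
  rw [not_and_or, not_le, not_le] at h
  rcases h with h | h <;> simp [gridAmp, hP.eq_zero_of_index hR hW h]

/-- Summation indices that can carry a non-zero kernel. -/
noncomputable def indexBox (W : ℕ) : Finset (ℤ × ℤ × ℤ × ℤ) :=
  Finset.Icc (-W : ℤ) W ×ˢ Finset.Icc (-W : ℤ) W ×ˢ Finset.Icc (-W : ℤ) W ×ˢ Finset.Icc (-W : ℤ) W

theorem gridAmp_mul_eq_zero {R : ℝ} (hR : 0 < R) {p : ℝ → ℝ} {P : ℝ → ℂ}
    (hP : IsPulseSpectrum R p P) (lk : Link) {W : ℕ} (hW : 0 < W) (i : ℤ) {v : ℤ × ℤ × ℤ × ℤ}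
    (hv : v ∉ indexBox W) :
    gridAmp P lk (R / W) i v.1 v.2.1 * conj (gridAmp P lk (R / W) i v.2.2.1 v.2.2.2) = 0 := by
  by_contra hne
  rw [mul_eq_zero, not_or, map_eq_zero] at hne
  have h1 := fun h => hne.1 (gridAmp_eq_zero hR hP lk hW i h)
  have h2 := fun h => hne.2 (gridAmp_eq_zero hR hP lk hW i h)
  simp only [imp_false, not_not, abs_le] at h1 h2
  exact hv (by simp only [indexBox, Finset.mem_product, Finset.mem_Icc]; tauto)

/-- Conjugation reverses the sign of the line index, which is the origin of the signs in
`blockFreq`; the six normalisations `√Δ` give `Δ ^ 3`. -/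
theorem prod_dft {Δ : ℝ} (hΔ : 0 ≤ Δ) (W : ℕ) (u : ℕ → Fin 2 → ℂ) (q s t : Fin 2) (κ : Fin 6 → ℤ) :
    dft Δ W u s (κ 0) * conj (dft Δ W u s (κ 1)) * dft Δ W u q (κ 2) *
      conj (dft Δ W u t (κ 3)) * dft Δ W u t (κ 4) * conj (dft Δ W u q (κ 5)) =
    (Δ : ℂ) ^ 3 * ∏ j, ∑ n ∈ Finset.range W, letter q s t (u n) j *
      Complex.exp (-(2 * Real.pi * Complex.I * (if Even (j : ℕ) then κ j else -κ j : ℤ) * n / W)) := by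
  have hc : ∀ r k, conj (dft Δ W u r k) = (Real.sqrt Δ : ℂ) * ∑ n ∈ Finset.range W,
      conj (u n r) * Complex.exp (-(2 * Real.pi * Complex.I * (-k : ℤ) * n / W)) := by
    intro r k
    simp only [dft, map_mul, map_sum, Complex.conj_ofReal, ← Complex.exp_conj]
    congr 1
    refine Finset.sum_congr rfl fun n _ => ?_
    congr 2
    simp [Complex.conj_ofNat]
  have h6 : (Real.sqrt Δ : ℂ) ^ 6 = (Δ : ℂ) ^ 3 := by
    rw [← Complex.ofReal_pow, ← Complex.ofReal_pow]
    congr 1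
    rw [show 6 = 2 * 3 from rfl, pow_mul, Real.sq_sqrt hΔ]
  have e0 : Even ((0 : Fin 6) : ℕ) := by decide
  have e1 : ¬ Even ((1 : Fin 6) : ℕ) := by decide
  have e2 : Even ((2 : Fin 6) : ℕ) := by decide
  have e3 : ¬ Even ((3 : Fin 6) : ℕ) := by decide
  have e4 : Even ((4 : Fin 6) : ℕ) := by decide
  have e5 : ¬ Even ((5 : Fin 6) : ℕ) := by decide
  have v0 : ![s, s, q, t, t, q] 0 = s := rfl
  have v1 : ![s, s, q, t, t, q] 1 = s := rfl
  have v2 : ![s, s, q, t, t, q] 2 = q := rfl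
  have v3 : ![s, s, q, t, t, q] 3 = t := rfl
  have v4 : ![s, s, q, t, t, q] 4 = t := rfl
  have v5 : ![s, s, q, t, t, q] 5 = q := rfl
  rw [Fin.prod_univ_six, ← h6]
  simp only [hc, letter, e0, e1, e2, e3, e4, e5, if_true, if_false, v0, v1, v2, v3, v4, v5]
  simp only [dft]
  ring

theorem prod_exp_block (κ : Fin 6 → ℤ) (W n : ℕ) (B : Finset (Fin 6)) :
    ∏ j ∈ B, Complex.exp (-(2 * Real.pi * Complex.I * (if Even (j : ℕ) then κ j else -κ j : ℤ) *
      n / W)) = Complex.exp (-(2 * Real.pi * Complex.I * blockFreq κ B * n / W)) := by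
  rw [← Complex.exp_sum]
  congr 1
  rw [blockFreq, Finset.sum_neg_distrib]
  push_cast
  rw [Finset.mul_sum, Finset.sum_mul, Finset.sum_div]

section Power

variable {Ω : Type*} [MeasurableSpace Ω] {μ : Measure Ω} {a : ℕ → Ω → Fin 2 → ℂ}

/-- The product of the six Fourier coefficients. -/
noncomputable def dftProd (Δ : ℝ) (W : ℕ) (u : ℕ → Fin 2 → ℂ) (q s t : Fin 2) (κ : Fin 6 → ℤ) : ℂ :=
  dft Δ W u s (κ 0) * conj (dft Δ W u s (κ 1)) * dft Δ W u q (κ 2) *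
      conj (dft Δ W u t (κ 3)) * dft Δ W u t (κ 4) * conj (dft Δ W u q (κ 5))

theorem integral_dftProd (ha_meas : ∀ n, Measurable (a n)) (ha_indep : iIndepFun a μ)
    (ha_ident : ∀ n, IdentDistrib (a n) (a 0) μ μ)
    (ha_six : ∀ q, MemLp (fun ω => a 0 ω q) 6 μ) (ha_mean : ∀ q, ∫ ω, a 0 ω q ∂μ = 0)
    {Δ : ℝ} (hΔ : 0 ≤ Δ) {W : ℕ} (hW : 0 < W) (q s t : Fin 2) (κ : Fin 6 → ℤ) :
    Integrable (fun ω => dftProd Δ W (fun n => a n ω) q s t κ) μ ∧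
    ∫ ω, dftProd Δ W (fun n => a n ω) q s t κ ∂μ =
      (Δ : ℂ) ^ 3 * ∑ σ : Finpartition (Finset.univ : Finset (Fin 6)),
        (W : ℂ) ^ σ.parts.card * deltaWeight μ (a 0) q s t σ *
          ∏ B ∈ σ.parts, if (W : ℤ) ∣ blockFreq κ B then 1 else 0 := by
  simp only [dftProd, prod_dft hΔ]
  obtain ⟨h1, h2⟩ := integral_prod_sum_letter ha_meas ha_indep ha_ident ha_six ha_mean q s t W
    fun j n => Complex.exp (-(2 * Real.pi * Complex.I *
      (if Even (j : ℕ) then κ j else -κ j : ℤ) * n / W))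
  refine ⟨h1.const_mul _, ?_⟩
  rw [integral_const_mul, h2]
  simp only [prod_exp_block, sum_exp_range hW, Finset.prod_mul_distrib, Finset.prod_const]
  exact congrArg _ (Finset.sum_congr rfl fun σ _ => by ring)

/-- The product of a line with its conjugate is a double sum over pairs `(k, m)` and `(k', m')`.
Each side contributes three launch factors `√Δ`, whence the outer `Δ ^ 3`, one power more than in
`psdCoeff`. -/
theorem normSq_nliLine {R : ℝ} (hR : 0 < R) {p : ℝ → ℝ} {P : ℝ → ℂ}
    (hP : IsPulseSpectrum R p P) (lk : Link) {W : ℕ} (hW : 0 < W) (u : ℕ → Fin 2 → ℂ) (q : Fin 2)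
    (i : ℤ) :
    ((‖nliLine lk (R / W) (launch P (R / W) W u) q i‖ ^ 2 : ℝ) : ℂ) =
      (8 / 9) ^ 2 * (lk.γ : ℂ) ^ 2 * ((R / W : ℝ) : ℂ) ^ 3 *
      ∑ v ∈ indexBox W, gridKernel P lk (R / W) (lineIndices i v) *
        ∑ s : Fin 2, ∑ t : Fin 2, dftProd (R / W) W u q s t (lineIndices i v) := by
  have hΔ : 0 ≤ R / W := by positivity
  set Δ := R / W with hΔdef
  have hC : ∀ q k, (W : ℤ) < |k| → launch P Δ W u q k = 0 := fun q k hk => by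
    simp [launch, hΔdef, hP.eq_zero_of_index hR hW hk]
  have h3 : (Real.sqrt Δ : ℂ) ^ 2 = Δ := by
    rw [← Complex.ofReal_pow, Real.sq_sqrt hΔ]
  have hline : nliLine lk Δ (launch P Δ W u) q i = Complex.I * (8 / 9) * lk.γ *
      ((Real.sqrt Δ : ℂ) ^ 3 * ∑ k ∈ Finset.Icc (-W : ℤ) W, ∑ m ∈ Finset.Icc (-W : ℤ) W,
        gridAmp P lk Δ i k m *
          ∑ s : Fin 2, dft Δ W u s k * conj (dft Δ W u s m) * dft Δ W u q (i - k + m)) := by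
    rw [nliLine, tsum_mixProd_mul hC, Finset.sum_product]
    congr 1
    rw [Finset.mul_sum]
    refine Finset.sum_congr rfl fun k _ => ?_
    rw [Finset.mul_sum]
    refine Finset.sum_congr rfl fun m _ => ?_
    simp only [mixProd, launch, gridAmp, map_mul, Complex.conj_ofReal, Fin.sum_univ_two]
    ring
  have hsq : ∀ z : ℂ, ((‖z‖ ^ 2 : ℝ) : ℂ) = z * conj z := fun z => by
    rw [Complex.mul_conj, Complex.normSq_eq_norm_sq]
  rw [hsq, hline]
  simp only [map_mul, map_sum, indexBox, Finset.sum_product, gridKernel_lineIndices,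
    Complex.conj_ofReal, Complex.conj_I, map_pow, map_div₀, Complex.conj_ofNat, Complex.conj_conj]
  have hprod : ∀ (F G : ℤ → ℤ → ℂ) (s : Finset ℤ), (∑ k ∈ s, ∑ m ∈ s, F k m) *
      (∑ k ∈ s, ∑ m ∈ s, G k m) = ∑ k ∈ s, ∑ m ∈ s, ∑ k' ∈ s, ∑ m' ∈ s, F k m * G k' m' := by
    intro F G s
    simp only [Finset.sum_mul]
    simp only [Finset.mul_sum]
  have hterm : ∀ k m k' m' : ℤ,
      (gridAmp P lk Δ i k m *
          ∑ s : Fin 2, dft Δ W u s k * conj (dft Δ W u s m) * dft Δ W u q (i - k + m)) *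
        (conj (gridAmp P lk Δ i k' m') *
          ∑ s : Fin 2, conj (dft Δ W u s k') * dft Δ W u s m' * conj (dft Δ W u q (i - k' + m'))) =
      gridAmp P lk Δ i k m * conj (gridAmp P lk Δ i k' m') *
        ∑ s : Fin 2, ∑ t : Fin 2, dftProd Δ W u q s t (lineIndices i (k, m, k', m')) := by
    intro k m k' m'
    have hd : ∀ s t, dftProd Δ W u q s t (lineIndices i (k, m, k', m')) =
      dft Δ W u s k * conj (dft Δ W u s m) * dft Δ W u q (i - k + m) *
        conj (dft Δ W u t k') * dft Δ W u t m' * conj (dft Δ W u q (i - k' + m')) :=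
      fun s t => rfl
    simp only [hd, Fin.sum_univ_two]
    ring
  simp only [← hterm]
  rw [← hprod (fun k m => gridAmp P lk Δ i k m *
          ∑ s : Fin 2, dft Δ W u s k * conj (dft Δ W u s m) * dft Δ W u q (i - k + m))
    (fun k' m' => conj (gridAmp P lk Δ i k' m') *
          ∑ s : Fin 2, conj (dft Δ W u s k') * dft Δ W u s m' * conj (dft Δ W u q (i - k' + m')))]
  rw [← h3]
  -- The two sides differ only by the factor `I * (-I) = 1`.
  linear_combination (-(8 / 9) ^ 2 * (lk.γ : ℂ) ^ 2 * (Real.sqrt Δ : ℂ) ^ 6 *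
    (∑ k ∈ Finset.Icc (-W : ℤ) W, ∑ m ∈ Finset.Icc (-W : ℤ) W, gridAmp P lk Δ i k m *
          ∑ s : Fin 2, dft Δ W u s k * conj (dft Δ W u s m) * dft Δ W u q (i - k + m)) *
    (∑ k ∈ Finset.Icc (-W : ℤ) W, ∑ m ∈ Finset.Icc (-W : ℤ) W, conj (gridAmp P lk Δ i k m) *
          ∑ s : Fin 2, conj (dft Δ W u s k) * dft Δ W u s m * conj (dft Δ W u q (i - k + m)))) *
    Complex.I_sq

theorem psdCoeff_eq_sum (μ : Measure Ω) (X : Ω → Fin 2 → ℂ) {R : ℝ} (hR : 0 < R) {p : ℝ → ℝ}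
    {P : ℝ → ℂ} (hP : IsPulseSpectrum R p P) (lk : Link) {W : ℕ} (hW : 0 < W)
    (T : Finset (Finpartition (Finset.univ : Finset (Fin 6)))) (δ : ℤ → ℂ) (q : Fin 2) (i : ℤ) :
    psdCoeff μ X P lk (R / W) W T δ q i =
      (8 / 9) ^ 2 * (lk.γ : ℂ) ^ 2 * ((R / W : ℝ) : ℂ) ^ 2 *
      ∑ v ∈ indexBox W, gridKernel P lk (R / W) (lineIndices i v) *
        ∑ s : Fin 2, ∑ t : Fin 2, ∑ σ ∈ T,
          ((R / W : ℝ) : ℂ) ^ 3 * (W : ℂ) ^ σ.parts.card * deltaWeight μ X q s t σ *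
            ∏ B ∈ σ.parts, δ (blockFreq (lineIndices i v) B) := by
  unfold psdCoeff
  congr 1
  refine tsum_eq_sum fun v hv => ?_
  have := gridAmp_mul_eq_zero hR hP lk hW i hv
  rw [← gridKernel_lineIndices] at this
  exact mul_eq_zero_of_left this _

theorem integral_normSq_nliLine (ha_meas : ∀ n, Measurable (a n)) (ha_indep : iIndepFun a μ)
    (ha_ident : ∀ n, IdentDistrib (a n) (a 0) μ μ)
    (ha_six : ∀ q, MemLp (fun ω => a 0 ω q) 6 μ) (ha_mean : ∀ q, ∫ ω, a 0 ω q ∂μ = 0)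
    {R : ℝ} (hR : 0 < R) {p : ℝ → ℝ} {P : ℝ → ℂ}
    (hP : IsPulseSpectrum R p P) (lk : Link) {W : ℕ} (hW : 0 < W) (q : Fin 2) (i : ℤ) :
    Integrable (fun ω => ‖nliLine lk (R / W) (launch P (R / W) W fun n => a n ω) q i‖ ^ 2) μ ∧
    ((∫ ω, ‖nliLine lk (R / W) (launch P (R / W) W fun n => a n ω) q i‖ ^ 2 ∂μ : ℝ) : ℂ) =
      ((R / W : ℝ) : ℂ) * psdCoeffFull μ (a 0) P lk (R / W) W q i := by
  have hΔ : 0 ≤ R / W := by positivity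
  have hd := fun s t κ =>
    integral_dftProd ha_meas ha_indep ha_ident ha_six ha_mean hΔ hW q s t κ
  have hi : ∀ v, Integrable (fun ω => gridKernel P lk (R / W) (lineIndices i v) *
        ∑ s : Fin 2, ∑ t : Fin 2, dftProd (R / W) W (fun n => a n ω) q s t (lineIndices i v)) μ :=
    fun v => (integrable_finsetSum _ fun s _ => integrable_finsetSum _ fun t _ =>
      (hd s t _).1).const_mul _
  have hint : Integrable (fun ω =>
      ((‖nliLine lk (R / W) (launch P (R / W) W fun n => a n ω) q i‖ ^ 2 : ℝ) : ℂ)) μ := by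
    simp only [normSq_nliLine hR hP lk hW]
    exact (integrable_finsetSum _ fun v _ => hi v).const_mul _
  refine ⟨hint.re.congr (ae_of_all _ fun ω => Complex.ofReal_re _), ?_⟩
  rw [← integral_complex_ofReal]
  simp only [normSq_nliLine hR hP lk hW]
  rw [integral_const_mul, integral_finsetSum _ fun v _ => hi v, psdCoeffFull,
    psdCoeff_eq_sum _ _ hR hP lk hW, ← mul_assoc]
  congr 1
  · ring
  · refine Finset.sum_congr rfl fun v _ => ?_
    rw [integral_const_mul, integral_finsetSum _ fun s _ => integrable_finsetSum _ fun t _ =>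
      (hd s t _).1]
    congr 1
    refine Finset.sum_congr rfl fun s _ => ?_
    rw [integral_finsetSum _ fun t _ => (hd s t _).1]
    refine Finset.sum_congr rfl fun t _ => ?_
    rw [(hd s t _).2, Finset.mul_sum]
    exact Finset.sum_congr rfl fun σ _ => by ring

end Power

/-! ### Lattice sums as integrals of step functions -/

theorem eq_floor_div_iff {Δ : ℝ} (hΔ : 0 < Δ) (k : ℤ) (x : ℝ) :
    ⌊x / Δ⌋ = k ↔ x ∈ Set.Ico (k * Δ) ((k + 1) * Δ) := by
  rw [Int.floor_eq_iff, le_div_iff₀ hΔ, div_lt_iff₀ hΔ, Set.mem_Ico]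

theorem abs_floor_mul_sub_le {Δ : ℝ} (hΔ : 0 < Δ) (x : ℝ) : |⌊x / Δ⌋ * Δ - x| ≤ Δ := by
  have h := (eq_floor_div_iff hΔ ⌊x / Δ⌋ x).1 rfl
  rw [abs_le]
  constructor <;> nlinarith [h.1, h.2]

theorem finite_support_lattice {Δ M : ℝ} (hΔ : 0 < Δ) {h : ℤ → ℂ}
    (hs : ∀ k : ℤ, M < |k * Δ| → h k = 0) : ∀ k ∉ Finset.Icc (-⌈M / Δ⌉) ⌈M / Δ⌉, h k = 0 := by
  intro k hk
  apply hs
  by_contra! hc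
  rw [abs_mul, abs_of_pos hΔ, ← le_div_iff₀ hΔ] at hc
  have h1 : (|k| : ℝ) ≤ (⌈M / Δ⌉ : ℝ) := hc.trans (Int.le_ceil _)
  have h2 : |k| ≤ ⌈M / Δ⌉ := by exact_mod_cast h1
  exact hk (by simpa [abs_le] using h2)

theorem measurable_step (Δ : ℝ) (h : ℤ → ℂ) : Measurable fun x : ℝ => h ⌊x / Δ⌋ :=
  (measurable_from_top (f := h)).comp (Int.measurable_floor.comp (measurable_id.div_const Δ))

/-- Each lattice point owns a cell of length `Δ`. Reading Riemann sums as integrals makes dominated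
convergence available for spectra that are only almost everywhere continuous. -/
theorem integral_step {Δ M : ℝ} (hΔ : 0 < Δ) {h : ℤ → ℂ}
    (hs : ∀ k : ℤ, M < |k * Δ| → h k = 0) :
    ∫ x : ℝ, h ⌊x / Δ⌋ = (Δ : ℂ) * ∑' k, h k := by
  have h0 := finite_support_lattice hΔ hs
  set F := Finset.Icc (-⌈M / Δ⌉) ⌈M / Δ⌉
  have h1 : ∀ x : ℝ, h ⌊x / Δ⌋ =
      ∑ k ∈ F, (Set.Ico (k * Δ) ((k + 1) * Δ)).indicator (fun _ => h k) x := by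
    intro x
    have : ∀ k : ℤ, (Set.Ico (k * Δ) ((k + 1) * Δ)).indicator (fun _ => h k) x =
        if ⌊x / Δ⌋ = k then h k else 0 := by
      intro k
      simp only [Set.indicator_apply, ← eq_floor_div_iff hΔ]
    simp only [this, Finset.sum_ite_eq]
    split_ifs with hk
    · rfl
    · exact h0 _ hk
  have hvol : ∀ k : ℤ, volume.real (Set.Ico (k * Δ) ((k + 1) * Δ)) = Δ := by
    intro k
    rw [Real.volume_real_Ico_of_le (by nlinarith)]
    ring
  simp only [h1]
  rw [integral_finsetSum, tsum_eq_sum h0, Finset.mul_sum]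
  · refine Finset.sum_congr rfl fun k _ => ?_
    rw [integral_indicator measurableSet_Ico, setIntegral_const, hvol]
    simp
  · intro k _
    exact (integrable_indicator_iff measurableSet_Ico).2
      (integrableOn_const (by simp [Real.volume_Ico]) (by simp))

/-- Rounding to the lattice moves a point by at most `Δ ≤ D`, so enlarging the support by `D` gives
an interval independent of the mesh. -/
theorem step_eq_zero {Δ M D : ℝ} (hΔ : 0 < Δ) (hD : Δ ≤ D) {h : ℤ → ℂ}
    (hs : ∀ k : ℤ, M < |k * Δ| → h k = 0) {x : ℝ} (hx : x ∉ Set.Icc (-(M + D)) (M + D)) :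
    h ⌊x / Δ⌋ = 0 := by
  apply hs
  by_contra! hc
  have h1 := abs_floor_mul_sub_le hΔ x
  rw [abs_le] at hc h1
  exact hx ⟨by linarith [hc.1, h1.2], by linarith [hc.2, h1.1]⟩

theorem norm_lattice_sum_le {Δ M D C : ℝ} (hΔ : 0 < Δ) (hD : Δ ≤ D) (hM : 0 ≤ M) {h : ℤ → ℂ}
    (hC : ∀ k, ‖h k‖ ≤ C) (hs : ∀ k : ℤ, M < |k * Δ| → h k = 0) :
    ‖(Δ : ℂ) * ∑' k, h k‖ ≤ C * (2 * (M + D)) := by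
  rw [← integral_step hΔ hs,
    ← setIntegral_eq_integral_of_forall_compl_eq_zero (s := Set.Icc (-(M + D)) (M + D))
      (fun x hx => step_eq_zero hΔ hD hs hx)]
  refine (norm_setIntegral_le_of_norm_le_const (by simp [Real.volume_Icc])
    (fun x _ => hC _)).trans_eq ?_
  rw [Real.volume_real_Icc_of_le (by linarith)]
  ring

/-- Mesh sizes tending to zero. -/
structure IsMesh (Δ : ℕ → ℝ) (D : ℝ) : Prop where
  pos : ∀ n, 0 < Δ n
  le : ∀ n, Δ n ≤ D
  tendsto : Tendsto Δ atTop (𝓝 0)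

theorem IsMesh.tendsto_floor {Δ : ℕ → ℝ} {D : ℝ} (hΔ : IsMesh Δ D) (x : ℝ) :
    Tendsto (fun n => (⌊x / Δ n⌋ : ℝ) * Δ n) atTop (𝓝 x) := by
  rw [tendsto_iff_dist_tendsto_zero]
  exact squeeze_zero (fun _ => dist_nonneg) (fun n => abs_floor_mul_sub_le (hΔ.pos n) x) hΔ.tendsto

/-- Bounded, uniformly compactly supported lattice functions that converge almost everywhere as
step functions. -/
theorem tendsto_lattice_sum {Δ : ℕ → ℝ} {D M C : ℝ} (hΔ : IsMesh Δ D) (hM : 0 ≤ M)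
    {h : ℕ → ℤ → ℂ} (hC : ∀ n k, ‖h n k‖ ≤ C) (hs : ∀ n (k : ℤ), M < |(k : ℝ) * Δ n| → h n k = 0)
    {H : ℝ → ℂ} (hlim : ∀ᵐ x, Tendsto (fun n => h n ⌊x / Δ n⌋) atTop (𝓝 (H x))) :
    Tendsto (fun n => (Δ n : ℂ) * ∑' k, h n k) atTop (𝓝 (∫ x, H x)) ∧ Integrable H ∧
      (∫ x, H x) = ∫ x in (-M)..M, H x := by
  -- Beyond `M` the rounded points are eventually beyond `M` too. The limit therefore lives on `[-M,
  -- M]`, although the step functions may reach slightly further.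
  have hz : ∀ᵐ x, x ∉ Set.Icc (-M) M → H x = 0 := by
    filter_upwards [hlim] with x hx hxM
    have h1 : ∀ᶠ n in atTop, M < |(⌊x / Δ n⌋ : ℝ) * Δ n| := by
      have h2 := (hΔ.tendsto_floor x).abs
      have h3 : M < |x| := by
        rw [Set.mem_Icc, ← abs_le] at hxM
        exact not_le.1 hxM
      exact h2.eventually (lt_mem_nhds h3)
    refine tendsto_nhds_unique hx (tendsto_const_nhds.congr' ?_)
    filter_upwards [h1] with n hn using (hs n _ hn).symm
  have hmeas : AEStronglyMeasurable H := aestronglyMeasurable_of_tendsto_ae atTop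
    (fun n => (measurable_step (Δ n) (h n)).aestronglyMeasurable) hlim
  have hb : ∀ᵐ x, ‖H x‖ ≤ C := by
    filter_upwards [hlim] with x hx
    exact le_of_tendsto hx.norm (Eventually.of_forall fun n => hC n _)
  refine ⟨?_, ?_, ?_⟩
  · have e : ∀ n, (Δ n : ℂ) * ∑' k, h n k = ∫ x : ℝ, h n ⌊x / Δ n⌋ :=
      fun n => (integral_step (hΔ.pos n) (hs n)).symm
    simp only [e]
    refine tendsto_integral_of_dominated_convergence
      ((Set.Icc (-(M + D)) (M + D)).indicator fun _ => C)
      (fun n => (measurable_step (Δ n) (h n)).aestronglyMeasurable) ?_ ?_ hlim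
    · exact (integrable_indicator_iff measurableSet_Icc).2
        (integrableOn_const (by simp [Real.volume_Icc]) (by simp))
    · refine fun n => Eventually.of_forall fun x => ?_
      by_cases hx : x ∈ Set.Icc (-(M + D)) (M + D)
      · rw [Set.indicator_of_mem hx]
        exact hC n _
      · rw [Set.indicator_of_notMem hx, step_eq_zero (hΔ.pos n) (hΔ.le n) (hs n) hx, norm_zero]
  · have h1 : IntegrableOn H (Set.Icc (-M) M) :=
      IntegrableOn.of_bound (by simp [Real.volume_Icc]) hmeas.restrict C (ae_restrict_of_ae hb)
    refine ((integrable_indicator_iff measurableSet_Icc).2 h1).congr ?_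
    filter_upwards [hz] with x hx
    by_cases hxM : x ∈ Set.Icc (-M) M
    · rw [Set.indicator_of_mem hxM]
    · rw [Set.indicator_of_notMem hxM, hx hxM]
  · rw [intervalIntegral.integral_of_le (by linarith), ← integral_Icc_eq_integral_Ioc,
      setIntegral_eq_integral_of_ae_compl_eq_zero hz]

/-! Iterated sums; `K` is a power of `ℤ`. -/

theorem support_fst {K : Type*} [NormedAddCommGroup K] {Δ M : ℝ} (hΔ : 0 < Δ) {h : ℤ × K → ℂ}
    (hs : ∀ k, M < ‖k‖ * Δ → h k = 0) (k : ℤ) (hk : M < |(k : ℝ) * Δ|) (m : K) : h (k, m) = 0 := by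
  refine hs _ (hk.trans_le ?_)
  rw [abs_mul, abs_of_pos hΔ, ← Int.norm_eq_abs]
  gcongr
  exact norm_fst_le (k, m)

theorem support_snd {K : Type*} [NormedAddCommGroup K] {Δ M : ℝ} (hΔ : 0 < Δ) {h : ℤ × K → ℂ}
    (hs : ∀ k, M < ‖k‖ * Δ → h k = 0) (k : ℤ) (m : K) (hm : M < ‖m‖ * Δ) : h (k, m) = 0 := by
  refine hs _ (hm.trans_le ?_)
  gcongr
  exact norm_snd_le (k, m)

section Iterated

variable {K : Type*} [NormedAddCommGroup K] [ProperSpace K] [DiscreteTopology K]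

theorem summable_lattice_of_norm {Δ M : ℝ} (hΔ : 0 < Δ) {h : K → ℂ}
    (hs : ∀ k, M < ‖k‖ * Δ → h k = 0) : Summable h := by
  have hfin : (Metric.closedBall (0 : K) (M / Δ)).Finite :=
    (isCompact_closedBall _ _).finite ⟨inferInstance⟩
  refine summable_of_ne_finset_zero (s := hfin.toFinset) fun k hk => hs k ?_
  rw [Set.Finite.mem_toFinset, mem_closedBall_zero_iff, not_le, div_lt_iff₀ hΔ] at hk
  exact hk

theorem lattice_sum_succ {Δ M : ℝ} (hΔ : 0 < Δ) (d : ℕ) {h : ℤ × K → ℂ}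
    (hs : ∀ k, M < ‖k‖ * Δ → h k = 0) :
    (Δ : ℂ) ^ (d + 1) * ∑' k, h k = (Δ : ℂ) * ∑' k : ℤ, ((Δ : ℂ) ^ d * ∑' m, h (k, m)) := by
  rw [(summable_lattice_of_norm hΔ hs).tsum_prod, tsum_mul_left]
  ring

theorem norm_lattice_sum_succ_le {Δ M D C C' : ℝ} (hΔ : 0 < Δ) (hD : Δ ≤ D) (hM : 0 ≤ M) (d : ℕ)
    {h : ℤ × K → ℂ} (hs : ∀ k, M < ‖k‖ * Δ → h k = 0)
    (hC : ∀ k : ℤ, ‖(Δ : ℂ) ^ d * ∑' m, h (k, m)‖ ≤ C * C') :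
    ‖(Δ : ℂ) ^ (d + 1) * ∑' k, h k‖ ≤ C * (C' * (2 * (M + D))) := by
  rw [lattice_sum_succ hΔ d hs, ← mul_assoc]
  exact norm_lattice_sum_le hΔ hD hM hC fun k hk => by simp [support_fst hΔ hs k hk]

/-- The inner sums, uniformly bounded, form a lattice function of the first index to which the
one-dimensional theorem applies. Peeling off one index at a time leads directly to iterated
integrals, with exceptional null sets that may depend on the earlier variables; no joint
measurability or Fubini argument enters. -/
theorem tendsto_lattice_sum_succ {Δ : ℕ → ℝ} {D M C : ℝ} (hΔ : IsMesh Δ D) (hM : 0 ≤ M) (d : ℕ)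
    {h : ℕ → ℤ × K → ℂ} (hs : ∀ n k, M < ‖k‖ * Δ n → h n k = 0)
    (hC : ∀ n (k : ℤ), ‖(Δ n : ℂ) ^ d * ∑' m, h n (k, m)‖ ≤ C)
    {H : ℝ → ℂ} (hlim : ∀ᵐ x, Tendsto (fun n => (Δ n : ℂ) ^ d * ∑' m, h n (⌊x / Δ n⌋, m)) atTop
      (𝓝 (H x))) :
    Tendsto (fun n => (Δ n : ℂ) ^ (d + 1) * ∑' k, h n k) atTop (𝓝 (∫ x in (-M)..M, H x)) := by
  have e : ∀ n, (Δ n : ℂ) ^ (d + 1) * ∑' k, h n k =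
      (Δ n : ℂ) * ∑' k : ℤ, ((Δ n : ℂ) ^ d * ∑' m, h n (k, m)) :=
    fun n => lattice_sum_succ (hΔ.pos n) d (hs n)
  simp only [e]
  have := tendsto_lattice_sum hΔ hM (h := fun n k => (Δ n : ℂ) ^ d * ∑' m, h n (k, m)) hC
    (fun n k hk => by simp [support_fst (hΔ.pos n) (hs n) k hk]) hlim
  rw [this.2.2] at this
  exact this.1

end Iterated

theorem norm_lattice_sum₁_le {Δ M D C : ℝ} (hΔ : 0 < Δ) (hD : Δ ≤ D) (hM : 0 ≤ M) {h : ℤ → ℂ}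
    (hC : ∀ k, ‖h k‖ ≤ C) (hs : ∀ k, M < ‖k‖ * Δ → h k = 0) :
    ‖(Δ : ℂ) ^ 1 * ∑' k, h k‖ ≤ C * (2 * (M + D)) := by
  rw [pow_one]
  refine norm_lattice_sum_le hΔ hD hM hC fun k hk => hs k ?_
  rwa [abs_mul, abs_of_pos hΔ, ← Int.norm_eq_abs] at hk

theorem norm_lattice_sum₂_le {Δ M D C : ℝ} (hΔ : 0 < Δ) (hD : Δ ≤ D) (hM : 0 ≤ M)
    {h : ℤ × ℤ → ℂ} (hC : ∀ k, ‖h k‖ ≤ C) (hs : ∀ k, M < ‖k‖ * Δ → h k = 0) :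
    ‖(Δ : ℂ) ^ 2 * ∑' k, h k‖ ≤ C * (2 * (M + D) * (2 * (M + D))) :=
  norm_lattice_sum_succ_le hΔ hD hM 1 hs fun k =>
    norm_lattice_sum₁_le hΔ hD hM (fun _ => hC _) fun m hm => support_snd hΔ hs k m hm

theorem norm_lattice_sum₃_le {Δ M D C : ℝ} (hΔ : 0 < Δ) (hD : Δ ≤ D) (hM : 0 ≤ M)
    {h : ℤ × ℤ × ℤ → ℂ} (hC : ∀ k, ‖h k‖ ≤ C) (hs : ∀ k, M < ‖k‖ * Δ → h k = 0) :
    ‖(Δ : ℂ) ^ 3 * ∑' k, h k‖ ≤ C * (2 * (M + D) * (2 * (M + D)) * (2 * (M + D))) :=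
  norm_lattice_sum_succ_le hΔ hD hM 2 hs fun k =>
    norm_lattice_sum₂_le hΔ hD hM (fun _ => hC _) fun m hm => support_snd hΔ hs k m hm

theorem norm_lattice_sum₄_le {Δ M D C : ℝ} (hΔ : 0 < Δ) (hD : Δ ≤ D) (hM : 0 ≤ M)
    {h : ℤ × ℤ × ℤ × ℤ → ℂ} (hC : ∀ k, ‖h k‖ ≤ C) (hs : ∀ k, M < ‖k‖ * Δ → h k = 0) :
    ‖(Δ : ℂ) ^ 4 * ∑' k, h k‖ ≤
      C * (2 * (M + D) * (2 * (M + D)) * (2 * (M + D)) * (2 * (M + D))) :=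
  norm_lattice_sum_succ_le hΔ hD hM 3 hs fun k =>
    norm_lattice_sum₃_le hΔ hD hM (fun _ => hC _) fun m hm => support_snd hΔ hs k m hm

theorem tendsto_lattice_sum₁ {Δ : ℕ → ℝ} {D M C : ℝ} (hΔ : IsMesh Δ D) (hM : 0 ≤ M)
    {h : ℕ → ℤ → ℂ} (hC : ∀ n k, ‖h n k‖ ≤ C) (hs : ∀ n k, M < ‖k‖ * Δ n → h n k = 0)
    {H : ℝ → ℂ} (hlim : ∀ᵐ x, Tendsto (fun n => h n ⌊x / Δ n⌋) atTop (𝓝 (H x))) :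
    Tendsto (fun n => (Δ n : ℂ) ^ 1 * ∑' k, h n k) atTop (𝓝 (∫ x in (-M)..M, H x)) := by
  simp only [pow_one]
  have := tendsto_lattice_sum hΔ hM hC (fun n k hk => hs n k (by
    rwa [abs_mul, abs_of_pos (hΔ.pos n), ← Int.norm_eq_abs] at hk)) hlim
  rw [this.2.2] at this
  exact this.1

theorem tendsto_lattice_sum₂ {Δ : ℕ → ℝ} {D M C : ℝ} (hΔ : IsMesh Δ D) (hM : 0 ≤ M)
    {h : ℕ → ℤ × ℤ → ℂ} (hC : ∀ n k, ‖h n k‖ ≤ C) (hs : ∀ n k, M < ‖k‖ * Δ n → h n k = 0)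
    {H : ℝ → ℝ → ℂ} (hlim : ∀ᵐ x, ∀ᵐ y,
      Tendsto (fun n => h n (⌊x / Δ n⌋, ⌊y / Δ n⌋)) atTop (𝓝 (H x y))) :
    Tendsto (fun n => (Δ n : ℂ) ^ 2 * ∑' k, h n k) atTop
      (𝓝 (∫ x in (-M)..M, ∫ y in (-M)..M, H x y)) := by
  refine tendsto_lattice_sum_succ hΔ hM 1 hs (fun n k => norm_lattice_sum₁_le (hΔ.pos n) (hΔ.le n)
    hM (fun m => hC n (k, m)) fun m hm => support_snd (hΔ.pos n) (hs n) k m hm) ?_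
  filter_upwards [hlim] with x hx
  exact tendsto_lattice_sum₁ hΔ hM (fun n m => hC n _)
    (fun n m hm => support_snd (hΔ.pos n) (hs n) _ m hm) hx

theorem tendsto_lattice_sum₃ {Δ : ℕ → ℝ} {D M C : ℝ} (hΔ : IsMesh Δ D) (hM : 0 ≤ M)
    {h : ℕ → ℤ × ℤ × ℤ → ℂ} (hC : ∀ n k, ‖h n k‖ ≤ C) (hs : ∀ n k, M < ‖k‖ * Δ n → h n k = 0)
    {H : ℝ → ℝ → ℝ → ℂ} (hlim : ∀ᵐ x, ∀ᵐ y, ∀ᵐ z,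
      Tendsto (fun n => h n (⌊x / Δ n⌋, ⌊y / Δ n⌋, ⌊z / Δ n⌋)) atTop (𝓝 (H x y z))) :
    Tendsto (fun n => (Δ n : ℂ) ^ 3 * ∑' k, h n k) atTop
      (𝓝 (∫ x in (-M)..M, ∫ y in (-M)..M, ∫ z in (-M)..M, H x y z)) := by
  refine tendsto_lattice_sum_succ hΔ hM 2 hs (fun n k => norm_lattice_sum₂_le (hΔ.pos n) (hΔ.le n)
    hM (fun m => hC n (k, m)) fun m hm => support_snd (hΔ.pos n) (hs n) k m hm) ?_
  filter_upwards [hlim] with x hx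
  exact tendsto_lattice_sum₂ hΔ hM (fun n m => hC n _)
    (fun n m hm => support_snd (hΔ.pos n) (hs n) _ m hm) hx

theorem tendsto_lattice_sum₄ {Δ : ℕ → ℝ} {D M C : ℝ} (hΔ : IsMesh Δ D) (hM : 0 ≤ M)
    {h : ℕ → ℤ × ℤ × ℤ × ℤ → ℂ} (hC : ∀ n k, ‖h n k‖ ≤ C)
    (hs : ∀ n k, M < ‖k‖ * Δ n → h n k = 0)
    {H : ℝ → ℝ → ℝ → ℝ → ℂ} (hlim : ∀ᵐ x, ∀ᵐ y, ∀ᵐ z, ∀ᵐ w,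
      Tendsto (fun n => h n (⌊x / Δ n⌋, ⌊y / Δ n⌋, ⌊z / Δ n⌋, ⌊w / Δ n⌋)) atTop
        (𝓝 (H x y z w))) :
    Tendsto (fun n => (Δ n : ℂ) ^ 4 * ∑' k, h n k) atTop
      (𝓝 (∫ x in (-M)..M, ∫ y in (-M)..M, ∫ z in (-M)..M, ∫ w in (-M)..M, H x y z w)) := by
  refine tendsto_lattice_sum_succ hΔ hM 3 hs (fun n k => norm_lattice_sum₃_le (hΔ.pos n) (hΔ.le n)
    hM (fun m => hC n (k, m)) fun m hm => support_snd (hΔ.pos n) (hs n) k m hm) ?_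
  filter_upwards [hlim] with x hx
  exact tendsto_lattice_sum₃ hΔ hM (fun n m => hC n _)
    (fun n m hm => support_snd (hΔ.pos n) (hs n) _ m hm) hx

/-! ### Limits of the mixing kernels -/

/-- `P(x) P*(y) P(f - x + y) η(x, y, f)`. -/
noncomputable def amp (P : ℝ → ℂ) (lk : Link) (f x y : ℝ) : ℂ :=
  P x * conj (P y) * P (f - x + y) * eta lk x y f

noncomputable def pairAmp (P : ℝ → ℂ) (lk : Link) (f x y x' y' : ℝ) : ℂ :=
  amp P lk f x y * conj (amp P lk f x' y')

noncomputable def gridPair (P : ℝ → ℂ) (lk : Link) (Δ : ℝ) (i k m k' m' : ℤ) : ℂ :=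
  gridAmp P lk Δ i k m * conj (gridAmp P lk Δ i k' m')

/-- The numerator is at most `2` because of the loss, the denominator is at least its real part `α`,
and the span phases are unimodular. Uniformity in the frequencies supplies the dominating constant.
-/
theorem norm_eta_le {lk : Link} (hα : 0 < lk.α) (hL : 0 < lk.L) (x y f : ℝ) :
    ‖eta lk x y f‖ ≤ 2 / lk.α * lk.spans := by
  rw [eta_eq, norm_mul, norm_div]
  have h1 : ‖1 - Complex.exp ((-lk.α + Complex.I * mismatch lk x y f) * lk.L)‖ ≤ 2 := by
    refine (norm_sub_le _ _).trans ?_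
    rw [norm_one, Complex.norm_exp]
    have : Real.exp (((-lk.α + Complex.I * mismatch lk x y f) * lk.L : ℂ)).re ≤ 1 := by
      rw [Real.exp_le_one_iff]
      simp
      positivity
    linarith
  have h2 : lk.α ≤ ‖(lk.α : ℂ) - Complex.I * mismatch lk x y f‖ := by
    refine le_trans ?_ (Complex.re_le_norm _)
    simp
  have h3 : ‖∑ l ∈ Finset.range lk.spans,
      Complex.exp (Complex.I * mismatch lk x y f * l * lk.L)‖ ≤ lk.spans := by
    refine (norm_sum_le _ _).trans ?_
    have : ∀ l : ℕ, ‖Complex.exp (Complex.I * mismatch lk x y f * l * lk.L)‖ = 1 := by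
      intro l
      rw [Complex.norm_exp]
      simp
    simp [this]
  gcongr

theorem continuous_eta {lk : Link} (hα : 0 < lk.α) :
    Continuous fun v : ℝ × ℝ × ℝ => eta lk v.1 v.2.1 v.2.2 := by
  simp only [eta_eq, mismatch]
  refine Continuous.mul (Continuous.div (by fun_prop) (by fun_prop) fun v => ?_) (by fun_prop)
  exact alpha_sub_ne_zero hα _

theorem exists_norm_gridAmp_le {R : ℝ} {p : ℝ → ℝ} {P : ℝ → ℂ} (hP : IsPulseSpectrum R p P)
    {lk : Link} (hα : 0 < lk.α) (hL : 0 < lk.L) :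
    ∃ C, 0 ≤ C ∧ ∀ Δ i k m, ‖gridAmp P lk Δ i k m‖ ≤ C := by
  obtain ⟨B, hB⟩ := hP.bounded
  have hB0 : 0 ≤ B := (norm_nonneg _).trans (hB 0)
  refine ⟨B * B * B * (2 / lk.α * lk.spans), by positivity, fun Δ i k m => ?_⟩
  simp only [gridAmp, norm_mul, RCLike.norm_conj]
  gcongr
  · exact hB _
  · exact hB _
  · exact hB _
  · exact norm_eta_le hα hL _ _ _

theorem exists_norm_gridPair_le {R : ℝ} {p : ℝ → ℝ} {P : ℝ → ℂ} (hP : IsPulseSpectrum R p P)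
    {lk : Link} (hα : 0 < lk.α) (hL : 0 < lk.L) :
    ∃ C, 0 ≤ C ∧ ∀ Δ i k m k' m', ‖gridPair P lk Δ i k m k' m'‖ ≤ C := by
  obtain ⟨C, h0, hC⟩ := exists_norm_gridAmp_le hP hα hL
  refine ⟨C * C, by positivity, fun Δ i k m k' m' => ?_⟩
  rw [gridPair, norm_mul, RCLike.norm_conj]
  exact mul_le_mul (hC _ _ _ _) (hC _ _ _ _) (norm_nonneg _) h0

theorem gridPair_eq_zero {R : ℝ} {p : ℝ → ℝ} {P : ℝ → ℂ} (hP : IsPulseSpectrum R p P) (lk : Link)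
    {Δ : ℝ} (i : ℤ) {k m k' m' : ℤ} (h : R / 2 < |(k : ℝ) * Δ| ∨ R / 2 < |(m : ℝ) * Δ| ∨
      R / 2 < |(k' : ℝ) * Δ| ∨ R / 2 < |(m' : ℝ) * Δ|) : gridPair P lk Δ i k m k' m' = 0 := by
  rcases h with h | h | h | h <;> simp [gridPair, gridAmp, hP.bandlimited _ h]

theorem lt_norm_prod_iff {K K' : Type*} [NormedAddCommGroup K] [NormedAddCommGroup K'] {M Δ : ℝ}
    (hΔ : 0 < Δ) (k : K) (m : K') :
    M < ‖(k, m)‖ * Δ ↔ M < ‖k‖ * Δ ∨ M < ‖m‖ * Δ := by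
  rw [Prod.norm_def, max_mul_of_nonneg _ _ hΔ.le, lt_max_iff]

theorem lt_norm_int_iff {M Δ : ℝ} (hΔ : 0 < Δ) (k : ℤ) : M < ‖k‖ * Δ ↔ M < |(k : ℝ) * Δ| := by
  rw [abs_mul, abs_of_pos hΔ, Int.norm_eq_abs]

/-- The frequencies `k n * Δ n` tend to `x`. -/
def GridTo (Δ : ℕ → ℝ) (k : ℕ → ℤ) (x : ℝ) : Prop :=
  Tendsto (fun n => (k n : ℝ) * Δ n) atTop (𝓝 x)

/-- The frequencies `k n * Δ n` tend to `x` and the values of `P` there to the value at `x`. -/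
structure SpectrumTo (P : ℝ → ℂ) (Δ : ℕ → ℝ) (k : ℕ → ℤ) (x : ℝ) : Prop where
  grid : GridTo Δ k x
  value : Tendsto (fun n => P ((k n : ℝ) * Δ n)) atTop (𝓝 (P x))

section Limits

variable {P : ℝ → ℂ} {lk : Link} {Δ : ℕ → ℝ} {i k m k' m' : ℕ → ℤ} {f x y x' y' : ℝ}

theorem GridTo.add (hk : GridTo Δ k x) (hm : GridTo Δ m y) :
    GridTo Δ (fun n => k n + m n) (x + y) := by
  have := Tendsto.add hk hm
  refine this.congr fun n => ?_
  push_cast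
  ring

theorem GridTo.neg (hk : GridTo Δ k x) : GridTo Δ (fun n => -k n) (-x) := by
  have := Tendsto.neg hk
  refine this.congr fun n => ?_
  push_cast
  ring

theorem GridTo.sub (hk : GridTo Δ k x) (hm : GridTo Δ m y) :
    GridTo Δ (fun n => k n - m n) (x - y) := by
  simpa only [sub_eq_add_neg] using hk.add hm.neg

theorem GridTo.spectrum (hk : GridTo Δ k x) (hc : ContinuousAt P x) : SpectrumTo P Δ k x :=
  ⟨hk, hc.tendsto.comp hk⟩

/-- `eta` is jointly continuous, so only the values of `P` need care. The third line `i - k + m` is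
in general not the rounding of its limit, so continuity of `P` at that limit is used. -/
theorem tendsto_gridAmp (hα : 0 < lk.α) (hi : GridTo Δ i f) (hk : SpectrumTo P Δ k x)
    (hm : SpectrumTo P Δ m y) (hc : ContinuousAt P (f - x + y)) :
    Tendsto (fun n => gridAmp P lk (Δ n) (i n) (k n) (m n)) atTop (𝓝 (amp P lk f x y)) := by
  have h1 := (((hi.sub hk.grid).add hm.grid).spectrum hc).value
  have h2 := ((continuous_eta hα).tendsto (x, y, f)).comp
    (Tendsto.prodMk_nhds hk.grid (Tendsto.prodMk_nhds hm.grid hi))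
  exact ((hk.value.mul ((Complex.continuous_conj.tendsto _).comp hm.value)).mul h1).mul h2

theorem tendsto_gridPair (hα : 0 < lk.α) (hi : GridTo Δ i f) (hk : SpectrumTo P Δ k x)
    (hm : SpectrumTo P Δ m y) (hc : ContinuousAt P (f - x + y)) (hk' : SpectrumTo P Δ k' x')
    (hm' : SpectrumTo P Δ m' y') (hc' : ContinuousAt P (f - x' + y')) :
    Tendsto (fun n => gridPair P lk (Δ n) (i n) (k n) (m n) (k' n) (m' n)) atTop
      (𝓝 (pairAmp P lk f x y x' y')) :=
  (tendsto_gridAmp hα hi hk hm hc).mul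
    ((Complex.continuous_conj.tendsto _).comp (tendsto_gridAmp hα hi hk' hm' hc'))

/-- Translations, like the reflections below, preserve Lebesgue measure, so the discontinuities are
avoided for almost every value of the last variable. The function `s` allows the argument of `P` to
keep the form it has in the integrand. -/
theorem IsPulseSpectrum.ae_continuousAt_add {R : ℝ} {p : ℝ → ℝ} (hP : IsPulseSpectrum R p P)
    {s : ℝ → ℝ} (c : ℝ) (hs : ∀ y, s y = c + y) : ∀ᵐ y, ContinuousAt P (s y) := by
  simp only [hs]
  exact (measurePreserving_add_left volume c).quasiMeasurePreserving.ae hP.ae_continuousAt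

theorem IsPulseSpectrum.ae_continuousAt_sub {R : ℝ} {p : ℝ → ℝ} (hP : IsPulseSpectrum R p P)
    {s : ℝ → ℝ} (c : ℝ) (hs : ∀ y, s y = c - y) : ∀ᵐ y, ContinuousAt P (s y) := by
  simp only [hs]
  exact (Measure.measurePreserving_sub_left volume c).quasiMeasurePreserving.ae hP.ae_continuousAt

/-- Hermitian symmetry transfers the convergence at `f` to `-f`, the point where `χ₃` and `χ₇`
evaluate `P`. -/
theorem SpectrumTo.neg {R : ℝ} {p : ℝ → ℝ} (hP : IsPulseSpectrum R p P)
    (hi : SpectrumTo P Δ i f) : SpectrumTo P Δ (fun n => -i n) (-f) := by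
  refine ⟨hi.grid.neg, ?_⟩
  rw [hP.hermitian]
  refine ((Complex.continuous_conj.tendsto _).comp hi.value).congr fun n => ?_
  rw [Function.comp_apply, ← hP.hermitian]
  push_cast
  ring_nf

theorem absSq_eq (z : ℂ) : absSq z = z * conj z := by
  rw [absSq, Complex.mul_conj, Complex.normSq_eq_norm_sq]

theorem twoRe_eq (z : ℂ) : twoRe z = z + conj z := by
  rw [twoRe, Complex.add_conj]

end Limits

/-! ### The frequency integrals as integrals of one amplitude pair -/

section ChiForms

variable {R : ℝ} {p : ℝ → ℝ} {P : ℝ → ℂ} (lk : Link) (f : ℝ)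

theorem chi1_eq : chi1 P lk R f = ∫ x in (-(R / 2))..(R / 2), ∫ y in (-(R / 2))..(R / 2),
    pairAmp P lk f x y x y := by
  simp only [chi1, pairAmp, amp, absSq_eq, map_mul, Complex.conj_conj]
  congr! 4 with x y
  ring

/-- The second amplitude has middle frequency `-(f - x + y)` and third frequency `-y`; by Hermitian
symmetry these values complete the squared moduli. -/
theorem chi2_eq (hP : IsPulseSpectrum R p P) : chi2 P lk R f = ∫ x in (-(R / 2))..(R / 2), ∫ y in (-(R / 2))..(R / 2),
    pairAmp P lk f x y x (-f + x - y) := by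
  have e1 : ∀ x y, P (-f + x - y) = conj (P (f - x + y)) := fun x y => by
    rw [← hP.hermitian]; ring_nf
  have e2 : ∀ x y, P (f - x + (-f + x - y)) = conj (P y) := fun x y => by
    rw [← hP.hermitian]; ring_nf
  simp only [chi2, pairAmp, amp, absSq_eq, map_mul, Complex.conj_conj, e1, e2]
  congr! 4 with x y
  ring

/-- With middle frequency `-f` the third frequency is `-x`, so the first and third factors form `|P
x|²` and `P f` leaves the integral. -/
theorem amp_neg (hP : IsPulseSpectrum R p P) (x : ℝ) : amp P lk f x (-f) = P f * (absSq (P x) * eta lk x (-f) f) := by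
  have e : P (f - x + -f) = conj (P x) := by
    rw [← hP.hermitian]; ring_nf
  simp only [amp, hP.hermitian, e, absSq_eq, Complex.conj_conj]
  ring

theorem chi3_eq (hP : IsPulseSpectrum R p P) : chi3 P lk R f = ∫ x in (-(R / 2))..(R / 2), ∫ y in (-(R / 2))..(R / 2),
    pairAmp P lk f x (-f) y (-f) := by
  simp only [pairAmp, intervalIntegral.integral_const_mul, intervalIntegral.integral_mul_const,
    intervalIntegral.intervalIntegral_conj, amp_neg lk f hP]
  simp only [chi3, absSq_eq, map_mul]
  ring

theorem chi4_eq : chi4 P lk R f = ∫ x in (-(R / 2))..(R / 2), ∫ y in (-(R / 2))..(R / 2),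
    ∫ z in (-(R / 2))..(R / 2), pairAmp P lk f x y (x - y) z := by
  have e : ∀ x y z : ℝ, f - x + y + z = f - (x - y) + z := fun x y z => by ring
  simp only [chi4, pairAmp, amp, map_mul, Complex.conj_conj, e]
  congr! 6 with x y z
  ring

theorem chi5_eq : chi5 P lk R f = ∫ x in (-(R / 2))..(R / 2), ∫ y in (-(R / 2))..(R / 2),
    ∫ z in (-(R / 2))..(R / 2), pairAmp P lk f x y z (y - x) := by
  have e : ∀ x y z : ℝ, f - x + y - z = f - z + (y - x) := fun x y z => by ring
  simp only [chi5, pairAmp, amp, map_mul, Complex.conj_conj, e]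
  congr! 6 with x y z
  ring

theorem chi6_eq (hP : IsPulseSpectrum R p P) : chi6 P lk R f = ∫ x in (-(R / 2))..(R / 2), ∫ y in (-(R / 2))..(R / 2),
    ∫ z in (-(R / 2))..(R / 2), pairAmp P lk f x y z (-f - y) := by
  have e1 : ∀ y, P (-f - y) = conj (P (f + y)) := fun y => by
    rw [← hP.hermitian]; ring_nf
  have e2 : ∀ y z, P (f - z + (-f - y)) = conj (P (y + z)) := fun y z => by
    rw [← hP.hermitian]; ring_nf
  simp only [chi6, pairAmp, amp, map_mul, Complex.conj_conj, e1, e2]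
  congr! 6 with x y z
  ring

theorem chi7_eq (hP : IsPulseSpectrum R p P) : chi7 P lk R f = ∫ x in (-(R / 2))..(R / 2), ∫ y in (-(R / 2))..(R / 2),
    ∫ z in (-(R / 2))..(R / 2), pairAmp P lk f x (-f) y z := by
  simp only [chi7, ← intervalIntegral.integral_const_mul, pairAmp, amp_neg lk f hP]
  simp only [amp, map_mul, Complex.conj_conj]
  congr! 6 with x y z
  ring

theorem chi8_eq : chi8 P lk R f = ∫ x in (-(R / 2))..(R / 2), ∫ y in (-(R / 2))..(R / 2),
    ∫ z in (-(R / 2))..(R / 2), pairAmp P lk f x y x z := by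
  simp only [chi8, pairAmp, amp, absSq_eq, map_mul, Complex.conj_conj]
  congr! 6 with x y z
  ring

theorem chi9_eq (hP : IsPulseSpectrum R p P) : chi9 P lk R f = ∫ x in (-(R / 2))..(R / 2), ∫ y in (-(R / 2))..(R / 2),
    ∫ z in (-(R / 2))..(R / 2), pairAmp P lk f x y z (-x) := by
  have e : ∀ x z : ℝ, f - x - z = f - z + -x := fun x z => by ring
  simp only [chi9, pairAmp, amp, absSq_eq, map_mul, Complex.conj_conj, e, hP.hermitian]
  congr! 6 with x y z
  ring

theorem chi10_eq : chi10 P lk R f = ∫ x in (-(R / 2))..(R / 2), ∫ y in (-(R / 2))..(R / 2),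
    ∫ z in (-(R / 2))..(R / 2), pairAmp P lk f x y z y := by
  have e : ∀ y z : ℝ, f + y - z = f - z + y := fun y z => by ring
  simp only [chi10, pairAmp, amp, absSq_eq, map_mul, Complex.conj_conj, e]
  congr! 6 with x y z
  ring

theorem chi11_eq : chi11 P lk R f = ∫ x in (-(R / 2))..(R / 2), ∫ y in (-(R / 2))..(R / 2),
    ∫ z in (-(R / 2))..(R / 2), ∫ w in (-(R / 2))..(R / 2), pairAmp P lk f x y z w := by
  simp only [chi11, pairAmp, amp, map_mul, Complex.conj_conj]
  congr! 8 with x y z w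
  ring

end ChiForms

/-! ### Riemann sums of the frequency integrals -/

noncomputable def gridChi1 (P : ℝ → ℂ) (lk : Link) (Δ : ℝ) (i : ℤ) : ℂ :=
  (Δ : ℂ) ^ 2 * ∑' v : ℤ × ℤ, gridPair P lk Δ i v.1 v.2 v.1 v.2

noncomputable def gridChi2 (P : ℝ → ℂ) (lk : Link) (Δ : ℝ) (i : ℤ) : ℂ :=
  (Δ : ℂ) ^ 2 * ∑' v : ℤ × ℤ, gridPair P lk Δ i v.1 v.2 v.1 (-i + v.1 - v.2)

noncomputable def gridChi3 (P : ℝ → ℂ) (lk : Link) (Δ : ℝ) (i : ℤ) : ℂ :=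
  (Δ : ℂ) ^ 2 * ∑' v : ℤ × ℤ, gridPair P lk Δ i v.1 (-i) v.2 (-i)

noncomputable def gridChi4 (P : ℝ → ℂ) (lk : Link) (Δ : ℝ) (i : ℤ) : ℂ :=
  (Δ : ℂ) ^ 3 * ∑' v : ℤ × ℤ × ℤ, gridPair P lk Δ i v.1 v.2.1 (v.1 - v.2.1) v.2.2

noncomputable def gridChi5 (P : ℝ → ℂ) (lk : Link) (Δ : ℝ) (i : ℤ) : ℂ :=
  (Δ : ℂ) ^ 3 * ∑' v : ℤ × ℤ × ℤ, gridPair P lk Δ i v.1 v.2.1 v.2.2 (v.2.1 - v.1)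

noncomputable def gridChi6 (P : ℝ → ℂ) (lk : Link) (Δ : ℝ) (i : ℤ) : ℂ :=
  (Δ : ℂ) ^ 3 * ∑' v : ℤ × ℤ × ℤ, gridPair P lk Δ i v.1 v.2.1 v.2.2 (-i - v.2.1)

noncomputable def gridChi7 (P : ℝ → ℂ) (lk : Link) (Δ : ℝ) (i : ℤ) : ℂ :=
  (Δ : ℂ) ^ 3 * ∑' v : ℤ × ℤ × ℤ, gridPair P lk Δ i v.1 (-i) v.2.1 v.2.2

noncomputable def gridChi8 (P : ℝ → ℂ) (lk : Link) (Δ : ℝ) (i : ℤ) : ℂ :=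
  (Δ : ℂ) ^ 3 * ∑' v : ℤ × ℤ × ℤ, gridPair P lk Δ i v.1 v.2.1 v.1 v.2.2

noncomputable def gridChi9 (P : ℝ → ℂ) (lk : Link) (Δ : ℝ) (i : ℤ) : ℂ :=
  (Δ : ℂ) ^ 3 * ∑' v : ℤ × ℤ × ℤ, gridPair P lk Δ i v.1 v.2.1 v.2.2 (-v.1)

noncomputable def gridChi10 (P : ℝ → ℂ) (lk : Link) (Δ : ℝ) (i : ℤ) : ℂ :=
  (Δ : ℂ) ^ 3 * ∑' v : ℤ × ℤ × ℤ, gridPair P lk Δ i v.1 v.2.1 v.2.2 v.2.1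

noncomputable def gridChi11 (P : ℝ → ℂ) (lk : Link) (Δ : ℝ) (i : ℤ) : ℂ :=
  (Δ : ℂ) ^ 4 * ∑' v : ℤ × ℤ × ℤ × ℤ, gridPair P lk Δ i v.1 v.2.1 v.2.2.1 v.2.2.2

section ChiLimits

variable {R : ℝ} {p : ℝ → ℝ} {P : ℝ → ℂ} {lk : Link} {Δ : ℕ → ℝ} {i : ℕ → ℤ} {f : ℝ}

theorem IsMesh.gridTo_floor (hΔ : IsMesh Δ R) (x : ℝ) : GridTo Δ (fun n => ⌊x / Δ n⌋) x :=
  hΔ.tendsto_floor x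

/-- All eleven limits follow one scheme: bound and support come from `gridPair`, and each variable
in turn avoids the null set on which a factor depending on it, with the earlier variables fixed, is
evaluated at a discontinuity. -/
theorem tendsto_gridChi1 (hR : 0 < R) (hP : IsPulseSpectrum R p P) (hα : 0 < lk.α)
    (hL : 0 < lk.L) (hΔ : IsMesh Δ R) (hi : GridTo Δ i f) :
    Tendsto (fun n => gridChi1 P lk (Δ n) (i n)) atTop (𝓝 (chi1 P lk R f)) := by
  obtain ⟨C, -, hC⟩ := exists_norm_gridPair_le hP hα hL
  rw [chi1_eq]
  refine tendsto_lattice_sum₂ hΔ (half_pos hR).le (fun n v => hC _ _ _ _ _ _)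
    (fun n v hv => ?_) ?_
  · obtain ⟨v0, v1⟩ := v
    simp only [lt_norm_prod_iff (hΔ.pos n), lt_norm_int_iff (hΔ.pos n)] at hv
    exact gridPair_eq_zero hP lk _ (by tauto)
  · filter_upwards [hP.ae_continuousAt] with x hx1
    filter_upwards [hP.ae_continuousAt,
      hP.ae_continuousAt_add (f - x) (s := fun y => f - x + y) fun _ => by ring] with y hy1 hy2
    have lx := hΔ.gridTo_floor x
    have ly := hΔ.gridTo_floor y
    exact tendsto_gridPair hα hi (lx.spectrum hx1) (ly.spectrum hy1) hy2
      (lx.spectrum hx1) (ly.spectrum hy1) hy2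

theorem tendsto_gridChi2 (hR : 0 < R) (hP : IsPulseSpectrum R p P) (hα : 0 < lk.α)
    (hL : 0 < lk.L) (hΔ : IsMesh Δ R) (hi : GridTo Δ i f) :
    Tendsto (fun n => gridChi2 P lk (Δ n) (i n)) atTop (𝓝 (chi2 P lk R f)) := by
  obtain ⟨C, -, hC⟩ := exists_norm_gridPair_le hP hα hL
  rw [chi2_eq lk f hP]
  refine tendsto_lattice_sum₂ hΔ (half_pos hR).le (fun n v => hC _ _ _ _ _ _)
    (fun n v hv => ?_) ?_
  · obtain ⟨v0, v1⟩ := v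
    simp only [lt_norm_prod_iff (hΔ.pos n), lt_norm_int_iff (hΔ.pos n)] at hv
    exact gridPair_eq_zero hP lk _ (by tauto)
  · filter_upwards [hP.ae_continuousAt] with x hx1
    filter_upwards [hP.ae_continuousAt,
      hP.ae_continuousAt_add (f - x) (s := fun y => f - x + y) fun _ => by ring,
      hP.ae_continuousAt_sub (-f + x) (s := fun y => -f + x - y) fun _ => by ring,
      hP.ae_continuousAt_sub 0 (s := fun y => f - x + (-f + x - y)) fun _ => by ring] with y hy1 hy2 hy3 hy4
    have lx := hΔ.gridTo_floor x
    have ly := hΔ.gridTo_floor y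
    exact tendsto_gridPair hα hi (lx.spectrum hx1) (ly.spectrum hy1) hy2
      (lx.spectrum hx1) (((hi.neg.add lx).sub ly).spectrum hy3) hy4

/-- The line `-i` is not summed over, so no null set can absorb a discontinuity of `P` at `-f`. This
is why `SpectrumTo` replaces `GridTo`, here and for `χ₇`. -/
theorem tendsto_gridChi3 (hR : 0 < R) (hP : IsPulseSpectrum R p P) (hα : 0 < lk.α)
    (hL : 0 < lk.L) (hΔ : IsMesh Δ R) (hif : SpectrumTo P Δ i f) :
    Tendsto (fun n => gridChi3 P lk (Δ n) (i n)) atTop (𝓝 (chi3 P lk R f)) := by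
  obtain ⟨C, -, hC⟩ := exists_norm_gridPair_le hP hα hL
  rw [chi3_eq lk f hP]
  refine tendsto_lattice_sum₂ hΔ (half_pos hR).le (fun n v => hC _ _ _ _ _ _)
    (fun n v hv => ?_) ?_
  · obtain ⟨v0, v1⟩ := v
    simp only [lt_norm_prod_iff (hΔ.pos n), lt_norm_int_iff (hΔ.pos n)] at hv
    exact gridPair_eq_zero hP lk _ (by tauto)
  · filter_upwards [hP.ae_continuousAt,
      hP.ae_continuousAt_sub (f + -f) (s := fun x => f - x + -f) fun _ => by ring] with x hx1 hx2
    filter_upwards [hP.ae_continuousAt,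
      hP.ae_continuousAt_sub (f + -f) (s := fun y => f - y + -f) fun _ => by ring] with y hy1 hy2
    have lx := hΔ.gridTo_floor x
    have ly := hΔ.gridTo_floor y
    exact tendsto_gridPair hα hif.grid (lx.spectrum hx1) (hif.neg hP) hx2
      (ly.spectrum hy1) (hif.neg hP) hy2

theorem tendsto_gridChi4 (hR : 0 < R) (hP : IsPulseSpectrum R p P) (hα : 0 < lk.α)
    (hL : 0 < lk.L) (hΔ : IsMesh Δ R) (hi : GridTo Δ i f) :
    Tendsto (fun n => gridChi4 P lk (Δ n) (i n)) atTop (𝓝 (chi4 P lk R f)) := by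
  obtain ⟨C, -, hC⟩ := exists_norm_gridPair_le hP hα hL
  rw [chi4_eq]
  refine tendsto_lattice_sum₃ hΔ (half_pos hR).le (fun n v => hC _ _ _ _ _ _)
    (fun n v hv => ?_) ?_
  · obtain ⟨v0, v1, v2⟩ := v
    simp only [lt_norm_prod_iff (hΔ.pos n), lt_norm_int_iff (hΔ.pos n)] at hv
    exact gridPair_eq_zero hP lk _ (by tauto)
  · filter_upwards [hP.ae_continuousAt] with x hx1
    filter_upwards [hP.ae_continuousAt,
      hP.ae_continuousAt_add (f - x) (s := fun y => f - x + y) fun _ => by ring,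
      hP.ae_continuousAt_sub x (s := fun y => x - y) fun _ => by ring] with y hy1 hy2 hy3
    filter_upwards [hP.ae_continuousAt,
      hP.ae_continuousAt_add (f - (x - y)) (s := fun z => f - (x - y) + z) fun _ => by ring] with z hz1 hz2
    have lx := hΔ.gridTo_floor x
    have ly := hΔ.gridTo_floor y
    have lz := hΔ.gridTo_floor z
    exact tendsto_gridPair hα hi (lx.spectrum hx1) (ly.spectrum hy1) hy2
      ((lx.sub ly).spectrum hy3) (lz.spectrum hz1) hz2

theorem tendsto_gridChi5 (hR : 0 < R) (hP : IsPulseSpectrum R p P) (hα : 0 < lk.α)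
    (hL : 0 < lk.L) (hΔ : IsMesh Δ R) (hi : GridTo Δ i f) :
    Tendsto (fun n => gridChi5 P lk (Δ n) (i n)) atTop (𝓝 (chi5 P lk R f)) := by
  obtain ⟨C, -, hC⟩ := exists_norm_gridPair_le hP hα hL
  rw [chi5_eq]
  refine tendsto_lattice_sum₃ hΔ (half_pos hR).le (fun n v => hC _ _ _ _ _ _)
    (fun n v hv => ?_) ?_
  · obtain ⟨v0, v1, v2⟩ := v
    simp only [lt_norm_prod_iff (hΔ.pos n), lt_norm_int_iff (hΔ.pos n)] at hv
    exact gridPair_eq_zero hP lk _ (by tauto)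
  · filter_upwards [hP.ae_continuousAt] with x hx1
    filter_upwards [hP.ae_continuousAt,
      hP.ae_continuousAt_add (f - x) (s := fun y => f - x + y) fun _ => by ring,
      hP.ae_continuousAt_add (-x) (s := fun y => y - x) fun _ => by ring] with y hy1 hy2 hy3
    filter_upwards [hP.ae_continuousAt,
      hP.ae_continuousAt_sub (f + (y - x)) (s := fun z => f - z + (y - x)) fun _ => by ring] with z hz1 hz2
    have lx := hΔ.gridTo_floor x
    have ly := hΔ.gridTo_floor y
    have lz := hΔ.gridTo_floor z
    exact tendsto_gridPair hα hi (lx.spectrum hx1) (ly.spectrum hy1) hy2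
      (lz.spectrum hz1) ((ly.sub lx).spectrum hy3) hz2

theorem tendsto_gridChi6 (hR : 0 < R) (hP : IsPulseSpectrum R p P) (hα : 0 < lk.α)
    (hL : 0 < lk.L) (hΔ : IsMesh Δ R) (hi : GridTo Δ i f) :
    Tendsto (fun n => gridChi6 P lk (Δ n) (i n)) atTop (𝓝 (chi6 P lk R f)) := by
  obtain ⟨C, -, hC⟩ := exists_norm_gridPair_le hP hα hL
  rw [chi6_eq lk f hP]
  refine tendsto_lattice_sum₃ hΔ (half_pos hR).le (fun n v => hC _ _ _ _ _ _)
    (fun n v hv => ?_) ?_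
  · obtain ⟨v0, v1, v2⟩ := v
    simp only [lt_norm_prod_iff (hΔ.pos n), lt_norm_int_iff (hΔ.pos n)] at hv
    exact gridPair_eq_zero hP lk _ (by tauto)
  · filter_upwards [hP.ae_continuousAt] with x hx1
    filter_upwards [hP.ae_continuousAt,
      hP.ae_continuousAt_add (f - x) (s := fun y => f - x + y) fun _ => by ring,
      hP.ae_continuousAt_sub (-f) (s := fun y => -f - y) fun _ => by ring] with y hy1 hy2 hy3
    filter_upwards [hP.ae_continuousAt,
      hP.ae_continuousAt_sub (f + (-f - y)) (s := fun z => f - z + (-f - y)) fun _ => by ring] with z hz1 hz2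
    have lx := hΔ.gridTo_floor x
    have ly := hΔ.gridTo_floor y
    have lz := hΔ.gridTo_floor z
    exact tendsto_gridPair hα hi (lx.spectrum hx1) (ly.spectrum hy1) hy2
      (lz.spectrum hz1) ((hi.neg.sub ly).spectrum hy3) hz2

theorem tendsto_gridChi7 (hR : 0 < R) (hP : IsPulseSpectrum R p P) (hα : 0 < lk.α)
    (hL : 0 < lk.L) (hΔ : IsMesh Δ R) (hif : SpectrumTo P Δ i f) :
    Tendsto (fun n => gridChi7 P lk (Δ n) (i n)) atTop (𝓝 (chi7 P lk R f)) := by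
  obtain ⟨C, -, hC⟩ := exists_norm_gridPair_le hP hα hL
  rw [chi7_eq lk f hP]
  refine tendsto_lattice_sum₃ hΔ (half_pos hR).le (fun n v => hC _ _ _ _ _ _)
    (fun n v hv => ?_) ?_
  · obtain ⟨v0, v1, v2⟩ := v
    simp only [lt_norm_prod_iff (hΔ.pos n), lt_norm_int_iff (hΔ.pos n)] at hv
    exact gridPair_eq_zero hP lk _ (by tauto)
  · filter_upwards [hP.ae_continuousAt,
      hP.ae_continuousAt_sub (f + -f) (s := fun x => f - x + -f) fun _ => by ring] with x hx1 hx2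
    filter_upwards [hP.ae_continuousAt] with y hy1
    filter_upwards [hP.ae_continuousAt,
      hP.ae_continuousAt_add (f - y) (s := fun z => f - y + z) fun _ => by ring] with z hz1 hz2
    have lx := hΔ.gridTo_floor x
    have ly := hΔ.gridTo_floor y
    have lz := hΔ.gridTo_floor z
    exact tendsto_gridPair hα hif.grid (lx.spectrum hx1) (hif.neg hP) hx2
      (ly.spectrum hy1) (lz.spectrum hz1) hz2

theorem tendsto_gridChi8 (hR : 0 < R) (hP : IsPulseSpectrum R p P) (hα : 0 < lk.α)
    (hL : 0 < lk.L) (hΔ : IsMesh Δ R) (hi : GridTo Δ i f) :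
    Tendsto (fun n => gridChi8 P lk (Δ n) (i n)) atTop (𝓝 (chi8 P lk R f)) := by
  obtain ⟨C, -, hC⟩ := exists_norm_gridPair_le hP hα hL
  rw [chi8_eq]
  refine tendsto_lattice_sum₃ hΔ (half_pos hR).le (fun n v => hC _ _ _ _ _ _)
    (fun n v hv => ?_) ?_
  · obtain ⟨v0, v1, v2⟩ := v
    simp only [lt_norm_prod_iff (hΔ.pos n), lt_norm_int_iff (hΔ.pos n)] at hv
    exact gridPair_eq_zero hP lk _ (by tauto)
  · filter_upwards [hP.ae_continuousAt] with x hx1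
    filter_upwards [hP.ae_continuousAt,
      hP.ae_continuousAt_add (f - x) (s := fun y => f - x + y) fun _ => by ring] with y hy1 hy2
    filter_upwards [hP.ae_continuousAt,
      hP.ae_continuousAt_add (f - x) (s := fun z => f - x + z) fun _ => by ring] with z hz1 hz2
    have lx := hΔ.gridTo_floor x
    have ly := hΔ.gridTo_floor y
    have lz := hΔ.gridTo_floor z
    exact tendsto_gridPair hα hi (lx.spectrum hx1) (ly.spectrum hy1) hy2
      (lx.spectrum hx1) (lz.spectrum hz1) hz2

theorem tendsto_gridChi9 (hR : 0 < R) (hP : IsPulseSpectrum R p P) (hα : 0 < lk.α)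
    (hL : 0 < lk.L) (hΔ : IsMesh Δ R) (hi : GridTo Δ i f) :
    Tendsto (fun n => gridChi9 P lk (Δ n) (i n)) atTop (𝓝 (chi9 P lk R f)) := by
  obtain ⟨C, -, hC⟩ := exists_norm_gridPair_le hP hα hL
  rw [chi9_eq lk f hP]
  refine tendsto_lattice_sum₃ hΔ (half_pos hR).le (fun n v => hC _ _ _ _ _ _)
    (fun n v hv => ?_) ?_
  · obtain ⟨v0, v1, v2⟩ := v
    simp only [lt_norm_prod_iff (hΔ.pos n), lt_norm_int_iff (hΔ.pos n)] at hv
    exact gridPair_eq_zero hP lk _ (by tauto)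
  · filter_upwards [hP.ae_continuousAt,
      hP.ae_continuousAt_sub 0 (s := fun x => -x) fun _ => by ring] with x hx1 hx2
    filter_upwards [hP.ae_continuousAt,
      hP.ae_continuousAt_add (f - x) (s := fun y => f - x + y) fun _ => by ring] with y hy1 hy2
    filter_upwards [hP.ae_continuousAt,
      hP.ae_continuousAt_sub (f + -x) (s := fun z => f - z + -x) fun _ => by ring] with z hz1 hz2
    have lx := hΔ.gridTo_floor x
    have ly := hΔ.gridTo_floor y
    have lz := hΔ.gridTo_floor z
    exact tendsto_gridPair hα hi (lx.spectrum hx1) (ly.spectrum hy1) hy2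
      (lz.spectrum hz1) (lx.neg.spectrum hx2) hz2

theorem tendsto_gridChi10 (hR : 0 < R) (hP : IsPulseSpectrum R p P) (hα : 0 < lk.α)
    (hL : 0 < lk.L) (hΔ : IsMesh Δ R) (hi : GridTo Δ i f) :
    Tendsto (fun n => gridChi10 P lk (Δ n) (i n)) atTop (𝓝 (chi10 P lk R f)) := by
  obtain ⟨C, -, hC⟩ := exists_norm_gridPair_le hP hα hL
  rw [chi10_eq]
  refine tendsto_lattice_sum₃ hΔ (half_pos hR).le (fun n v => hC _ _ _ _ _ _)
    (fun n v hv => ?_) ?_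
  · obtain ⟨v0, v1, v2⟩ := v
    simp only [lt_norm_prod_iff (hΔ.pos n), lt_norm_int_iff (hΔ.pos n)] at hv
    exact gridPair_eq_zero hP lk _ (by tauto)
  · filter_upwards [hP.ae_continuousAt] with x hx1
    filter_upwards [hP.ae_continuousAt,
      hP.ae_continuousAt_add (f - x) (s := fun y => f - x + y) fun _ => by ring] with y hy1 hy2
    filter_upwards [hP.ae_continuousAt,
      hP.ae_continuousAt_sub (f + y) (s := fun z => f - z + y) fun _ => by ring] with z hz1 hz2
    have lx := hΔ.gridTo_floor x
    have ly := hΔ.gridTo_floor y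
    have lz := hΔ.gridTo_floor z
    exact tendsto_gridPair hα hi (lx.spectrum hx1) (ly.spectrum hy1) hy2
      (lz.spectrum hz1) (ly.spectrum hy1) hz2

theorem tendsto_gridChi11 (hR : 0 < R) (hP : IsPulseSpectrum R p P) (hα : 0 < lk.α)
    (hL : 0 < lk.L) (hΔ : IsMesh Δ R) (hi : GridTo Δ i f) :
    Tendsto (fun n => gridChi11 P lk (Δ n) (i n)) atTop (𝓝 (chi11 P lk R f)) := by
  obtain ⟨C, -, hC⟩ := exists_norm_gridPair_le hP hα hL
  rw [chi11_eq]
  refine tendsto_lattice_sum₄ hΔ (half_pos hR).le (fun n v => hC _ _ _ _ _ _)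
    (fun n v hv => ?_) ?_
  · obtain ⟨v0, v1, v2, v3⟩ := v
    simp only [lt_norm_prod_iff (hΔ.pos n), lt_norm_int_iff (hΔ.pos n)] at hv
    exact gridPair_eq_zero hP lk _ (by tauto)
  · filter_upwards [hP.ae_continuousAt] with x hx1
    filter_upwards [hP.ae_continuousAt,
      hP.ae_continuousAt_add (f - x) (s := fun y => f - x + y) fun _ => by ring] with y hy1 hy2
    filter_upwards [hP.ae_continuousAt] with z hz1
    filter_upwards [hP.ae_continuousAt,
      hP.ae_continuousAt_add (f - z) (s := fun w => f - z + w) fun _ => by ring] with w hw1 hw2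
    have lx := hΔ.gridTo_floor x
    have ly := hΔ.gridTo_floor y
    have lz := hΔ.gridTo_floor z
    have lw := hΔ.gridTo_floor w
    exact tendsto_gridPair hα hi (lx.spectrum hx1) (ly.spectrum hy1) hy2
      (lz.spectrum hz1) (lw.spectrum hw1) hw2

end ChiLimits

/-! ### Reduction of the delta products to lattice sums -/

/-- The line indices of `lineIndices i v` with the signs of their positions. -/
def signedIndices (i : ℤ) (v : ℤ × ℤ × ℤ × ℤ) : Fin 6 → ℤ :=
  ![v.1, -v.2.1, i - v.1 + v.2.1, -v.2.2.1, v.2.2.2, -(i - v.2.2.1 + v.2.2.2)]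

/-- The sum over all line indices that is carried by one delta product. -/
noncomputable def deltaSum (P : ℝ → ℂ) (lk : Link) (Δ : ℝ) (i : ℤ) (S : Finset (Finset (Fin 6))) :
    ℂ :=
  ∑' v : ℤ × ℤ × ℤ × ℤ, gridKernel P lk Δ (lineIndices i v) *
    ∏ B ∈ S, if blockFreq (lineIndices i v) B = 0 then 1 else 0

theorem blockFreq_toFinset (i : ℤ) (v : ℤ × ℤ × ℤ × ℤ) {b : List (Fin 6)} (hb : b.Nodup) :
    blockFreq (lineIndices i v) b.toFinset = (b.map (signedIndices i v)).sum := by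
  rw [blockFreq, List.sum_toFinset _ hb]
  congr 1
  refine List.map_congr_left fun j _ => ?_
  fin_cases j <;> rfl

theorem prod_delta_pattern (i : ℤ) (v : ℤ × ℤ × ℤ × ℤ) {c : Pattern} (hc : c ∈ patterns) :
    (∏ B ∈ c.parts, if blockFreq (lineIndices i v) B = 0 then (1 : ℂ) else 0) =
      if ∀ b ∈ c, (b.map (signedIndices i v)).sum = 0 then 1 else 0 := by
  obtain ⟨h1, h2⟩ := patterns_blocks c hc
  have h3 : (∀ B ∈ c.parts, blockFreq (lineIndices i v) B = 0) ↔
      ∀ b ∈ c, (b.map (signedIndices i v)).sum = 0 := by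
    constructor
    · intro h b hb
      rw [← blockFreq_toFinset i v (h2 b hb)]
      exact h _ (Pattern.mem_parts.2 ⟨b, hb, rfl⟩)
    · intro h B hB
      obtain ⟨b, hb, rfl⟩ := Pattern.mem_parts.1 hB
      rw [blockFreq_toFinset i v (h2 b hb)]
      exact h b hb
  rw [Finset.prod_ite_zero]
  simp only [h3, Finset.prod_const_one]

/-- The block conditions cut out an affine sublattice of `ℤ⁴`, off which the summand vanishes. The
map `ι` parametrises it and `ρ` reads off the free indices. -/
theorem deltaSum_eq_tsum {K : Type*} (P : ℝ → ℂ) (lk : Link) (Δ : ℝ) (i : ℤ) {c : Pattern}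
    (hc : c ∈ patterns) (F : K → ℂ) (ι : K → ℤ × ℤ × ℤ × ℤ) (ρ : ℤ × ℤ × ℤ × ℤ → K)
    (hρ : ∀ x, ρ (ι x) = x) (h₁ : ∀ x, ∀ b ∈ c, (b.map (signedIndices i (ι x))).sum = 0)
    (h₂ : ∀ v, (∀ b ∈ c, (b.map (signedIndices i v)).sum = 0) → ι (ρ v) = v)
    (hF : ∀ x, gridPair P lk Δ i (ι x).1 (ι x).2.1 (ι x).2.2.1 (ι x).2.2.2 = F x) :
    deltaSum P lk Δ i c.parts = ∑' x, F x := by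
  have hinj : Function.Injective ι := Function.LeftInverse.injective hρ
  simp only [deltaSum, prod_delta_pattern i _ hc, gridKernel_lineIndices]
  rw [← hinj.tsum_eq]
  · refine tsum_congr fun x => ?_
    rw [if_pos (h₁ x), mul_one, ← hF]
    rfl
  · intro v hv
    by_contra hne
    refine hv ?_
    have hn : ¬ ∀ b ∈ c, (b.map (signedIndices i v)).sum = 0 := fun h => hne ⟨ρ v, h₂ v h⟩
    simp only [hn, if_false, mul_zero]

/-- Exchanging `k` with `n = i - k + m` swaps two factors `P` and, up to two signs, the two factors
of the mismatch. Hence patterns differing by the exchange of positions `0, 2` or `3, 5` have equal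
sums, which is why a class has up to four members. -/
theorem gridAmp_reflect (P : ℝ → ℂ) (lk : Link) (Δ : ℝ) (i k m : ℤ) :
    gridAmp P lk Δ i (i - k + m) m = gridAmp P lk Δ i k m := by
  have e1 : i - (i - k + m) + m = k := by ring
  have e2 : eta lk ((i - k + m : ℤ) * Δ) (m * Δ) (i * Δ) = eta lk (k * Δ) (m * Δ) (i * Δ) := by
    have : mismatch lk ((i - k + m : ℤ) * Δ) (m * Δ) (i * Δ) =
        mismatch lk (k * Δ) (m * Δ) (i * Δ) := by
      simp only [mismatch]
      push_cast
      ring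
    simp only [eta_eq, this]
  rw [gridAmp, gridAmp, e1, e2]
  ring

theorem conj_gridPair (P : ℝ → ℂ) (lk : Link) (Δ : ℝ) (i k m k' m' : ℤ) :
    conj (gridPair P lk Δ i k m k' m') = gridPair P lk Δ i k' m' k m := by
  simp only [gridPair, map_mul, Complex.conj_conj]
  ring

section Reduction

variable (P : ℝ → ℂ) (lk : Link) (Δ : ℝ) (i : ℤ)

theorem deltaSum_chi1Patterns {c : Pattern} (hc : c ∈ chi1Patterns) :
    (Δ : ℂ) ^ 2 * deltaSum P lk Δ i c.parts = gridChi1 P lk Δ i := by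
  simp only [gridChi1]
  congr 1
  simp only [chi1Patterns, List.mem_cons, List.not_mem_nil, or_false] at hc
  rcases hc with rfl | rfl
  · refine deltaSum_eq_tsum P lk Δ i (by decide) _
      (fun (x, y) => (x, y, x, y))
      (fun (k, m, k', m') => (k, m))
      ?_ ?_ ?_ ?_
    · rintro ⟨x, y⟩
      rfl
    · rintro ⟨x, y⟩
      simp [signedIndices]
    · rintro ⟨k, m, k', m'⟩ h
      simp [signedIndices] at h
      simp only [Prod.mk.injEq, true_and]
      omega
    · rintro ⟨x, y⟩
      simp [gridPair]
  -- This pattern is the first with positions `3` and `5` exchanged, so `k'` takes the value `n'`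
  -- had before.
  · refine deltaSum_eq_tsum P lk Δ i (by decide) _
      (fun (x, y) => (x, y, i - x + y, y))
      (fun (k, m, k', m') => (k, m))
      ?_ ?_ ?_ ?_
    · rintro ⟨x, y⟩
      rfl
    · rintro ⟨x, y⟩
      simp [signedIndices]
      omega
    · rintro ⟨k, m, k', m'⟩ h
      simp [signedIndices] at h
      simp only [Prod.mk.injEq, true_and]
      omega
    · rintro ⟨x, y⟩
      simp [gridPair, gridAmp_reflect]

theorem deltaSum_chi2Patterns {c : Pattern} (hc : c ∈ chi2Patterns) :
    (Δ : ℂ) ^ 2 * deltaSum P lk Δ i c.parts = gridChi2 P lk Δ i := by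
  simp only [gridChi2]
  congr 1
  simp only [chi2Patterns, List.mem_cons, List.not_mem_nil, or_false] at hc
  rcases hc with rfl | rfl | rfl | rfl
  · refine deltaSum_eq_tsum P lk Δ i (by decide) _
      (fun (x, y) => (x, y, x, -i + x - y))
      (fun (k, m, k', m') => (k, m))
      ?_ ?_ ?_ ?_
    · rintro ⟨x, y⟩
      rfl
    · rintro ⟨x, y⟩
      simp [signedIndices]
      omega
    · rintro ⟨k, m, k', m'⟩ h
      simp [signedIndices] at h
      simp only [Prod.mk.injEq, true_and]
      omega
    · rintro ⟨x, y⟩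
      simp [gridPair]
  · refine deltaSum_eq_tsum P lk Δ i (by decide) _
      (fun (x, y) => (x, y, i - x + (-i + x - y), -i + x - y))
      (fun (k, m, k', m') => (k, m))
      ?_ ?_ ?_ ?_
    · rintro ⟨x, y⟩
      rfl
    · rintro ⟨x, y⟩
      simp [signedIndices]
      omega
    · rintro ⟨k, m, k', m'⟩ h
      simp [signedIndices] at h
      simp only [Prod.mk.injEq, true_and]
      omega
    · rintro ⟨x, y⟩
      simp [gridPair, gridAmp_reflect]
  -- Positions `0` and `2` are exchanged relative to the first pattern: the variable `x` is now `n`,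
  -- recovered as `i - k + m`.
  · refine deltaSum_eq_tsum P lk Δ i (by decide) _
      (fun (x, y) => (i - x + y, y, x, -i + x - y))
      (fun (k, m, k', m') => (i - k + m, m))
      ?_ ?_ ?_ ?_
    · rintro ⟨x, y⟩
      simp only [Prod.mk.injEq, and_true]
      omega
    · rintro ⟨x, y⟩
      simp [signedIndices]
      omega
    · rintro ⟨k, m, k', m'⟩ h
      simp [signedIndices] at h
      simp only [Prod.mk.injEq, true_and]
      omega
    · rintro ⟨x, y⟩
      simp [gridPair, gridAmp_reflect]
  · refine deltaSum_eq_tsum P lk Δ i (by decide) _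
      (fun (x, y) => (i - x + y, y, i - x + (-i + x - y), -i + x - y))
      (fun (k, m, k', m') => (i - k + m, m))
      ?_ ?_ ?_ ?_
    · rintro ⟨x, y⟩
      simp only [Prod.mk.injEq, and_true]
      omega
    · rintro ⟨x, y⟩
      simp [signedIndices]
      omega
    · rintro ⟨k, m, k', m'⟩ h
      simp [signedIndices] at h
      simp only [Prod.mk.injEq, true_and]
      omega
    · rintro ⟨x, y⟩
      simp [gridPair, gridAmp_reflect]

/-- From `k + n = 0` and `k - m + n = i` follows `m = -i`, and likewise `m' = -i`; `k` and `k'`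
remain free. -/
theorem deltaSum_chi3Patterns {c : Pattern} (hc : c ∈ chi3Patterns) :
    (Δ : ℂ) ^ 2 * deltaSum P lk Δ i c.parts = gridChi3 P lk Δ i := by
  simp only [gridChi3]
  congr 1
  obtain rfl := List.mem_singleton.1 hc
  · refine deltaSum_eq_tsum P lk Δ i (by decide) _
      (fun (x, y) => (x, -i, y, -i))
      (fun (k, m, k', m') => (k, k'))
      ?_ ?_ ?_ ?_
    · rintro ⟨x, y⟩
      rfl
    · rintro ⟨x, y⟩
      simp [signedIndices]
      omega
    · rintro ⟨k, m, k', m'⟩ h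
      simp [signedIndices] at h
      simp only [Prod.mk.injEq, true_and]
      omega
    · rintro ⟨x, y⟩
      simp [gridPair]

theorem deltaSum_chi4Patterns {c : Pattern} (hc : c ∈ chi4Patterns) :
    (Δ : ℂ) ^ 3 * deltaSum P lk Δ i c.parts = gridChi4 P lk Δ i := by
  simp only [gridChi4]
  congr 1
  simp only [chi4Patterns, List.mem_cons, List.not_mem_nil, or_false] at hc
  rcases hc with rfl | rfl | rfl | rfl
  · refine deltaSum_eq_tsum P lk Δ i (by decide) _
      (fun (x, y, z) => (x, y, x - y, z))
      (fun (k, m, k', m') => (k, m, m'))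
      ?_ ?_ ?_ ?_
    · rintro ⟨x, y, z⟩
      rfl
    · rintro ⟨x, y, z⟩
      simp [signedIndices]
      omega
    · rintro ⟨k, m, k', m'⟩ h
      simp [signedIndices] at h
      simp only [Prod.mk.injEq, true_and, and_true]
      omega
    · rintro ⟨x, y, z⟩
      simp [gridPair]
  · refine deltaSum_eq_tsum P lk Δ i (by decide) _
      (fun (x, y, z) => (x, y, i - (x - y) + z, z))
      (fun (k, m, k', m') => (k, m, m'))
      ?_ ?_ ?_ ?_
    · rintro ⟨x, y, z⟩
      rfl
    · rintro ⟨x, y, z⟩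
      simp [signedIndices]
      omega
    · rintro ⟨k, m, k', m'⟩ h
      simp [signedIndices] at h
      simp only [Prod.mk.injEq, true_and, and_true]
      omega
    · rintro ⟨x, y, z⟩
      simp [gridPair, gridAmp_reflect]
  · refine deltaSum_eq_tsum P lk Δ i (by decide) _
      (fun (x, y, z) => (i - x + y, y, x - y, z))
      (fun (k, m, k', m') => (i - k + m, m, m'))
      ?_ ?_ ?_ ?_
    · rintro ⟨x, y, z⟩
      simp only [Prod.mk.injEq, and_true]
      omega
    · rintro ⟨x, y, z⟩
      simp [signedIndices]
      omega
    · rintro ⟨k, m, k', m'⟩ h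
      simp [signedIndices] at h
      simp only [Prod.mk.injEq, true_and, and_true]
      omega
    · rintro ⟨x, y, z⟩
      simp [gridPair, gridAmp_reflect]
  · refine deltaSum_eq_tsum P lk Δ i (by decide) _
      (fun (x, y, z) => (i - x + y, y, i - (x - y) + z, z))
      (fun (k, m, k', m') => (i - k + m, m, m'))
      ?_ ?_ ?_ ?_
    · rintro ⟨x, y, z⟩
      simp only [Prod.mk.injEq, and_true]
      omega
    · rintro ⟨x, y, z⟩
      simp [signedIndices]
      omega
    · rintro ⟨k, m, k', m'⟩ h
      simp [signedIndices] at h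
      simp only [Prod.mk.injEq, true_and, and_true]
      omega
    · rintro ⟨x, y, z⟩
      simp [gridPair, gridAmp_reflect]

theorem deltaSum_chi5Patterns {c : Pattern} (hc : c ∈ chi5Patterns) :
    (Δ : ℂ) ^ 3 * deltaSum P lk Δ i c.parts = gridChi5 P lk Δ i := by
  simp only [gridChi5]
  congr 1
  simp only [chi5Patterns, List.mem_cons, List.not_mem_nil, or_false] at hc
  rcases hc with rfl | rfl
  · refine deltaSum_eq_tsum P lk Δ i (by decide) _
      (fun (x, y, z) => (x, y, z, y - x))
      (fun (k, m, k', m') => (k, m, k'))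
      ?_ ?_ ?_ ?_
    · rintro ⟨x, y, z⟩
      rfl
    · rintro ⟨x, y, z⟩
      simp [signedIndices]
      omega
    · rintro ⟨k, m, k', m'⟩ h
      simp [signedIndices] at h
      simp only [Prod.mk.injEq, true_and]
      omega
    · rintro ⟨x, y, z⟩
      simp [gridPair]
  · refine deltaSum_eq_tsum P lk Δ i (by decide) _
      (fun (x, y, z) => (i - x + y, y, z, y - x))
      (fun (k, m, k', m') => (i - k + m, m, k'))
      ?_ ?_ ?_ ?_
    · rintro ⟨x, y, z⟩
      simp only [Prod.mk.injEq, and_true]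
      omega
    · rintro ⟨x, y, z⟩
      simp [signedIndices]
      omega
    · rintro ⟨k, m, k', m'⟩ h
      simp [signedIndices] at h
      simp only [Prod.mk.injEq, true_and]
      omega
    · rintro ⟨x, y, z⟩
      simp [gridPair, gridAmp_reflect]

/-- These patterns arise from those of `χ₅` by exchanging primed and unprimed positions, which
conjugates the kernel pair. -/
theorem deltaSum_chi5ConjPatterns {c : Pattern} (hc : c ∈ chi5ConjPatterns) :
    (Δ : ℂ) ^ 3 * deltaSum P lk Δ i c.parts = conj (gridChi5 P lk Δ i) := by
  simp only [gridChi5, map_mul, map_pow, Complex.conj_ofReal, Complex.conj_tsum, conj_gridPair]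
  congr 1
  simp only [chi5ConjPatterns, List.mem_cons, List.not_mem_nil, or_false] at hc
  rcases hc with rfl | rfl
  · refine deltaSum_eq_tsum P lk Δ i (by decide) _
      (fun (x, y, z) => (z, y - x, x, y))
      (fun (k, m, k', m') => (k', m', k))
      ?_ ?_ ?_ ?_
    · rintro ⟨x, y, z⟩
      rfl
    · rintro ⟨x, y, z⟩
      simp [signedIndices]
      omega
    · rintro ⟨k, m, k', m'⟩ h
      simp [signedIndices] at h
      simp only [Prod.mk.injEq, true_and, and_true]
      omega
    · rintro ⟨x, y, z⟩
      simp [gridPair]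
  · refine deltaSum_eq_tsum P lk Δ i (by decide) _
      (fun (x, y, z) => (z, y - x, i - x + y, y))
      (fun (k, m, k', m') => (i - k' + m', m', k))
      ?_ ?_ ?_ ?_
    · rintro ⟨x, y, z⟩
      simp only [Prod.mk.injEq, and_true]
      omega
    · rintro ⟨x, y, z⟩
      simp [signedIndices]
      omega
    · rintro ⟨k, m, k', m'⟩ h
      simp [signedIndices] at h
      simp only [Prod.mk.injEq, true_and, and_true]
      omega
    · rintro ⟨x, y, z⟩
      simp [gridPair, gridAmp_reflect]

theorem deltaSum_chi6Patterns {c : Pattern} (hc : c ∈ chi6Patterns) :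
    (Δ : ℂ) ^ 3 * deltaSum P lk Δ i c.parts = gridChi6 P lk Δ i := by
  simp only [gridChi6]
  congr 1
  obtain rfl := List.mem_singleton.1 hc
  · refine deltaSum_eq_tsum P lk Δ i (by decide) _
      (fun (x, y, z) => (x, y, z, -i - y))
      (fun (k, m, k', m') => (k, m, k'))
      ?_ ?_ ?_ ?_
    · rintro ⟨x, y, z⟩
      rfl
    · rintro ⟨x, y, z⟩
      simp [signedIndices]
      omega
    · rintro ⟨k, m, k', m'⟩ h
      simp [signedIndices] at h
      simp only [Prod.mk.injEq, true_and]
      omega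
    · rintro ⟨x, y, z⟩
      simp [gridPair]

theorem deltaSum_chi7Patterns {c : Pattern} (hc : c ∈ chi7Patterns) :
    (Δ : ℂ) ^ 3 * deltaSum P lk Δ i c.parts = gridChi7 P lk Δ i := by
  simp only [gridChi7]
  congr 1
  obtain rfl := List.mem_singleton.1 hc
  · refine deltaSum_eq_tsum P lk Δ i (by decide) _
      (fun (x, y, z) => (x, -i, y, z))
      (fun (k, m, k', m') => (k, k', m'))
      ?_ ?_ ?_ ?_
    · rintro ⟨x, y, z⟩
      rfl
    · rintro ⟨x, y, z⟩
      simp [signedIndices]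
      omega
    · rintro ⟨k, m, k', m'⟩ h
      simp [signedIndices] at h
      simp only [Prod.mk.injEq, true_and, and_true]
      omega
    · rintro ⟨x, y, z⟩
      simp [gridPair]

theorem deltaSum_chi7ConjPatterns {c : Pattern} (hc : c ∈ chi7ConjPatterns) :
    (Δ : ℂ) ^ 3 * deltaSum P lk Δ i c.parts = conj (gridChi7 P lk Δ i) := by
  simp only [gridChi7, map_mul, map_pow, Complex.conj_ofReal, Complex.conj_tsum, conj_gridPair]
  congr 1
  obtain rfl := List.mem_singleton.1 hc
  · refine deltaSum_eq_tsum P lk Δ i (by decide) _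
      (fun (x, y, z) => (y, z, x, -i))
      (fun (k, m, k', m') => (k', k, m))
      ?_ ?_ ?_ ?_
    · rintro ⟨x, y, z⟩
      rfl
    · rintro ⟨x, y, z⟩
      simp [signedIndices]
      omega
    · rintro ⟨k, m, k', m'⟩ h
      simp [signedIndices] at h
      simp only [Prod.mk.injEq, true_and]
      omega
    · rintro ⟨x, y, z⟩
      simp [gridPair]

theorem deltaSum_chi8Patterns {c : Pattern} (hc : c ∈ chi8Patterns) :
    (Δ : ℂ) ^ 3 * deltaSum P lk Δ i c.parts = gridChi8 P lk Δ i := by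
  simp only [gridChi8]
  congr 1
  simp only [chi8Patterns, List.mem_cons, List.not_mem_nil, or_false] at hc
  rcases hc with rfl | rfl | rfl | rfl
  · refine deltaSum_eq_tsum P lk Δ i (by decide) _
      (fun (x, y, z) => (x, y, x, z))
      (fun (k, m, k', m') => (k, m, m'))
      ?_ ?_ ?_ ?_
    · rintro ⟨x, y, z⟩
      rfl
    · rintro ⟨x, y, z⟩
      simp [signedIndices]
      omega
    · rintro ⟨k, m, k', m'⟩ h
      simp [signedIndices] at h
      simp only [Prod.mk.injEq, true_and, and_true]
      omega
    · rintro ⟨x, y, z⟩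
      simp [gridPair]
  · refine deltaSum_eq_tsum P lk Δ i (by decide) _
      (fun (x, y, z) => (x, y, i - x + z, z))
      (fun (k, m, k', m') => (k, m, m'))
      ?_ ?_ ?_ ?_
    · rintro ⟨x, y, z⟩
      rfl
    · rintro ⟨x, y, z⟩
      simp [signedIndices]
      omega
    · rintro ⟨k, m, k', m'⟩ h
      simp [signedIndices] at h
      simp only [Prod.mk.injEq, true_and, and_true]
      omega
    · rintro ⟨x, y, z⟩
      simp [gridPair, gridAmp_reflect]
  · refine deltaSum_eq_tsum P lk Δ i (by decide) _
      (fun (x, y, z) => (i - x + y, y, x, z))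
      (fun (k, m, k', m') => (i - k + m, m, m'))
      ?_ ?_ ?_ ?_
    · rintro ⟨x, y, z⟩
      simp only [Prod.mk.injEq, and_true]
      omega
    · rintro ⟨x, y, z⟩
      simp [signedIndices]
      omega
    · rintro ⟨k, m, k', m'⟩ h
      simp [signedIndices] at h
      simp only [Prod.mk.injEq, true_and, and_true]
      omega
    · rintro ⟨x, y, z⟩
      simp [gridPair, gridAmp_reflect]
  · refine deltaSum_eq_tsum P lk Δ i (by decide) _
      (fun (x, y, z) => (i - x + y, y, i - x + z, z))
      (fun (k, m, k', m') => (i - k + m, m, m'))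
      ?_ ?_ ?_ ?_
    · rintro ⟨x, y, z⟩
      simp only [Prod.mk.injEq, and_true]
      omega
    · rintro ⟨x, y, z⟩
      simp [signedIndices]
      omega
    · rintro ⟨k, m, k', m'⟩ h
      simp [signedIndices] at h
      simp only [Prod.mk.injEq, true_and, and_true]
      omega
    · rintro ⟨x, y, z⟩
      simp [gridPair, gridAmp_reflect]

theorem deltaSum_chi9Patterns {c : Pattern} (hc : c ∈ chi9Patterns) :
    (Δ : ℂ) ^ 3 * deltaSum P lk Δ i c.parts = gridChi9 P lk Δ i := by
  simp only [gridChi9]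
  congr 1
  simp only [chi9Patterns, List.mem_cons, List.not_mem_nil, or_false] at hc
  rcases hc with rfl | rfl
  · refine deltaSum_eq_tsum P lk Δ i (by decide) _
      (fun (x, y, z) => (x, y, z, -x))
      (fun (k, m, k', m') => (k, m, k'))
      ?_ ?_ ?_ ?_
    · rintro ⟨x, y, z⟩
      rfl
    · rintro ⟨x, y, z⟩
      simp [signedIndices]
      omega
    · rintro ⟨k, m, k', m'⟩ h
      simp [signedIndices] at h
      simp only [Prod.mk.injEq, true_and]
      omega
    · rintro ⟨x, y, z⟩
      simp [gridPair]
  · refine deltaSum_eq_tsum P lk Δ i (by decide) _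
      (fun (x, y, z) => (i - x + y, y, z, -x))
      (fun (k, m, k', m') => (i - k + m, m, k'))
      ?_ ?_ ?_ ?_
    · rintro ⟨x, y, z⟩
      simp only [Prod.mk.injEq, and_true]
      omega
    · rintro ⟨x, y, z⟩
      simp [signedIndices]
      omega
    · rintro ⟨k, m, k', m'⟩ h
      simp [signedIndices] at h
      simp only [Prod.mk.injEq, true_and]
      omega
    · rintro ⟨x, y, z⟩
      simp [gridPair, gridAmp_reflect]

theorem deltaSum_chi9ConjPatterns {c : Pattern} (hc : c ∈ chi9ConjPatterns) :
    (Δ : ℂ) ^ 3 * deltaSum P lk Δ i c.parts = conj (gridChi9 P lk Δ i) := by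
  simp only [gridChi9, map_mul, map_pow, Complex.conj_ofReal, Complex.conj_tsum, conj_gridPair]
  congr 1
  simp only [chi9ConjPatterns, List.mem_cons, List.not_mem_nil, or_false] at hc
  rcases hc with rfl | rfl
  · refine deltaSum_eq_tsum P lk Δ i (by decide) _
      (fun (x, y, z) => (z, -x, x, y))
      (fun (k, m, k', m') => (k', m', k))
      ?_ ?_ ?_ ?_
    · rintro ⟨x, y, z⟩
      rfl
    · rintro ⟨x, y, z⟩
      simp [signedIndices]
      omega
    · rintro ⟨k, m, k', m'⟩ h
      simp [signedIndices] at h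
      simp only [Prod.mk.injEq, true_and, and_true]
      omega
    · rintro ⟨x, y, z⟩
      simp [gridPair]
  · refine deltaSum_eq_tsum P lk Δ i (by decide) _
      (fun (x, y, z) => (z, -x, i - x + y, y))
      (fun (k, m, k', m') => (i - k' + m', m', k))
      ?_ ?_ ?_ ?_
    · rintro ⟨x, y, z⟩
      simp only [Prod.mk.injEq, and_true]
      omega
    · rintro ⟨x, y, z⟩
      simp [signedIndices]
      omega
    · rintro ⟨k, m, k', m'⟩ h
      simp [signedIndices] at h
      simp only [Prod.mk.injEq, true_and, and_true]
      omega
    · rintro ⟨x, y, z⟩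
      simp [gridPair, gridAmp_reflect]

theorem deltaSum_chi10Patterns {c : Pattern} (hc : c ∈ chi10Patterns) :
    (Δ : ℂ) ^ 3 * deltaSum P lk Δ i c.parts = gridChi10 P lk Δ i := by
  simp only [gridChi10]
  congr 1
  obtain rfl := List.mem_singleton.1 hc
  · refine deltaSum_eq_tsum P lk Δ i (by decide) _
      (fun (x, y, z) => (x, y, z, y))
      (fun (k, m, k', m') => (k, m, k'))
      ?_ ?_ ?_ ?_
    · rintro ⟨x, y, z⟩
      rfl
    · rintro ⟨x, y, z⟩
      simp [signedIndices]
      omega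
    · rintro ⟨k, m, k', m'⟩ h
      simp [signedIndices] at h
      simp only [Prod.mk.injEq, true_and]
      omega
    · rintro ⟨x, y, z⟩
      simp [gridPair]

/-- The signed sum over all positions is `i - i = 0`, so the only delta is void and all four indices
stay free. -/
theorem deltaSum_chi11Patterns {c : Pattern} (hc : c ∈ chi11Patterns) :
    (Δ : ℂ) ^ 4 * deltaSum P lk Δ i c.parts = gridChi11 P lk Δ i := by
  simp only [gridChi11]
  congr 1
  obtain rfl := List.mem_singleton.1 hc
  · refine deltaSum_eq_tsum P lk Δ i (by decide) _
      (fun (x, y, z, w) => (x, y, z, w))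
      (fun (k, m, k', m') => (k, m, k', m'))
      ?_ ?_ ?_ ?_
    · rintro ⟨x, y, z, w⟩
      rfl
    · rintro ⟨x, y, z, w⟩
      simp [signedIndices]
      omega
    · rintro ⟨k, m, k', m'⟩ h
      simp [signedIndices] at h
      rfl
    · rintro ⟨x, y, z, w⟩
      simp [gridPair]

/-- Conjugation exchanges the two halves of the pair. When the pattern class is stable under this
exchange, the conjugate sum is another parametrisation of the same delta sum, hence real. The
reality of the limiting PSD rests on this and the analogous statements below. -/
theorem conj_gridChi2 : conj (gridChi2 P lk Δ i) = gridChi2 P lk Δ i := by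
  refine Eq.trans ?_ (deltaSum_chi2Patterns P lk Δ i (c := [[0, 3], [1, 5], [2, 4]]) (by decide))
  simp only [gridChi2, map_mul, map_pow, Complex.conj_ofReal, Complex.conj_tsum, conj_gridPair]
  congr 1
  symm
  · refine deltaSum_eq_tsum P lk Δ i (by decide) _
      (fun (x, y) => (x, -i + x - y, x, y))
      (fun (k, m, k', m') => (k', m'))
      ?_ ?_ ?_ ?_
    · rintro ⟨x, y⟩
      rfl
    · rintro ⟨x, y⟩
      simp [signedIndices]
      omega
    · rintro ⟨k, m, k', m'⟩ h
      simp [signedIndices] at h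
      simp only [Prod.mk.injEq, and_true]
      omega
    · rintro ⟨x, y⟩
      simp [gridPair]

theorem conj_gridChi4 : conj (gridChi4 P lk Δ i) = gridChi4 P lk Δ i := by
  refine Eq.trans ?_ (deltaSum_chi4Patterns P lk Δ i (c := [[0, 1, 3], [2, 4, 5]]) (by decide))
  simp only [gridChi4, map_mul, map_pow, Complex.conj_ofReal, Complex.conj_tsum, conj_gridPair]
  congr 1
  symm
  -- The exchange of halves maps this pattern to another member of its class, so both amplitudes are
  -- also reflected.
  · refine deltaSum_eq_tsum P lk Δ i (by decide) _
      (fun (x, y, z) => (i - (x - y) + z, z, i - x + y, y))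
      (fun (k, m, k', m') => (i - k' + m', m', m))
      ?_ ?_ ?_ ?_
    · rintro ⟨x, y, z⟩
      simp only [Prod.mk.injEq, and_true]
      omega
    · rintro ⟨x, y, z⟩
      simp [signedIndices]
      omega
    · rintro ⟨k, m, k', m'⟩ h
      simp [signedIndices] at h
      simp only [Prod.mk.injEq, true_and, and_true]
      omega
    · rintro ⟨x, y, z⟩
      simp [gridPair, gridAmp_reflect]

theorem conj_gridChi6 : conj (gridChi6 P lk Δ i) = gridChi6 P lk Δ i := by
  refine Eq.trans ?_ (deltaSum_chi6Patterns P lk Δ i (c := [[0, 2, 4], [1, 3, 5]]) (by decide))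
  simp only [gridChi6, map_mul, map_pow, Complex.conj_ofReal, Complex.conj_tsum, conj_gridPair]
  congr 1
  symm
  · refine deltaSum_eq_tsum P lk Δ i (by decide) _
      (fun (x, y, z) => (z, -i - y, x, y))
      (fun (k, m, k', m') => (k', m', k))
      ?_ ?_ ?_ ?_
    · rintro ⟨x, y, z⟩
      rfl
    · rintro ⟨x, y, z⟩
      simp [signedIndices]
      omega
    · rintro ⟨k, m, k', m'⟩ h
      simp [signedIndices] at h
      simp only [Prod.mk.injEq, true_and, and_true]
      omega
    · rintro ⟨x, y, z⟩
      simp [gridPair]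

theorem conj_gridChi8 : conj (gridChi8 P lk Δ i) = gridChi8 P lk Δ i := by
  refine Eq.trans ?_ (deltaSum_chi8Patterns P lk Δ i (c := [[0, 3], [1, 2, 4, 5]]) (by decide))
  simp only [gridChi8, map_mul, map_pow, Complex.conj_ofReal, Complex.conj_tsum, conj_gridPair]
  congr 1
  symm
  · refine deltaSum_eq_tsum P lk Δ i (by decide) _
      (fun (x, y, z) => (x, z, x, y))
      (fun (k, m, k', m') => (k', m', m))
      ?_ ?_ ?_ ?_
    · rintro ⟨x, y, z⟩
      rfl
    · rintro ⟨x, y, z⟩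
      simp [signedIndices]
      omega
    · rintro ⟨k, m, k', m'⟩ h
      simp [signedIndices] at h
      simp only [Prod.mk.injEq, and_true]
      omega
    · rintro ⟨x, y, z⟩
      simp [gridPair]

theorem conj_gridChi10 : conj (gridChi10 P lk Δ i) = gridChi10 P lk Δ i := by
  refine Eq.trans ?_ (deltaSum_chi10Patterns P lk Δ i (c := [[0, 2, 3, 5], [1, 4]]) (by decide))
  simp only [gridChi10, map_mul, map_pow, Complex.conj_ofReal, Complex.conj_tsum, conj_gridPair]
  congr 1
  symm
  · refine deltaSum_eq_tsum P lk Δ i (by decide) _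
      (fun (x, y, z) => (z, y, x, y))
      (fun (k, m, k', m') => (k', m', k))
      ?_ ?_ ?_ ?_
    · rintro ⟨x, y, z⟩
      rfl
    · rintro ⟨x, y, z⟩
      simp [signedIndices]
      omega
    · rintro ⟨k, m, k', m'⟩ h
      simp [signedIndices] at h
      simp only [Prod.mk.injEq, true_and, and_true]
      omega
    · rintro ⟨x, y, z⟩
      simp [gridPair]

end Reduction

/-! ### The moment weights of the delta products -/

/-- Exponents `(a, b, c, d)` of a monomial `X^a (X*)^b Y^c (Y*)^d`. -/
abbrev Exponent := ℕ × ℕ × ℕ × ℕ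

/-- Exponent of the letter at position `j`; `e₁`, `e₂` tell whether `s`, `t` are the orthogonal
polarisation. -/
def letterExp (e₁ e₂ : Bool) (j : Fin 6) : Exponent :=
  if ![e₁, e₁, false, e₂, e₂, false] j then
    (if Even (j : ℕ) then (0, 0, 1, 0) else (0, 0, 0, 1))
  else (if Even (j : ℕ) then (1, 0, 0, 0) else (0, 1, 0, 0))

def blockExp (e₁ e₂ : Bool) (b : List (Fin 6)) : Exponent :=
  b.foldr (fun j x => letterExp e₁ e₂ j + x) 0

/-- A polynomial in the moments: coefficients and products of moments. -/
abbrev MomentPoly := List (ℤ × List Exponent)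

noncomputable def momentAt (E : ℕ → ℕ → ℕ → ℕ → ℂ) (x : Exponent) : ℂ := E x.1 x.2.1 x.2.2.1 x.2.2.2

noncomputable def MomentPoly.eval (E : ℕ → ℕ → ℕ → ℕ → ℂ) (l : MomentPoly) : ℂ :=
  (l.map fun t => (t.1 : ℂ) * (t.2.map (momentAt E)).prod).sum

/-- A sorting key that brings equal products of moments to equal lists. There are only six letters,
so base ten causes no collision. -/
def Exponent.code (x : Exponent) : ℕ := ((x.1 * 10 + x.2.1) * 10 + x.2.2.1) * 10 + x.2.2.2

/-- Total weight of a pattern as a polynomial in the moments. -/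
def weightPoly (c : Pattern) : MomentPoly :=
  [(false, false), (false, true), (true, false), (true, true)].flatMap fun e =>
    patterns.map fun d =>
      (d.excl c, (d.map (blockExp e.1 e.2)).insertionSort fun x y => x.code ≤ y.code)

/-- Add a term to a polynomial, merging it with a like term. -/
def MomentPoly.insertTerm (t : ℤ × List Exponent) : MomentPoly → MomentPoly
  | [] => [t]
  | u :: l => if u.2 = t.2 then (u.1 + t.1, u.2) :: l else u :: MomentPoly.insertTerm t l

/-- Merge like terms and drop zero terms. -/
def MomentPoly.collect (l : MomentPoly) : MomentPoly :=
  ((l.filter fun t => t.1 ≠ 0).foldr MomentPoly.insertTerm []).filter fun t => t.1 ≠ 0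

theorem MomentPoly.eval_cons (E : ℕ → ℕ → ℕ → ℕ → ℂ) (t : ℤ × List Exponent) (l : MomentPoly) :
    MomentPoly.eval E (t :: l) = (t.1 : ℂ) * (t.2.map (momentAt E)).prod + MomentPoly.eval E l := by
  simp [MomentPoly.eval]

theorem MomentPoly.eval_insertTerm (E : ℕ → ℕ → ℕ → ℕ → ℂ) (t : ℤ × List Exponent) (l : MomentPoly) :
    MomentPoly.eval E (MomentPoly.insertTerm t l) =
      (t.1 : ℂ) * (t.2.map (momentAt E)).prod + MomentPoly.eval E l := by
  induction l with
  | nil => rw [MomentPoly.insertTerm, MomentPoly.eval_cons]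
  | cons u l ih =>
    rw [MomentPoly.insertTerm]
    split_ifs with h
    · rw [MomentPoly.eval_cons, MomentPoly.eval_cons, ← h]
      push_cast
      ring
    · rw [MomentPoly.eval_cons, MomentPoly.eval_cons, ih]
      ring

theorem MomentPoly.eval_filter (E : ℕ → ℕ → ℕ → ℕ → ℂ) (l : MomentPoly) :
    MomentPoly.eval E (l.filter fun t => t.1 ≠ 0) = MomentPoly.eval E l := by
  induction l with
  | nil => rfl
  | cons t l ih =>
    by_cases h : t.1 = 0
    · rw [List.filter_cons_of_neg (by simp [h]), ih, MomentPoly.eval_cons, h]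
      simp
    · rw [List.filter_cons_of_pos (by simp [h]), MomentPoly.eval_cons, MomentPoly.eval_cons, ih]

theorem MomentPoly.eval_collect (E : ℕ → ℕ → ℕ → ℕ → ℂ) (l : MomentPoly) :
    MomentPoly.eval E l.collect = MomentPoly.eval E l := by
  rw [MomentPoly.collect, MomentPoly.eval_filter]
  conv_rhs => rw [← MomentPoly.eval_filter]
  induction l.filter fun t => t.1 ≠ 0 with
  | nil => rfl
  | cons t l ih => rw [List.foldr_cons, MomentPoly.eval_insertTerm, ih, MomentPoly.eval_cons]

theorem MomentPoly.eval_append (E : ℕ → ℕ → ℕ → ℕ → ℂ) (l l' : MomentPoly) :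
    MomentPoly.eval E (l ++ l') = MomentPoly.eval E l + MomentPoly.eval E l' := by
  simp [MomentPoly.eval]

theorem MomentPoly.eval_flatMap {α : Type*} (E : ℕ → ℕ → ℕ → ℕ → ℂ) (f : α → MomentPoly)
    (l : List α) :
    MomentPoly.eval E (l.flatMap f) = (l.map fun a => MomentPoly.eval E (f a)).sum := by
  induction l with
  | nil => rfl
  | cons a l ih =>
    rw [List.flatMap_cons, MomentPoly.eval_append, ih, List.map_cons, List.sum_cons]

/-- Total weight of a list of patterns. -/
noncomputable def totalWeight (E : ℕ → ℕ → ℕ → ℕ → ℂ) (l : List Pattern) : ℂ :=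
  (l.map fun c => MomentPoly.eval E (weightPoly c)).sum

/-- The inclusion-exclusion bookkeeping becomes an equality of integer lists, decided by the kernel.
What remains is to compare the normal form `u` with the stated coefficient, a ring identity once
conjugate moments are rewritten by exchanging exponents. -/
theorem totalWeight_eq (E : ℕ → ℕ → ℕ → ℕ → ℂ) {l : List Pattern} {u : MomentPoly}
    (h : MomentPoly.collect (l.flatMap weightPoly) = u) :
    totalWeight E l = MomentPoly.eval E u := by
  rw [← h, MomentPoly.eval_collect, MomentPoly.eval_flatMap, totalWeight]

section Coefficients

variable {E : ℕ → ℕ → ℕ → ℕ → ℂ}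

theorem totalWeight_chi1Patterns (hE : ∀ a b c d, conj (E a b c d) = E b a d c) :
    totalWeight E chi1Patterns = coefPhi1 E := by
  rw [totalWeight_eq E (u :=
    [(1, [(0, 0, 1, 1), (0, 1, 1, 0), (1, 0, 0, 1)]),
     (4, [(0, 1, 1, 0), (1, 0, 0, 1), (1, 1, 0, 0)]),
     (2, [(1, 1, 0, 0), (1, 1, 0, 0), (1, 1, 0, 0)]),
     (1, [(0, 0, 1, 1), (0, 0, 1, 1), (1, 1, 0, 0)])]) (by decide +kernel)]
  simp only [coefPhi1, MomentPoly.eval, momentAt, List.map_cons, List.map_nil, List.sum_cons,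
    List.sum_nil, List.prod_cons, List.prod_nil, absSq_eq,
    hE]
  push_cast
  ring

theorem totalWeight_chi2Patterns (hE : ∀ a b c d, conj (E a b c d) = E b a d c) :
    totalWeight E chi2Patterns = coefPhi2 E := by
  rw [totalWeight_eq E (u :=
    [(1, [(0, 0, 0, 2), (0, 0, 2, 0), (1, 1, 0, 0)]),
     (4, [(0, 1, 0, 1), (1, 0, 1, 0), (1, 1, 0, 0)]),
     (4, [(0, 2, 0, 0), (1, 1, 0, 0), (2, 0, 0, 0)]),
     (1, [(0, 0, 2, 0), (0, 1, 0, 1), (1, 0, 0, 1)]),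
     (2, [(0, 2, 0, 0), (1, 0, 0, 1), (1, 0, 1, 0)]),
     (1, [(0, 0, 0, 2), (0, 1, 1, 0), (1, 0, 1, 0)]),
     (2, [(0, 1, 0, 1), (0, 1, 1, 0), (2, 0, 0, 0)]),
     (1, [(0, 0, 1, 1), (0, 1, 0, 1), (1, 0, 1, 0)])]) (by decide +kernel)]
  simp only [coefPhi2, MomentPoly.eval, momentAt, List.map_cons, List.map_nil, List.sum_cons,
    List.sum_nil, List.prod_cons, List.prod_nil, absSq_eq, twoRe_eq, map_add, map_mul,
    map_ofNat, hE]
  push_cast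
  ring

theorem totalWeight_chi3Patterns (hE : ∀ a b c d, conj (E a b c d) = E b a d c) :
    totalWeight E chi3Patterns = coefPhi3 E := by
  rw [totalWeight_eq E (u :=
    [(1, [(0, 0, 1, 1), (0, 1, 0, 1), (1, 0, 1, 0)]),
     (1, [(0, 2, 0, 0), (1, 0, 0, 1), (1, 0, 1, 0)]),
     (1, [(0, 1, 0, 1), (0, 1, 1, 0), (2, 0, 0, 0)]),
     (1, [(0, 2, 0, 0), (1, 1, 0, 0), (2, 0, 0, 0)])]) (by decide +kernel)]
  simp only [coefPhi3, MomentPoly.eval, momentAt, List.map_cons, List.map_nil, List.sum_cons,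
    List.sum_nil, List.prod_cons, List.prod_nil, absSq_eq, twoRe_eq, map_mul,
    hE]
  push_cast
  ring

theorem totalWeight_chi4Patterns (hE : ∀ a b c d, conj (E a b c d) = E b a d c) :
    totalWeight E chi4Patterns = coefPsi1 E := by
  rw [totalWeight_eq E (u :=
    [(1, [(0, 0, 2, 1), (1, 1, 0, 1)]), (4, [(1, 1, 0, 1), (1, 1, 1, 0)]),
     (2, [(1, 0, 1, 1), (1, 2, 0, 0)]), (4, [(1, 2, 0, 0), (2, 1, 0, 0)]),
     (1, [(0, 1, 2, 0), (1, 0, 0, 2)]), (1, [(0, 1, 1, 1), (1, 0, 1, 1)]),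
     (2, [(0, 1, 1, 1), (2, 1, 0, 0)]), (1, [(0, 0, 1, 2), (1, 1, 1, 0)])]) (by decide +kernel)]
  simp only [coefPsi1, MomentPoly.eval, momentAt, List.map_cons, List.map_nil, List.sum_cons,
    List.sum_nil, List.prod_cons, List.prod_nil, absSq_eq, twoRe_eq, map_mul,
    hE]
  push_cast
  ring

/-- In `2 Re (Ψ₂ χ₅ + Ψ₃ χ₅*)` the factor of `χ₅` is `Ψ₂ + Ψ₃*`; the patterns determine only this
sum. The same holds for `χ₇` and `χ₉`. -/
theorem totalWeight_chi5Patterns (hE : ∀ a b c d, conj (E a b c d) = E b a d c) :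
    totalWeight E chi5Patterns = coefPsi2 E + conj (coefPsi3 E) := by
  rw [totalWeight_eq E (u :=
    [(1, [(0, 1, 1, 1), (1, 0, 1, 1)]), (1, [(0, 2, 1, 0), (2, 0, 0, 1)]),
     (2, [(1, 1, 0, 1), (1, 1, 1, 0)]), (2, [(1, 2, 0, 0), (2, 1, 0, 0)]),
     (1, [(0, 0, 2, 1), (1, 1, 0, 1)]), (1, [(1, 0, 1, 1), (1, 2, 0, 0)])]) (by decide +kernel)]
  simp only [coefPsi2, coefPsi3, MomentPoly.eval, momentAt, List.map_cons, List.map_nil, List.sum_cons,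
    List.sum_nil, List.prod_cons, List.prod_nil, absSq_eq, map_add, map_mul,
    hE]
  push_cast
  ring

theorem totalWeight_chi5ConjPatterns (hE : ∀ a b c d, conj (E a b c d) = E b a d c) :
    totalWeight E chi5ConjPatterns = coefPsi3 E + conj (coefPsi2 E) := by
  rw [totalWeight_eq E (u :=
    [(1, [(0, 1, 1, 1), (1, 0, 1, 1)]), (2, [(1, 1, 0, 1), (1, 1, 1, 0)]),
     (1, [(0, 2, 1, 0), (2, 0, 0, 1)]), (2, [(1, 2, 0, 0), (2, 1, 0, 0)]),
     (1, [(0, 0, 1, 2), (1, 1, 1, 0)]), (1, [(0, 1, 1, 1), (2, 1, 0, 0)])]) (by decide +kernel)]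
  simp only [coefPsi3, coefPsi2, MomentPoly.eval, momentAt, List.map_cons, List.map_nil, List.sum_cons,
    List.sum_nil, List.prod_cons, List.prod_nil, absSq_eq, map_add, map_mul,
    map_ofNat, hE]
  push_cast
  ring

theorem totalWeight_chi6Patterns (hE : ∀ a b c d, conj (E a b c d) = E b a d c) :
    totalWeight E chi6Patterns = coefPsi4 E := by
  rw [totalWeight_eq E (u :=
    [(1, [(0, 1, 0, 2), (1, 0, 2, 0)]), (2, [(0, 2, 0, 1), (2, 0, 1, 0)]),
     (1, [(0, 3, 0, 0), (3, 0, 0, 0)])]) (by decide +kernel)]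
  simp only [coefPsi4, MomentPoly.eval, momentAt, List.map_cons, List.map_nil, List.sum_cons,
    List.sum_nil, List.prod_cons, List.prod_nil, absSq_eq,
    hE]
  push_cast
  ring

theorem totalWeight_chi7Patterns (hE : ∀ a b c d, conj (E a b c d) = E b a d c) :
    totalWeight E chi7Patterns = coefLam1 E + conj (coefLam2 E) := by
  rw [totalWeight_eq E (u :=
    [(-1, [(0, 0, 0, 2), (0, 1, 1, 0), (1, 0, 1, 0)]),
     (-2, [(0, 0, 1, 1), (0, 1, 0, 1), (1, 0, 1, 0)]), (1, [(0, 1, 1, 2), (1, 0, 1, 0)]),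
     (-2, [(0, 1, 0, 1), (1, 0, 1, 0), (1, 1, 0, 0)]), (1, [(1, 0, 1, 0), (1, 2, 0, 1)]),
     (-1, [(0, 2, 0, 0), (1, 0, 0, 1), (1, 0, 1, 0)]),
     (-2, [(0, 1, 0, 1), (0, 1, 1, 0), (2, 0, 0, 0)]),
     (-1, [(0, 0, 1, 1), (0, 2, 0, 0), (2, 0, 0, 0)]), (1, [(0, 2, 1, 1), (2, 0, 0, 0)]),
     (-3, [(0, 2, 0, 0), (1, 1, 0, 0), (2, 0, 0, 0)]), (1, [(1, 3, 0, 0), (2, 0, 0, 0)])]) (by decide +kernel)]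
  simp only [coefLam1, coefLam2, MomentPoly.eval, momentAt, List.map_cons, List.map_nil, List.sum_cons,
    List.sum_nil, List.prod_cons, List.prod_nil, absSq_eq, map_add, map_sub, map_mul,
    map_neg, map_ofNat, hE]
  push_cast
  ring

theorem totalWeight_chi7ConjPatterns (hE : ∀ a b c d, conj (E a b c d) = E b a d c) :
    totalWeight E chi7ConjPatterns = coefLam2 E + conj (coefLam1 E) := by
  rw [totalWeight_eq E (u :=
    [(-2, [(0, 0, 1, 1), (0, 1, 0, 1), (1, 0, 1, 0)]),
     (-1, [(0, 0, 2, 0), (0, 1, 0, 1), (1, 0, 0, 1)]), (1, [(0, 1, 0, 1), (1, 0, 2, 1)]),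
     (-1, [(0, 0, 1, 1), (0, 2, 0, 0), (2, 0, 0, 0)]),
     (-2, [(0, 2, 0, 0), (1, 0, 0, 1), (1, 0, 1, 0)]), (1, [(0, 2, 0, 0), (2, 0, 1, 1)]),
     (-2, [(0, 1, 0, 1), (1, 0, 1, 0), (1, 1, 0, 0)]), (1, [(0, 1, 0, 1), (2, 1, 1, 0)]),
     (-1, [(0, 1, 0, 1), (0, 1, 1, 0), (2, 0, 0, 0)]),
     (-3, [(0, 2, 0, 0), (1, 1, 0, 0), (2, 0, 0, 0)]), (1, [(0, 2, 0, 0), (3, 1, 0, 0)])]) (by decide +kernel)]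
  simp only [coefLam2, coefLam1, MomentPoly.eval, momentAt, List.map_cons, List.map_nil, List.sum_cons,
    List.sum_nil, List.prod_cons, List.prod_nil, absSq_eq, map_add, map_sub, map_mul,
    map_neg, map_ofNat, hE]
  push_cast
  ring

theorem totalWeight_chi8Patterns (hE : ∀ a b c d, conj (E a b c d) = E b a d c) :
    totalWeight E chi8Patterns = coefLam3 E := by
  rw [totalWeight_eq E (u :=
    [(-3, [(0, 0, 1, 1), (0, 0, 1, 1), (1, 1, 0, 0)]), (1, [(0, 0, 2, 2), (1, 1, 0, 0)]),
     (-1, [(0, 0, 0, 2), (0, 0, 2, 0), (1, 1, 0, 0)]),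
     (-4, [(0, 0, 1, 1), (1, 1, 0, 0), (1, 1, 0, 0)]), (4, [(1, 1, 0, 0), (1, 1, 1, 1)]),
     (-4, [(0, 1, 0, 1), (1, 0, 1, 0), (1, 1, 0, 0)]),
     (-12, [(0, 1, 1, 0), (1, 0, 0, 1), (1, 1, 0, 0)]),
     (-8, [(1, 1, 0, 0), (1, 1, 0, 0), (1, 1, 0, 0)]), (4, [(1, 1, 0, 0), (2, 2, 0, 0)]),
     (-4, [(0, 2, 0, 0), (1, 1, 0, 0), (2, 0, 0, 0)]),
     (-5, [(0, 0, 1, 1), (0, 1, 1, 0), (1, 0, 0, 1)]), (1, [(0, 1, 2, 1), (1, 0, 0, 1)]),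
     (-1, [(0, 0, 2, 0), (0, 1, 0, 1), (1, 0, 0, 1)]), (2, [(1, 0, 0, 1), (1, 2, 1, 0)]),
     (-2, [(0, 2, 0, 0), (1, 0, 0, 1), (1, 0, 1, 0)]), (1, [(0, 1, 1, 0), (1, 0, 1, 2)]),
     (-1, [(0, 0, 0, 2), (0, 1, 1, 0), (1, 0, 1, 0)]), (2, [(0, 1, 1, 0), (2, 1, 0, 1)]),
     (-2, [(0, 1, 0, 1), (0, 1, 1, 0), (2, 0, 0, 0)]), (1, [(0, 0, 1, 1), (1, 1, 1, 1)]),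
     (-1, [(0, 0, 1, 1), (0, 1, 0, 1), (1, 0, 1, 0)])]) (by decide +kernel)]
  simp only [coefLam3, MomentPoly.eval, momentAt, List.map_cons, List.map_nil, List.sum_cons,
    List.sum_nil, List.prod_cons, List.prod_nil, absSq_eq, twoRe_eq, map_add, map_sub, map_mul,
    map_ofNat, hE]
  push_cast
  ring

theorem totalWeight_chi9Patterns (hE : ∀ a b c d, conj (E a b c d) = E b a d c) :
    totalWeight E chi9Patterns = coefLam4 E + conj (coefLam5 E) := by
  rw [totalWeight_eq E (u :=
    [(-2, [(0, 0, 1, 1), (0, 1, 0, 1), (1, 0, 1, 0)]), (1, [(0, 1, 1, 2), (1, 0, 1, 0)]),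
     (-1, [(0, 0, 0, 2), (0, 1, 1, 0), (1, 0, 1, 0)]),
     (-1, [(0, 0, 1, 1), (0, 2, 0, 0), (2, 0, 0, 0)]), (1, [(0, 2, 1, 1), (2, 0, 0, 0)]),
     (-2, [(0, 1, 0, 1), (0, 1, 1, 0), (2, 0, 0, 0)]),
     (-6, [(0, 1, 0, 1), (1, 0, 1, 0), (1, 1, 0, 0)]), (3, [(1, 0, 1, 0), (1, 2, 0, 1)]),
     (-3, [(0, 2, 0, 0), (1, 0, 0, 1), (1, 0, 1, 0)]),
     (-6, [(0, 2, 0, 0), (1, 1, 0, 0), (2, 0, 0, 0)]), (2, [(1, 3, 0, 0), (2, 0, 0, 0)]),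
     (-2, [(0, 0, 2, 0), (0, 1, 0, 1), (1, 0, 0, 1)]), (1, [(0, 0, 2, 0), (1, 1, 0, 2)]),
     (-1, [(0, 0, 0, 2), (0, 0, 2, 0), (1, 1, 0, 0)])]) (by decide +kernel)]
  simp only [coefLam4, coefLam5, MomentPoly.eval, momentAt, List.map_cons, List.map_nil, List.sum_cons,
    List.sum_nil, List.prod_cons, List.prod_nil, absSq_eq, twoRe_eq, map_add, map_sub, map_mul,
    map_neg, map_ofNat, hE]
  push_cast
  ring

theorem totalWeight_chi9ConjPatterns (hE : ∀ a b c d, conj (E a b c d) = E b a d c) :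
    totalWeight E chi9ConjPatterns = coefLam5 E + conj (coefLam4 E) := by
  rw [totalWeight_eq E (u :=
    [(-2, [(0, 0, 1, 1), (0, 1, 0, 1), (1, 0, 1, 0)]), (1, [(0, 1, 0, 1), (1, 0, 2, 1)]),
     (-1, [(0, 0, 2, 0), (0, 1, 0, 1), (1, 0, 0, 1)]),
     (-6, [(0, 1, 0, 1), (1, 0, 1, 0), (1, 1, 0, 0)]), (3, [(0, 1, 0, 1), (2, 1, 1, 0)]),
     (-3, [(0, 1, 0, 1), (0, 1, 1, 0), (2, 0, 0, 0)]),
     (-1, [(0, 0, 1, 1), (0, 2, 0, 0), (2, 0, 0, 0)]), (1, [(0, 2, 0, 0), (2, 0, 1, 1)]),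
     (-2, [(0, 2, 0, 0), (1, 0, 0, 1), (1, 0, 1, 0)]),
     (-6, [(0, 2, 0, 0), (1, 1, 0, 0), (2, 0, 0, 0)]), (2, [(0, 2, 0, 0), (3, 1, 0, 0)]),
     (-2, [(0, 0, 0, 2), (0, 1, 1, 0), (1, 0, 1, 0)]), (1, [(0, 0, 0, 2), (1, 1, 2, 0)]),
     (-1, [(0, 0, 0, 2), (0, 0, 2, 0), (1, 1, 0, 0)])]) (by decide +kernel)]
  simp only [coefLam5, coefLam4, MomentPoly.eval, momentAt, List.map_cons, List.map_nil, List.sum_cons,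
    List.sum_nil, List.prod_cons, List.prod_nil, absSq_eq, twoRe_eq, map_add, map_sub, map_mul,
    map_neg, map_ofNat, hE]
  push_cast
  ring

theorem totalWeight_chi10Patterns (hE : ∀ a b c d, conj (E a b c d) = E b a d c) :
    totalWeight E chi10Patterns = coefLam6 E := by
  rw [totalWeight_eq E (u :=
    [(1, [(0, 0, 1, 1), (1, 1, 1, 1)]), (-1, [(0, 0, 1, 1), (0, 1, 0, 1), (1, 0, 1, 0)]),
     (-1, [(0, 0, 1, 1), (0, 1, 1, 0), (1, 0, 0, 1)]),
     (-1, [(0, 0, 1, 1), (0, 0, 1, 1), (1, 1, 0, 0)]), (1, [(1, 0, 0, 1), (1, 2, 1, 0)]),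
     (-1, [(0, 2, 0, 0), (1, 0, 0, 1), (1, 0, 1, 0)]),
     (-4, [(0, 1, 1, 0), (1, 0, 0, 1), (1, 1, 0, 0)]), (1, [(0, 1, 1, 0), (2, 1, 0, 1)]),
     (-1, [(0, 1, 0, 1), (0, 1, 1, 0), (2, 0, 0, 0)]), (1, [(1, 1, 0, 0), (2, 2, 0, 0)]),
     (-1, [(0, 2, 0, 0), (1, 1, 0, 0), (2, 0, 0, 0)]),
     (-2, [(1, 1, 0, 0), (1, 1, 0, 0), (1, 1, 0, 0)])]) (by decide +kernel)]
  simp only [coefLam6, MomentPoly.eval, momentAt, List.map_cons, List.map_nil, List.sum_cons,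
    List.sum_nil, List.prod_cons, List.prod_nil, absSq_eq, twoRe_eq, map_sub, map_mul,
    hE]
  push_cast
  ring

theorem totalWeight_chi11Patterns (hE : ∀ a b c d, conj (E a b c d) = E b a d c) :
    totalWeight E chi11Patterns = coefXi1 E := by
  rw [totalWeight_eq E (u :=
    [(-4, [(0, 0, 1, 1), (1, 1, 1, 1)]), (-2, [(0, 1, 2, 1), (1, 0, 0, 1)]),
     (-4, [(0, 1, 1, 1), (1, 0, 1, 1)]), (-2, [(0, 1, 1, 0), (1, 0, 1, 2)]),
     (8, [(0, 0, 1, 1), (0, 1, 1, 0), (1, 0, 0, 1)]),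
     (4, [(0, 0, 0, 2), (0, 1, 1, 0), (1, 0, 1, 0)]),
     (8, [(0, 0, 1, 1), (0, 1, 0, 1), (1, 0, 1, 0)]),
     (4, [(0, 0, 2, 0), (0, 1, 0, 1), (1, 0, 0, 1)]),
     (4, [(0, 0, 1, 1), (0, 0, 1, 1), (1, 1, 0, 0)]), (1, [(1, 1, 2, 2)]),
     (-2, [(0, 1, 0, 1), (1, 0, 2, 1)]), (-1, [(0, 0, 0, 2), (1, 1, 2, 0)]),
     (-2, [(0, 1, 1, 2), (1, 0, 1, 0)]), (-1, [(0, 0, 2, 0), (1, 1, 0, 2)]),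
     (-1, [(0, 0, 2, 2), (1, 1, 0, 0)]), (-1, [(0, 1, 0, 2), (1, 0, 2, 0)]),
     (-2, [(0, 0, 1, 2), (1, 1, 1, 0)]), (-2, [(0, 0, 2, 1), (1, 1, 0, 1)]),
     (-1, [(0, 1, 2, 0), (1, 0, 0, 2)]), (2, [(0, 0, 0, 2), (0, 0, 2, 0), (1, 1, 0, 0)]),
     (-2, [(0, 0, 1, 1), (2, 2, 0, 0)]), (-4, [(1, 0, 0, 1), (1, 2, 1, 0)]),
     (-4, [(1, 0, 1, 1), (1, 2, 0, 0)]), (-8, [(1, 1, 0, 0), (1, 1, 1, 1)]),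
     (8, [(0, 0, 1, 1), (1, 1, 0, 0), (1, 1, 0, 0)]),
     (16, [(0, 1, 0, 1), (1, 0, 1, 0), (1, 1, 0, 0)]),
     (16, [(0, 1, 1, 0), (1, 0, 0, 1), (1, 1, 0, 0)]),
     (4, [(0, 0, 1, 1), (0, 2, 0, 0), (2, 0, 0, 0)]),
     (8, [(0, 2, 0, 0), (1, 0, 0, 1), (1, 0, 1, 0)]), (2, [(2, 2, 1, 1)]),
     (-4, [(0, 1, 0, 1), (2, 1, 1, 0)]), (-2, [(0, 2, 1, 1), (2, 0, 0, 0)]),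
     (-4, [(1, 0, 1, 0), (1, 2, 0, 1)]), (-4, [(0, 1, 1, 0), (2, 1, 0, 1)]),
     (-2, [(0, 2, 0, 0), (2, 0, 1, 1)]), (-2, [(0, 2, 0, 1), (2, 0, 1, 0)]),
     (-8, [(1, 1, 0, 1), (1, 1, 1, 0)]), (-2, [(0, 2, 1, 0), (2, 0, 0, 1)]),
     (-4, [(0, 1, 1, 1), (2, 1, 0, 0)]), (8, [(0, 1, 0, 1), (0, 1, 1, 0), (2, 0, 0, 0)]),
     (-9, [(1, 1, 0, 0), (2, 2, 0, 0)]), (-9, [(1, 2, 0, 0), (2, 1, 0, 0)]),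
     (12, [(1, 1, 0, 0), (1, 1, 0, 0), (1, 1, 0, 0)]),
     (18, [(0, 2, 0, 0), (1, 1, 0, 0), (2, 0, 0, 0)]), (1, [(3, 3, 0, 0)]),
     (-3, [(0, 2, 0, 0), (3, 1, 0, 0)]), (-3, [(1, 3, 0, 0), (2, 0, 0, 0)]),
     (-1, [(0, 3, 0, 0), (3, 0, 0, 0)])]) (by decide +kernel)]
  simp only [coefXi1, MomentPoly.eval, momentAt, List.map_cons, List.map_nil, List.sum_cons,
    List.sum_nil, List.prod_cons, List.prod_nil, absSq_eq, twoRe_eq, map_add, map_sub, map_mul,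
    map_ofNat, hE]
  push_cast
  ring

theorem conj_coef_eq (hE : ∀ a b c d, conj (E a b c d) = E b a d c) :
    conj (coefPhi1 E) = coefPhi1 E ∧ conj (coefPhi2 E) = coefPhi2 E ∧
    conj (coefPhi3 E) = coefPhi3 E ∧ conj (coefPsi1 E) = coefPsi1 E ∧
    conj (coefPsi4 E) = coefPsi4 E ∧ conj (coefLam3 E) = coefLam3 E ∧
    conj (coefLam6 E) = coefLam6 E ∧ conj (coefXi1 E) = coefXi1 E := by
  refine ⟨?_, ?_, ?_, ?_, ?_, ?_, ?_, ?_⟩ <;>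
  · simp only [coefPhi1, coefPhi2, coefPhi3, coefPsi1, coefPsi4, coefLam3, coefLam6, coefXi1,
      absSq_eq, twoRe_eq, map_add, map_sub, map_mul, map_pow, map_neg, map_ofNat,
      hE]
    ring

end Coefficients

/-! ### The moment weights in terms of the symbols -/

section Weights

variable {Ω : Type*} [MeasurableSpace Ω] {μ : Measure Ω}

theorem conj_moment (X Y : Ω → ℂ) (a b c d : ℕ) :
    conj (moment μ X Y a b c d) = moment μ X Y b a d c := by
  rw [moment, moment, ← integral_conj]
  congr 1 with ω
  simp only [map_mul, map_pow, Complex.conj_conj]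
  ring

/-- The monomial `z^a (z*)^b w^c (w*)^d`. -/
noncomputable def monomialAt (z w : ℂ) (x : Exponent) : ℂ :=
  z ^ x.1 * conj z ^ x.2.1 * w ^ x.2.2.1 * conj w ^ x.2.2.2

theorem monomialAt_add (z w : ℂ) (x y : Exponent) :
    monomialAt z w (x + y) = monomialAt z w x * monomialAt z w y := by
  simp only [monomialAt, Prod.fst_add, Prod.snd_add, pow_add]
  ring

/-- The polarisation selected by `e` relative to `q`. -/
def relPol (q : Fin 2) (e : Bool) : Fin 2 := if e then 1 - q else q

theorem letter_relPol (q : Fin 2) (e₁ e₂ : Bool) (v : Fin 2 → ℂ) (j : Fin 6) :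
    letter q (relPol q e₁) (relPol q e₂) v j =
      monomialAt (v q) (v (1 - q)) (letterExp e₁ e₂ j) := by
  have h : ∀ n : Fin 6, Even (n : ℕ) ↔ n = 0 ∨ n = 2 ∨ n = 4 := by decide
  simp only [letter, letterExp, h]
  fin_cases j <;> cases e₁ <;> cases e₂ <;> simp [relPol, monomialAt]

theorem prod_letter_relPol (q : Fin 2) (e₁ e₂ : Bool) (v : Fin 2 → ℂ) {b : List (Fin 6)}
    (hb : b.Nodup) : ∏ j ∈ b.toFinset, letter q (relPol q e₁) (relPol q e₂) v j =
      monomialAt (v q) (v (1 - q)) (blockExp e₁ e₂ b) := by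
  rw [List.prod_toFinset _ hb]
  clear hb
  induction b with
  | nil => simp [blockExp, monomialAt]
  | cons j b ih =>
    rw [List.map_cons, List.prod_cons, ih, letter_relPol, ← monomialAt_add]
    rfl

/-- The pattern moment as a function of the blocks. -/
noncomputable def partsMoment (μ : Measure Ω) (X : Ω → Fin 2 → ℂ) (q s t : Fin 2)
    (S : Finset (Finset (Fin 6))) : ℂ :=
  ∏ B ∈ S, ∫ ω, ∏ j ∈ B, letter q s t (X ω) j ∂μ

theorem partsMoment_pattern (X : Ω → Fin 2 → ℂ) (q : Fin 2) (e₁ e₂ : Bool) {d : Pattern}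
    (hd : d ∈ patterns) : partsMoment μ X q (relPol q e₁) (relPol q e₂) d.parts =
      (((d.map (blockExp e₁ e₂)).insertionSort fun x y => x.code ≤ y.code).map
        (momentAt (moment μ (fun ω => X ω q) fun ω => X ω (1 - q)))).prod := by
  obtain ⟨h1, h2⟩ := patterns_blocks d hd
  rw [((List.perm_insertionSort _ _).map _).prod_eq, partsMoment, Pattern.parts,
    List.prod_toFinset _ h1, List.map_map, List.map_map]
  congr 1
  refine List.map_congr_left fun b hb => ?_
  simp only [Function.comp, prod_letter_relPol q e₁ e₂ _ (h2 b hb)]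
  rfl

/-- Recording only whether `s` and `t` differ from `q` makes the weight polynomials independent of
`q`; one computation serves both polarisations. -/
theorem sum_relPol (q : Fin 2) (F : Fin 2 → Fin 2 → ℂ) :
    ∑ s, ∑ t, F s t = ([(false, false), (false, true), (true, false), (true, true)].map
      fun e => F (relPol q e.1) (relPol q e.2)).sum := by
  fin_cases q <;> simp [relPol, Fin.sum_univ_two] <;> ring

/-- The moment weight, summed over the polarisations, as a function of the blocks. -/
noncomputable def partsWeight (μ : Measure Ω) (X : Ω → Fin 2 → ℂ) (q : Fin 2)
    (T : Finset (Finset (Fin 6))) : ℂ :=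
  ∑ s : Fin 2, ∑ t : Fin 2, ∑ π : Finpartition (Finset.univ : Finset (Fin 6)),
    (exclParts π.parts T : ℂ) * partsMoment μ X q s t π.parts

theorem sum_deltaWeight (X : Ω → Fin 2 → ℂ) (q : Fin 2)
    (σ : Finpartition (Finset.univ : Finset (Fin 6))) :
    ∑ s : Fin 2, ∑ t : Fin 2, deltaWeight μ X q s t σ = partsWeight μ X q σ.parts := by
  simp only [deltaWeight, partsWeight, exclusion_eq]
  rfl

variable {a : ℕ → Ω → Fin 2 → ℂ}

/-- Any `π` refining `σ` has the same singleton as a block, and its moment contains a mean as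
factor. -/
theorem partsWeight_singleton (ha_mean : ∀ q, ∫ ω, a 0 ω q ∂μ = 0) (q : Fin 2)
    {σ : Finpartition (Finset.univ : Finset (Fin 6))} (h : ∃ B ∈ σ.parts, B.card ≤ 1) :
    partsWeight μ (a 0) q σ.parts = 0 := by
  refine Finset.sum_eq_zero fun s _ => Finset.sum_eq_zero fun t _ =>
    Finset.sum_eq_zero fun π _ => ?_
  obtain ⟨B, hB, hc⟩ := h
  by_cases hle : ∀ A ∈ π.parts, ∃ B ∈ σ.parts, A ⊆ B
  · obtain ⟨j, hj⟩ := σ.nonempty_of_mem_parts hB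
    have hA := π.part_mem.2 (Finset.mem_univ j)
    have hjA : j ∈ π.part j := π.mem_part (Finset.mem_univ j)
    obtain ⟨B', hB', hs⟩ := hle _ hA
    have : B' = B := σ.eq_of_mem_parts hB' hB (hs hjA) hj
    subst this
    have h0 : partsMoment μ (a 0) q s t π.parts = 0 :=
      patternMoment_singleton ha_mean q s t ⟨_, hA, (Finset.card_le_card hs).trans hc⟩
    rw [h0, mul_zero]
  · rw [exclParts, if_neg hle, Int.cast_zero, zero_mul]

theorem partsWeight_pattern (ha_mean : ∀ q, ∫ ω, a 0 ω q ∂μ = 0) (q : Fin 2) {c : Pattern}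
    (hc : c ∈ patterns) : partsWeight μ (a 0) q c.parts =
      MomentPoly.eval (moment μ (fun ω => a 0 ω q) fun ω => a 0 ω (1 - q)) (weightPoly c) := by
  rw [partsWeight, sum_relPol q, weightPoly, MomentPoly.eval_flatMap]
  refine congrArg List.sum (List.map_congr_left fun e _ => ?_)
  rw [sum_finpartition (fun S => (exclParts S c.parts : ℂ) * partsMoment μ (a 0) q _ _ S)]
  · rw [MomentPoly.eval, List.map_map]
    refine congrArg List.sum (List.map_congr_left fun d hd => ?_)
    rw [partsMoment_pattern (a 0) q e.1 e.2 hd,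
      excl_parts (patterns_blocks d hd).1 (patterns_blocks c hc).1]
    rfl
  · intro σ h
    have h0 : partsMoment μ (a 0) q (relPol q e.1) (relPol q e.2) σ.parts = 0 :=
      patternMoment_singleton ha_mean q _ _ h
    simp only [h0, mul_zero]

end Weights

/-! ### The reduced coefficient in terms of lattice sums -/

section Kept

variable {Ω : Type*} [MeasurableSpace Ω] {μ : Measure Ω} {a : ℕ → Ω → Fin 2 → ℂ}

theorem card_parts {c : Pattern} (hc : c ∈ patterns) : c.parts.card = c.length := by
  rw [Pattern.parts, List.toFinset_card_of_nodup (patterns_blocks c hc).1, List.length_map]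

theorem deltaSum_eq_sum {R : ℝ} (hR : 0 < R) {p : ℝ → ℝ} {P : ℝ → ℂ} (hP : IsPulseSpectrum R p P)
    (lk : Link) {W : ℕ} (hW : 0 < W) (i : ℤ) (S : Finset (Finset (Fin 6))) :
    deltaSum P lk (R / W) i S = ∑ v ∈ indexBox W, gridKernel P lk (R / W) (lineIndices i v) *
      ∏ B ∈ S, if blockFreq (lineIndices i v) B = 0 then 1 else 0 := by
  refine tsum_eq_sum fun v hv => ?_
  rw [gridKernel_lineIndices, gridAmp_mul_eq_zero hR hP lk hW i hv, zero_mul]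

theorem psdCoeffKept_eq_sum (ha_mean : ∀ q, ∫ ω, a 0 ω q ∂μ = 0) {R : ℝ} (hR : 0 < R)
    {p : ℝ → ℝ} {P : ℝ → ℂ} (hP : IsPulseSpectrum R p P) (lk : Link) {W : ℕ} (hW : 0 < W)
    (q : Fin 2) (i : ℤ) :
    psdCoeffKept μ (a 0) P lk (R / W) W q i = (8 / 9) ^ 2 * (lk.γ : ℂ) ^ 2 *
      (keptPatterns.map fun c => ((R / W : ℝ) : ℂ) ^ 5 * (W : ℂ) ^ c.parts.card *
        partsWeight μ (a 0) q c.parts * deltaSum P lk (R / W) i c.parts).sum := by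
  classical
  have hin : ∀ (T : Finset (Finpartition (Finset.univ : Finset (Fin 6))))
      (D : Finset (Finset (Fin 6)) → ℂ) (x : ℂ),
      ∑ s : Fin 2, ∑ t : Fin 2, ∑ σ ∈ T, x * (W : ℂ) ^ σ.parts.card * deltaWeight μ (a 0) q s t σ *
        D σ.parts = ∑ σ ∈ T, x * (W : ℂ) ^ σ.parts.card * partsWeight μ (a 0) q σ.parts *
          D σ.parts := by
    intro T D x
    rw [Finset.sum_congr rfl fun s _ => Finset.sum_comm, Finset.sum_comm]
    refine Finset.sum_congr rfl fun σ _ => ?_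
    simp only [← sum_deltaWeight, Finset.mul_sum, Finset.sum_mul]
  rw [← sum_kept (fun S => ((R / W : ℝ) : ℂ) ^ 5 * (W : ℂ) ^ S.card *
    partsWeight μ (a 0) q S * deltaSum P lk (R / W) i S)
    (fun σ h => by rw [partsWeight_singleton ha_mean q h, mul_zero, zero_mul]),
    psdCoeffKept, psdCoeff_eq_sum μ (a 0) hR hP lk hW, mul_assoc]
  refine congrArg _ ?_
  have hv : ∀ v, ∑ s : Fin 2, ∑ t : Fin 2, ∑ σ ∈ Finset.univ.filter (fun σ => ¬ IsBias σ),
      ((R / W : ℝ) : ℂ) ^ 3 * (W : ℂ) ^ σ.parts.card * deltaWeight μ (a 0) q s t σ *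
        ∏ B ∈ σ.parts, (if blockFreq (lineIndices i v) B = 0 then (1 : ℂ) else 0) =
      ∑ σ ∈ Finset.univ.filter (fun σ => ¬ IsBias σ),
        ((R / W : ℝ) : ℂ) ^ 3 * (W : ℂ) ^ σ.parts.card * partsWeight μ (a 0) q σ.parts *
          ∏ B ∈ σ.parts, (if blockFreq (lineIndices i v) B = 0 then (1 : ℂ) else 0) := fun v =>
    hin _ (fun S => ∏ B ∈ S, if blockFreq (lineIndices i v) B = 0 then 1 else 0) _
  simp only [hv, Finset.mul_sum]
  rw [Finset.sum_comm]
  refine Finset.sum_congr rfl fun σ _ => ?_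
  rw [deltaSum_eq_sum hR hP lk hW, Finset.mul_sum]
  exact Finset.sum_congr rfl fun v _ => by ring

/-- Power counting: `Δ ^ 5 W ^ n = R ^ n Δ ^ (5 - n)`, and the remaining power of `Δ` is the cell
volume for the `5 - n` indices left free by `n` blocks. -/
theorem sum_class {l : List Pattern} {n : ℕ} (hl : ∀ c ∈ l, c ∈ patterns ∧ c.length = n)
    (hn : n ≤ 5) (ha_mean : ∀ q, ∫ ω, a 0 ω q ∂μ = 0) {R : ℝ} {W : ℕ} (hW : 0 < W) (P : ℝ → ℂ)
    (lk : Link) (q : Fin 2) (i : ℤ) {A : ℂ}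
    (hg : ∀ c ∈ l, ((R / W : ℝ) : ℂ) ^ (5 - n) * deltaSum P lk (R / W) i c.parts = A) :
    (l.map fun c => ((R / W : ℝ) : ℂ) ^ 5 * (W : ℂ) ^ c.parts.card *
        partsWeight μ (a 0) q c.parts * deltaSum P lk (R / W) i c.parts).sum =
      (R : ℂ) ^ n *
        (totalWeight (moment μ (fun ω => a 0 ω q) fun ω => a 0 ω (1 - q)) l * A) := by
  have hW' : (W : ℂ) ≠ 0 := Nat.cast_ne_zero.2 hW.ne'
  have hΔ : ((R / W : ℝ) : ℂ) * W = R := by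
    push_cast
    field_simp
  rw [totalWeight, ← List.sum_map_mul_right, ← List.sum_map_mul_left]
  refine congrArg List.sum (List.map_congr_left fun c hc => ?_)
  obtain ⟨h1, h2⟩ := hl c hc
  rw [card_parts h1, h2, partsWeight_pattern ha_mean q h1, ← hg c hc, ← hΔ]
  have h5 : ((R / W : ℝ) : ℂ) ^ 5 = ((R / W : ℝ) : ℂ) ^ n * ((R / W : ℝ) : ℂ) ^ (5 - n) := by
    rw [← pow_add, Nat.add_sub_cancel' hn]
  rw [h5]
  ring

/-- The formula for the PSD with arbitrary values `x` of the frequency integrals. -/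
noncomputable def psdForm (E : ℕ → ℕ → ℕ → ℕ → ℂ) (γ R : ℝ) (x : Fin 11 → ℂ) : ℂ :=
  (8 / 9) ^ 2 * (γ : ℂ) ^ 2 *
    ((R : ℂ) ^ 3 * (coefPhi1 E * x 0 + coefPhi2 E * x 1 + coefPhi3 E * x 2) +
      (R : ℂ) ^ 2 * (coefPsi1 E * x 3 + twoRe (coefPsi2 E * x 4 + coefPsi3 E * conj (x 4)) +
        coefPsi4 E * x 5 + twoRe (coefLam1 E * x 6 + coefLam2 E * conj (x 6)) +
        coefLam3 E * x 7 + twoRe (coefLam4 E * x 8 + coefLam5 E * conj (x 8)) +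
        coefLam6 E * x 9) +
      (R : ℂ) * coefXi1 E * x 10)

/-- The lattice sums that approximate the frequency integrals. -/
noncomputable def gridChi (P : ℝ → ℂ) (lk : Link) (Δ : ℝ) (i : ℤ) : Fin 11 → ℂ :=
  ![gridChi1 P lk Δ i, gridChi2 P lk Δ i, gridChi3 P lk Δ i, gridChi4 P lk Δ i,
    gridChi5 P lk Δ i, gridChi6 P lk Δ i, gridChi7 P lk Δ i, gridChi8 P lk Δ i,
    gridChi9 P lk Δ i, gridChi10 P lk Δ i, gridChi11 P lk Δ i]

/-- The frequency integrals. -/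
noncomputable def chi (P : ℝ → ℂ) (lk : Link) (R f : ℝ) : Fin 11 → ℂ :=
  ![chi1 P lk R f, chi2 P lk R f, chi3 P lk R f, chi4 P lk R f, chi5 P lk R f, chi6 P lk R f,
    chi7 P lk R f, chi8 P lk R f, chi9 P lk R f, chi10 P lk R f, chi11 P lk R f]

theorem nliPSD_eq (X Y : Ω → ℂ) (P : ℝ → ℂ) (lk : Link) (R f : ℝ) :
    nliPSD μ X Y P lk R f = psdForm (moment μ X Y) lk.γ R (chi P lk R f) := rfl

/-- An exact identity at finite `W`: all combinatorics is finished here, and the limit concerns the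
lattice sums alone. -/
theorem psdCoeffKept_eq (ha_mean : ∀ q, ∫ ω, a 0 ω q ∂μ = 0) {R : ℝ} (hR : 0 < R)
    {p : ℝ → ℝ} {P : ℝ → ℂ} (hP : IsPulseSpectrum R p P) (lk : Link) {W : ℕ} (hW : 0 < W)
    (q : Fin 2) (i : ℤ) :
    psdCoeffKept μ (a 0) P lk (R / W) W q i =
      psdForm (moment μ (fun ω => a 0 ω q) fun ω => a 0 ω (1 - q)) lk.γ R
        (gridChi P lk (R / W) i) := by
  have hE := conj_moment (μ := μ) (fun ω => a 0 ω q) fun ω => a 0 ω (1 - q)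
  rw [psdCoeffKept_eq_sum ha_mean hR hP lk hW, keptPatterns]
  simp only [List.map_append, List.sum_append]
  rw [sum_class (l := chi1Patterns) (n := 3) (by decide +kernel) (by norm_num) ha_mean hW P lk q i
      fun c hc => deltaSum_chi1Patterns P lk (R / W) i hc, totalWeight_chi1Patterns hE]
  rw [sum_class (l := chi2Patterns) (n := 3) (by decide +kernel) (by norm_num) ha_mean hW P lk q i
      fun c hc => deltaSum_chi2Patterns P lk (R / W) i hc, totalWeight_chi2Patterns hE]
  rw [sum_class (l := chi3Patterns) (n := 3) (by decide +kernel) (by norm_num) ha_mean hW P lk q i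
      fun c hc => deltaSum_chi3Patterns P lk (R / W) i hc, totalWeight_chi3Patterns hE]
  rw [sum_class (l := chi4Patterns) (n := 2) (by decide +kernel) (by norm_num) ha_mean hW P lk q i
      fun c hc => deltaSum_chi4Patterns P lk (R / W) i hc, totalWeight_chi4Patterns hE]
  rw [sum_class (l := chi5Patterns) (n := 2) (by decide +kernel) (by norm_num) ha_mean hW P lk q i
      fun c hc => deltaSum_chi5Patterns P lk (R / W) i hc, totalWeight_chi5Patterns hE]
  rw [sum_class (l := chi5ConjPatterns) (n := 2) (by decide +kernel) (by norm_num) ha_mean hW P lk q i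
      fun c hc => deltaSum_chi5ConjPatterns P lk (R / W) i hc, totalWeight_chi5ConjPatterns hE]
  rw [sum_class (l := chi6Patterns) (n := 2) (by decide +kernel) (by norm_num) ha_mean hW P lk q i
      fun c hc => deltaSum_chi6Patterns P lk (R / W) i hc, totalWeight_chi6Patterns hE]
  rw [sum_class (l := chi7Patterns) (n := 2) (by decide +kernel) (by norm_num) ha_mean hW P lk q i
      fun c hc => deltaSum_chi7Patterns P lk (R / W) i hc, totalWeight_chi7Patterns hE]
  rw [sum_class (l := chi7ConjPatterns) (n := 2) (by decide +kernel) (by norm_num) ha_mean hW P lk q i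
      fun c hc => deltaSum_chi7ConjPatterns P lk (R / W) i hc, totalWeight_chi7ConjPatterns hE]
  rw [sum_class (l := chi8Patterns) (n := 2) (by decide +kernel) (by norm_num) ha_mean hW P lk q i
      fun c hc => deltaSum_chi8Patterns P lk (R / W) i hc, totalWeight_chi8Patterns hE]
  rw [sum_class (l := chi9Patterns) (n := 2) (by decide +kernel) (by norm_num) ha_mean hW P lk q i
      fun c hc => deltaSum_chi9Patterns P lk (R / W) i hc, totalWeight_chi9Patterns hE]
  rw [sum_class (l := chi9ConjPatterns) (n := 2) (by decide +kernel) (by norm_num) ha_mean hW P lk q i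
      fun c hc => deltaSum_chi9ConjPatterns P lk (R / W) i hc, totalWeight_chi9ConjPatterns hE]
  rw [sum_class (l := chi10Patterns) (n := 2) (by decide +kernel) (by norm_num) ha_mean hW P lk q i
      fun c hc => deltaSum_chi10Patterns P lk (R / W) i hc, totalWeight_chi10Patterns hE]
  rw [sum_class (l := chi11Patterns) (n := 1) (by decide +kernel) (by norm_num) ha_mean hW P lk q i
      fun c hc => deltaSum_chi11Patterns P lk (R / W) i hc, totalWeight_chi11Patterns hE]
  simp only [psdForm, gridChi, twoRe_eq, map_add, map_mul, Complex.conj_conj]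
  simp only [Fin.isValue, Matrix.cons_val]
  ring

end Kept

/-! ### The limit of the reduced PSD -/

section Limit

variable {R : ℝ} {p : ℝ → ℝ} {P : ℝ → ℂ} {lk : Link}

theorem conj_gridChi1 (P : ℝ → ℂ) (lk : Link) (Δ : ℝ) (i : ℤ) :
    conj (gridChi1 P lk Δ i) = gridChi1 P lk Δ i := by
  simp only [gridChi1, map_mul, map_pow, Complex.conj_ofReal, Complex.conj_tsum, conj_gridPair]

theorem conj_gridChi11 (P : ℝ → ℂ) (lk : Link) (Δ : ℝ) (i : ℤ) :
    conj (gridChi11 P lk Δ i) = gridChi11 P lk Δ i := by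
  let e : ℤ × ℤ × ℤ × ℤ ≃ ℤ × ℤ × ℤ × ℤ :=
    ⟨fun v => (v.2.2.1, v.2.2.2, v.1, v.2.1), fun v => (v.2.2.1, v.2.2.2, v.1, v.2.1),
      fun _ => rfl, fun _ => rfl⟩
  simp only [gridChi11, map_mul, map_pow, Complex.conj_ofReal, Complex.conj_tsum, conj_gridPair]
  congr 1
  exact e.tsum_eq fun v : ℤ × ℤ × ℤ × ℤ => gridPair P lk Δ i v.1 v.2.1 v.2.2.1 v.2.2.2

theorem tendsto_gridChi (hR : 0 < R) (hP : IsPulseSpectrum R p P) (hα : 0 < lk.α) (hL : 0 < lk.L)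
    {Δ : ℕ → ℝ} {i : ℕ → ℤ} {f : ℝ} (hΔ : IsMesh Δ R) (hif : SpectrumTo P Δ i f) :
    Tendsto (fun n => gridChi P lk (Δ n) (i n)) atTop (𝓝 (chi P lk R f)) := by
  refine tendsto_pi_nhds.2 fun j => ?_
  fin_cases j
  · exact tendsto_gridChi1 hR hP hα hL hΔ hif.grid
  · exact tendsto_gridChi2 hR hP hα hL hΔ hif.grid
  · exact tendsto_gridChi3 hR hP hα hL hΔ hif
  · exact tendsto_gridChi4 hR hP hα hL hΔ hif.grid
  · exact tendsto_gridChi5 hR hP hα hL hΔ hif.grid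
  · exact tendsto_gridChi6 hR hP hα hL hΔ hif.grid
  · exact tendsto_gridChi7 hR hP hα hL hΔ hif
  · exact tendsto_gridChi8 hR hP hα hL hΔ hif.grid
  · exact tendsto_gridChi9 hR hP hα hL hΔ hif.grid
  · exact tendsto_gridChi10 hR hP hα hL hΔ hif.grid
  · exact tendsto_gridChi11 hR hP hα hL hΔ hif.grid

theorem exists_norm_gridChi_le (hR : 0 < R) (hP : IsPulseSpectrum R p P) (hα : 0 < lk.α)
    (hL : 0 < lk.L) :
    ∃ C, 0 ≤ C ∧ ∀ Δ i, 0 < Δ → Δ ≤ R → ‖gridChi P lk Δ i‖ ≤ C := by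
  obtain ⟨C, h0, hC⟩ := exists_norm_gridPair_le hP hα hL
  -- Length of the support interval `[-R / 2, R / 2]` enlarged on both sides by the largest mesh
  -- `R`; one factor arises per summation index.
  set b := 2 * (R / 2 + R) with hb
  have hb0 : 0 ≤ b := by positivity
  refine ⟨C * (b * b) + C * (b * b * b) + C * (b * b * b * b), by positivity,
    fun Δ i hΔ hD => ?_⟩
  have hM := (half_pos hR).le
  have p2 : 0 ≤ C * (b * b) := by positivity
  have p3 : 0 ≤ C * (b * b * b) := by positivity
  have p4 : 0 ≤ C * (b * b * b * b) := by positivity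
  refine (pi_norm_le_iff_of_nonneg (by positivity)).2 fun j => ?_
  fin_cases j
  · refine (norm_lattice_sum₂_le hΔ hD hM (fun v => hC _ _ _ _ _ _) fun v hv => ?_).trans
      (by rw [← hb]; linarith)
    obtain ⟨v0, v1⟩ := v
    simp only [lt_norm_prod_iff hΔ, lt_norm_int_iff hΔ] at hv
    exact gridPair_eq_zero hP lk _ (by tauto)
  · refine (norm_lattice_sum₂_le hΔ hD hM (fun v => hC _ _ _ _ _ _) fun v hv => ?_).trans
      (by rw [← hb]; linarith)
    obtain ⟨v0, v1⟩ := v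
    simp only [lt_norm_prod_iff hΔ, lt_norm_int_iff hΔ] at hv
    exact gridPair_eq_zero hP lk _ (by tauto)
  · refine (norm_lattice_sum₂_le hΔ hD hM (fun v => hC _ _ _ _ _ _) fun v hv => ?_).trans
      (by rw [← hb]; linarith)
    obtain ⟨v0, v1⟩ := v
    simp only [lt_norm_prod_iff hΔ, lt_norm_int_iff hΔ] at hv
    exact gridPair_eq_zero hP lk _ (by tauto)
  · refine (norm_lattice_sum₃_le hΔ hD hM (fun v => hC _ _ _ _ _ _) fun v hv => ?_).trans
      (by rw [← hb]; linarith)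
    obtain ⟨v0, v1, v2⟩ := v
    simp only [lt_norm_prod_iff hΔ, lt_norm_int_iff hΔ] at hv
    exact gridPair_eq_zero hP lk _ (by tauto)
  · refine (norm_lattice_sum₃_le hΔ hD hM (fun v => hC _ _ _ _ _ _) fun v hv => ?_).trans
      (by rw [← hb]; linarith)
    obtain ⟨v0, v1, v2⟩ := v
    simp only [lt_norm_prod_iff hΔ, lt_norm_int_iff hΔ] at hv
    exact gridPair_eq_zero hP lk _ (by tauto)
  · refine (norm_lattice_sum₃_le hΔ hD hM (fun v => hC _ _ _ _ _ _) fun v hv => ?_).trans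
      (by rw [← hb]; linarith)
    obtain ⟨v0, v1, v2⟩ := v
    simp only [lt_norm_prod_iff hΔ, lt_norm_int_iff hΔ] at hv
    exact gridPair_eq_zero hP lk _ (by tauto)
  · refine (norm_lattice_sum₃_le hΔ hD hM (fun v => hC _ _ _ _ _ _) fun v hv => ?_).trans
      (by rw [← hb]; linarith)
    obtain ⟨v0, v1, v2⟩ := v
    simp only [lt_norm_prod_iff hΔ, lt_norm_int_iff hΔ] at hv
    exact gridPair_eq_zero hP lk _ (by tauto)
  · refine (norm_lattice_sum₃_le hΔ hD hM (fun v => hC _ _ _ _ _ _) fun v hv => ?_).trans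
      (by rw [← hb]; linarith)
    obtain ⟨v0, v1, v2⟩ := v
    simp only [lt_norm_prod_iff hΔ, lt_norm_int_iff hΔ] at hv
    exact gridPair_eq_zero hP lk _ (by tauto)
  · refine (norm_lattice_sum₃_le hΔ hD hM (fun v => hC _ _ _ _ _ _) fun v hv => ?_).trans
      (by rw [← hb]; linarith)
    obtain ⟨v0, v1, v2⟩ := v
    simp only [lt_norm_prod_iff hΔ, lt_norm_int_iff hΔ] at hv
    exact gridPair_eq_zero hP lk _ (by tauto)
  · refine (norm_lattice_sum₃_le hΔ hD hM (fun v => hC _ _ _ _ _ _) fun v hv => ?_).trans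
      (by rw [← hb]; linarith)
    obtain ⟨v0, v1, v2⟩ := v
    simp only [lt_norm_prod_iff hΔ, lt_norm_int_iff hΔ] at hv
    exact gridPair_eq_zero hP lk _ (by tauto)
  · refine (norm_lattice_sum₄_le hΔ hD hM (fun v => hC _ _ _ _ _ _) fun v hv => ?_).trans
      (by rw [← hb]; linarith)
    obtain ⟨v0, v1, v2, v3⟩ := v
    simp only [lt_norm_prod_iff hΔ, lt_norm_int_iff hΔ] at hv
    exact gridPair_eq_zero hP lk _ (by tauto)

/-- Since `i = k - m + n` and each line has frequency at most `R / 2` in modulus, the interference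
is confined to `3 R / 2`. -/
theorem gridPair_eq_zero_of_line (hP : IsPulseSpectrum R p P) (lk : Link) {Δ : ℝ} {i : ℤ}
    (h : 3 * R / 2 < |(i : ℝ) * Δ|) (k m k' m' : ℤ) : gridPair P lk Δ i k m k' m' = 0 := by
  by_cases hk : R / 2 < |(k : ℝ) * Δ|
  · exact gridPair_eq_zero hP lk i (Or.inl hk)
  by_cases hm : R / 2 < |(m : ℝ) * Δ|
  · exact gridPair_eq_zero hP lk i (Or.inr (Or.inl hm))
  have hn : R / 2 < |((i - k + m : ℤ) : ℝ) * Δ| := by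
    by_contra hn
    rw [not_lt, abs_le] at hk hm hn
    push_cast at hn
    rcases lt_abs.1 h with h | h <;> linarith [hk.1, hk.2, hm.1, hm.2, hn.1, hn.2]
  rw [gridPair, gridAmp, hP.bandlimited _ hn]
  simp

theorem gridChi_eq_zero (hP : IsPulseSpectrum R p P) (lk : Link) {Δ : ℝ} {i : ℤ}
    (h : 3 * R / 2 < |(i : ℝ) * Δ|) : gridChi P lk Δ i = 0 := by
  have h0 := gridPair_eq_zero_of_line hP lk h
  funext j
  fin_cases j <;>
  simp [gridChi, gridChi1, gridChi2, gridChi3, gridChi4, gridChi5, gridChi6, gridChi7, gridChi8,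
    gridChi9, gridChi10, gridChi11, h0]

theorem continuous_psdForm (E : ℕ → ℕ → ℕ → ℕ → ℂ) (γ R : ℝ) : Continuous (psdForm E γ R) := by
  unfold psdForm
  simp only [twoRe_eq]
  fun_prop

theorem psdForm_zero (E : ℕ → ℕ → ℕ → ℕ → ℂ) (γ R : ℝ) : psdForm E γ R 0 = 0 := by
  simp [psdForm, twoRe_eq]

theorem exists_norm_psdForm_le (E : ℕ → ℕ → ℕ → ℕ → ℂ) (γ R C : ℝ) :
    ∃ C', ∀ x, ‖x‖ ≤ C → ‖psdForm E γ R x‖ ≤ C' := by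
  obtain ⟨C', h⟩ := (isCompact_closedBall (0 : Fin 11 → ℂ) C).exists_bound_of_continuousOn
    (continuous_psdForm E γ R).continuousOn
  exact ⟨C', fun x hx => h x (mem_closedBall_zero_iff.2 hx)⟩

/-- The maximum with `1` excludes the mesh `R / 0 = 0` and changes only finitely many terms. -/
theorem isMesh_div (hR : 0 < R) {W : ℕ → ℕ} (hW : Tendsto W atTop atTop) :
    IsMesh (fun n => R / (max (W n) 1 : ℕ)) R where
  pos n := div_pos hR (Nat.cast_pos.2 (by omega))
  le n := div_le_self hR.le (Nat.one_le_cast.2 (by omega))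
  tendsto := (tendsto_const_nhds (x := R)).div_atTop (tendsto_natCast_atTop_atTop.comp
    (tendsto_atTop_mono (fun n => le_max_left (W n) 1) hW))

theorem eventually_max_eq {W : ℕ → ℕ} (hW : Tendsto W atTop atTop) :
    ∀ᶠ n in atTop, max (W n) 1 = W n :=
  (hW.eventually_ge_atTop 1).mono fun _ h => max_eq_left h

/-- Reality passes to the limit along the rounded frequencies, for every `f`. The excluded indices
are `χ₅`, `χ₇`, `χ₉`, which enter only through real parts. `χ₃` is visibly real and is treated
directly, as `P` may be discontinuous at `f`. -/
theorem conj_chi (hR : 0 < R) (hP : IsPulseSpectrum R p P) (hα : 0 < lk.α) (hL : 0 < lk.L)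
    (f : ℝ) : ∀ j : Fin 11, j ≠ 4 → j ≠ 6 → j ≠ 8 → conj (chi P lk R f j) = chi P lk R f j := by
  have hΔ := isMesh_div hR tendsto_id
  have hi := hΔ.gridTo_floor f
  have key : ∀ {g : ℝ → ℤ → ℂ} {x : ℂ}, (∀ Δ i, conj (g Δ i) = g Δ i) →
      Tendsto (fun n => g (R / (max (id n) 1 : ℕ)) ⌊f / (R / (max (id n) 1 : ℕ))⌋) atTop (𝓝 x) →
      conj x = x := fun {g x} hg hx => by
    refine tendsto_nhds_unique ((Complex.continuous_conj.tendsto x).comp hx) ?_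
    simpa only [Function.comp_def, hg] using hx
  intro j h4 h6 h8
  fin_cases j
  · exact key (conj_gridChi1 P lk) (tendsto_gridChi1 hR hP hα hL hΔ hi)
  · exact key (conj_gridChi2 P lk) (tendsto_gridChi2 hR hP hα hL hΔ hi)
  · simp [chi, chi3, absSq]
  · exact key (conj_gridChi4 P lk) (tendsto_gridChi4 hR hP hα hL hΔ hi)
  · exact absurd rfl h4
  · exact key (conj_gridChi6 P lk) (tendsto_gridChi6 hR hP hα hL hΔ hi)
  · exact absurd rfl h6
  · exact key (conj_gridChi8 P lk) (tendsto_gridChi8 hR hP hα hL hΔ hi)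
  · exact absurd rfl h8
  · exact key (conj_gridChi10 P lk) (tendsto_gridChi10 hR hP hα hL hΔ hi)
  · exact key (conj_gridChi11 P lk) (tendsto_gridChi11 hR hP hα hL hΔ hi)

variable {Ω : Type*} [MeasurableSpace Ω] {μ : Measure Ω} {a : ℕ → Ω → Fin 2 → ℂ}

theorem conj_nliPSD (hR : 0 < R) (hP : IsPulseSpectrum R p P) (hα : 0 < lk.α) (hL : 0 < lk.L)
    (X Y : Ω → ℂ) (f : ℝ) : conj (nliPSD μ X Y P lk R f) = nliPSD μ X Y P lk R f := by
  obtain ⟨c1, c2, c3, c4, c6, c8, c10, c11⟩ := conj_coef_eq (conj_moment (μ := μ) X Y)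
  have hc := conj_chi hR hP hα hL f
  rw [nliPSD_eq, psdForm]
  simp only [twoRe_eq, map_mul, map_add, map_pow, map_div₀, map_ofNat, Complex.conj_ofReal,
    Complex.conj_conj, c1, c2, c3, c4, c6, c8, c10, c11, hc 0 (by decide) (by decide) (by decide),
    hc 1 (by decide) (by decide) (by decide), hc 2 (by decide) (by decide) (by decide),
    hc 3 (by decide) (by decide) (by decide), hc 5 (by decide) (by decide) (by decide),
    hc 7 (by decide) (by decide) (by decide), hc 9 (by decide) (by decide) (by decide),
    hc 10 (by decide) (by decide) (by decide)]
  ring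

theorem tendsto_psdCoeffKept (ha_mean : ∀ q, ∫ ω, a 0 ω q ∂μ = 0) (hR : 0 < R)
    (hP : IsPulseSpectrum R p P) (hα : 0 < lk.α) (hL : 0 < lk.L) (q : Fin 2) {f : ℝ} {W : ℕ → ℕ}
    {i : ℕ → ℤ} (hW : Tendsto W atTop atTop)
    (hi : Tendsto (fun n => (i n : ℝ) * (R / W n)) atTop (𝓝 f))
    (hPi : Tendsto (fun n => P ((i n : ℝ) * (R / W n))) atTop (𝓝 (P f))) :
    Tendsto (fun n => psdCoeffKept μ (a 0) P lk (R / W n) (W n) q (i n)) atTop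
      (𝓝 (nliPSD μ (fun ω => a 0 ω q) (fun ω => a 0 ω (1 - q)) P lk R f)) := by
  have he := eventually_max_eq hW
  have hΔ := isMesh_div hR hW
  have hif : SpectrumTo P (fun n => R / (max (W n) 1 : ℕ)) i f :=
    ⟨hi.congr' (by filter_upwards [he] with n hn; rw [hn]),
      hPi.congr' (by filter_upwards [he] with n hn; rw [hn])⟩
  rw [nliPSD_eq]
  refine (((continuous_psdForm _ _ _).tendsto _).comp
    (tendsto_gridChi hR hP hα hL hΔ hif)).congr' ?_
  filter_upwards [he] with n hn
  rw [Function.comp_apply, hn, psdCoeffKept_eq ha_mean hR hP lk (by omega)]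

/-- The sum over lines is one more lattice sum, so convergence at the continuity points of `P` and
`Q` suffices; integrability of the limit comes along. The alternative in `hQ` serves two uses: a
weight supported in `[-M, M]`, or `M = 3 R / 2`, beyond which the coefficient itself vanishes. -/
theorem tendsto_sum_psdCoeffKept (ha_mean : ∀ q, ∫ ω, a 0 ω q ∂μ = 0) (hR : 0 < R)
    (hP : IsPulseSpectrum R p P) (hα : 0 < lk.α) (hL : 0 < lk.L) (q : Fin 2) {Q : ℝ → ℂ}
    {B M : ℝ} (hM : 0 ≤ M) (hB : ∀ x, |x| ≤ 3 * R / 2 → ‖Q x‖ ≤ B)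
    (hQ : ∀ x, M < |x| → 3 * R / 2 < |x| ∨ Q x = 0) (hc : ∀ᵐ x, ContinuousAt Q x) :
    Tendsto (fun W : ℕ => ∑' i : ℤ, ((R / W : ℝ) : ℂ) *
        psdCoeffKept μ (a 0) P lk (R / W) W q i * Q ((i : ℝ) * (R / W))) atTop
      (𝓝 (∫ f : ℝ, nliPSD μ (fun ω => a 0 ω q) (fun ω => a 0 ω (1 - q)) P lk R f * Q f)) ∧
    Integrable (fun f : ℝ =>
      nliPSD μ (fun ω => a 0 ω q) (fun ω => a 0 ω (1 - q)) P lk R f * Q f) ∧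
    (∫ f : ℝ, nliPSD μ (fun ω => a 0 ω q) (fun ω => a 0 ω (1 - q)) P lk R f * Q f) =
      ∫ f in (-M)..M, nliPSD μ (fun ω => a 0 ω q) (fun ω => a 0 ω (1 - q)) P lk R f * Q f := by
  have hΔ := isMesh_div hR tendsto_id
  set E := moment μ (fun ω => a 0 ω q) fun ω => a 0 ω (1 - q) with hE
  simp only [nliPSD_eq]
  obtain ⟨C, -, hC⟩ := exists_norm_gridChi_le hR hP hα hL
  obtain ⟨C', hC'⟩ := exists_norm_psdForm_le E lk.γ R C
  have hC0 : 0 ≤ C' := (norm_nonneg _).trans (hC' _ (hC R 0 hR le_rfl))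
  have hB0 : 0 ≤ B := (norm_nonneg _).trans (hB 0 (by rw [abs_zero]; positivity))
  have hz : ∀ (Δ : ℝ) (i : ℤ), 3 * R / 2 < |(i : ℝ) * Δ| →
      psdForm E lk.γ R (gridChi P lk Δ i) = 0 := fun Δ i h => by
    rw [gridChi_eq_zero hP lk h, psdForm_zero]
  obtain ⟨h1, h2, h3⟩ := tendsto_lattice_sum hΔ hM (C := C' * B)
    (h := fun n k => psdForm E lk.γ R (gridChi P lk (R / (max (id n) 1 : ℕ)) k) *
      Q ((k : ℝ) * (R / (max (id n) 1 : ℕ))))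
    (H := fun f => psdForm E lk.γ R (chi P lk R f) * Q f)
    (fun n k => by
      rcases lt_or_ge (3 * R / 2) |(k : ℝ) * (R / (max (id n) 1 : ℕ))| with h | h
      · rw [hz _ _ h, zero_mul, norm_zero]
        positivity
      · rw [norm_mul]
        exact mul_le_mul (hC' _ (hC _ _ (hΔ.pos n) (hΔ.le n))) (hB _ h) (norm_nonneg _) hC0)
    (fun n k h => by
      rcases hQ _ h with h | h
      · rw [hz _ _ h, zero_mul]
      · rw [h, mul_zero])
    (by
      filter_upwards [hP.ae_continuousAt, hc] with x hx hxQ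
      have hi := hΔ.gridTo_floor x
      exact (((continuous_psdForm _ _ _).tendsto _).comp
        (tendsto_gridChi hR hP hα hL hΔ (hi.spectrum hx))).mul (hxQ.tendsto.comp hi))
  refine ⟨h1.congr' ?_, h2, h3⟩
  filter_upwards [eventually_ge_atTop 1] with n hn
  rw [id, max_eq_left hn, ← tsum_mul_left]
  refine tsum_congr fun k => ?_
  rw [psdCoeffKept_eq ha_mean hR hP lk (by omega), mul_assoc]

end Limit

end FibreNLI

/-! ### The theorem on the NLI spectrum and power -/

theorem mainTheorem1 {Ω : Type*} [MeasurableSpace Ω] (μ : Measure Ω) [IsProbabilityMeasure μ]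
    (a : ℕ → Ω → Fin 2 → ℂ) (ha_meas : ∀ n, Measurable (a n))
    (ha_indep : iIndepFun a μ) (ha_ident : ∀ n, IdentDistrib (a n) (a 0) μ μ)
    (ha_six : ∀ q, MemLp (fun ω => a 0 ω q) 6 μ)
    (ha_mean : ∀ q, ∫ ω, a 0 ω q ∂μ = 0)
    (R : ℝ) (hR : 0 < R) (p : ℝ → ℝ) (P : ℝ → ℂ) (hP : FibreNLI.IsPulseSpectrum R p P)
    (lk : FibreNLI.Link) (hα : 0 < lk.α) (hL : 0 < lk.L) :
    (∀ W : ℕ, 0 < W → ∀ ω, ∃! c : Fin 2 → ℤ → ℂ,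
      FibreNLI.IsReceivedNLI lk (R / W) (FibreNLI.launch P (R / W) W (fun n => a n ω)) c) ∧
    (∀ (W : ℕ) (c : Ω → Fin 2 → ℤ → ℂ), 0 < W →
      (∀ ω, FibreNLI.IsReceivedNLI lk (R / W)
        (FibreNLI.launch P (R / W) W (fun n => a n ω)) (c ω)) →
      ∀ q i, Integrable (fun ω => ‖c ω q i‖ ^ 2) μ ∧
        ((∫ ω, ‖c ω q i‖ ^ 2 ∂μ : ℝ) : ℂ) =
          ((R / W : ℝ) : ℂ) * FibreNLI.psdCoeffFull μ (a 0) P lk (R / W) W q i) ∧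
    ∃ S : Fin 2 → ℝ → ℝ,
      (∀ q f, (S q f : ℂ) =
        FibreNLI.nliPSD μ (fun ω => a 0 ω q) (fun ω => a 0 ω (1 - q)) P lk R f) ∧
      (∀ (q : Fin 2) (f : ℝ) (W : ℕ → ℕ) (i : ℕ → ℤ), Tendsto W atTop atTop →
        Tendsto (fun n => (i n : ℝ) * (R / W n)) atTop (𝓝 f) →
        Tendsto (fun n => P ((i n : ℝ) * (R / W n))) atTop (𝓝 (P f)) →
        Tendsto (fun n => FibreNLI.psdCoeffKept μ (a 0) P lk (R / W n) (W n) q (i n)) atTop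
          (𝓝 (S q f : ℂ))) ∧
      (∀ (q : Fin 2) (ψ : ℝ → ℂ), Continuous ψ →
        Tendsto (fun W : ℕ => ∑' i : ℤ, ((R / W : ℝ) : ℂ) *
            FibreNLI.psdCoeffKept μ (a 0) P lk (R / W) W q i * ψ ((i : ℝ) * (R / W))) atTop
          (𝓝 (∫ f : ℝ, (S q f : ℂ) * ψ f))) ∧
      (∀ q : Fin 2, Integrable (fun f : ℝ => S q f * ‖P f‖ ^ 2) ∧
        (∫ f : ℝ, S q f * ‖P f‖ ^ 2) = ∫ f in (-(R / 2))..(R / 2), S q f * ‖P f‖ ^ 2) ∧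
      (∀ q : Fin 2, Tendsto (fun W : ℕ => ∑' i : ℤ, ((R / W : ℝ) : ℂ) *
            FibreNLI.psdCoeffKept μ (a 0) P lk (R / W) W q i *
            (‖P ((i : ℝ) * (R / W))‖ ^ 2 : ℝ)) atTop
          (𝓝 ((∫ f : ℝ, S q f * ‖P f‖ ^ 2 : ℝ) : ℂ))) := by
  have hΔ : ∀ {W : ℕ}, 0 < W → ∀ (u : ℕ → Fin 2 → ℂ) q (k : ℤ), (W : ℤ) < |k| →
      FibreNLI.launch P (R / W) W u q k = 0 := fun hW u q k hk => by
    simp [FibreNLI.launch, hP.eq_zero_of_index hR hW hk]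
  -- The witness is the real part of `nliPSD`, which is its own conjugate.
  obtain ⟨S, hS⟩ : ∃ S : Fin 2 → ℝ → ℝ, ∀ q f, (S q f : ℂ) =
      FibreNLI.nliPSD μ (fun ω => a 0 ω q) (fun ω => a 0 ω (1 - q)) P lk R f :=
    ⟨_, fun q f => Complex.conj_eq_iff_re.1 (FibreNLI.conj_nliPSD hR hP hα hL _ _ f)⟩
  refine ⟨fun W hW ω => ?_, fun W c hW hc q i => ?_, S, hS, ?_⟩
  · simp only [FibreNLI.isReceivedNLI_iff hα hL (R / W) (hΔ hW _)]
    exact existsUnique_eq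
  · have h : ∀ ω, c ω =
        FibreNLI.nliLine lk (R / W) (FibreNLI.launch P (R / W) W fun n => a n ω) := fun ω =>
      (FibreNLI.isReceivedNLI_iff hα hL (R / W) (hΔ hW _) _).1 (hc ω)
    simp only [h]
    exact FibreNLI.integral_normSq_nliLine ha_meas ha_indep ha_ident ha_six ha_mean hR hP lk hW q i
  obtain ⟨B, hB⟩ := hP.bounded
  have hB0 : 0 ≤ B := (norm_nonneg _).trans (hB 0)
  -- The weight `|P|²` is supported in the band, so `M = R / 2` gives the integral over `[-R / 2, R
  -- / 2]` as well as the limit.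
  have hpow := fun q => FibreNLI.tendsto_sum_psdCoeffKept ha_mean hR hP hα hL q
    (Q := fun f => ((‖P f‖ ^ 2 : ℝ) : ℂ)) (B := B ^ 2) (M := R / 2) (half_pos hR).le
    (fun x _ => by
      rw [Complex.norm_real, Real.norm_of_nonneg (by positivity)]
      exact pow_le_pow_left₀ (norm_nonneg _) (hB x) 2)
    (fun x hx => Or.inr (by simp [hP.bandlimited x hx]))
    (by
      filter_upwards [hP.ae_continuousAt] with x hx
      exact (Complex.continuous_ofReal.continuousAt).comp (hx.norm.pow 2))
  simp only [← hS, ← Complex.ofReal_mul, integral_complex_ofReal,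
    intervalIntegral.integral_ofReal] at hpow
  refine ⟨fun q f W i hW hi hPi => ?_, fun q ψ hψ => ?_, fun q => ⟨?_, ?_⟩, fun q => ?_⟩
  · rw [hS]
    exact FibreNLI.tendsto_psdCoeffKept ha_mean hR hP hα hL q hW hi hPi
  · simp only [hS]
    -- No growth condition on `ψ` is needed, because the reduced PSD vanishes outside `[-3 R / 2, 3
    -- R / 2]`.
    obtain ⟨B', hB'⟩ := (isCompact_closedBall (0 : ℝ) (3 * R / 2)).exists_bound_of_continuousOn
      hψ.continuousOn
    exact (FibreNLI.tendsto_sum_psdCoeffKept ha_mean hR hP hα hL q (M := 3 * R / 2) (by positivity)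
      (fun x hx => hB' x (mem_closedBall_zero_iff.2 hx)) (fun x hx => Or.inl hx)
      (Eventually.of_forall fun x => hψ.continuousAt)).1
  · exact (hpow q).2.1.re
  · exact_mod_cast (hpow q).2.2
  · simpa only [Complex.ofReal_mul] using (hpow q).1
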